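/- **Setting.** Let $k$ be an algebraically closed field of characteristic $p>0$, and let $X,Y,H$ be the standard basis of $\mathfrak{sl}_2(\mathbb C)$. Let $\mathcal U_{\mathbb Z}$ be the subring of the universal enveloping algebra of $\mathfrak{sl}_2(\mathbb C)$ generated by all $X^{(m)}=X^m/m!$ and $Y^{(m)}=Y^m/m!$ ($m\ge 0$), and let $\mathcal U=\mathcal U_{\mathbb Z}\otimes_{\mathbb Z}k$. For $c\in\mathbb Z$ the elements $\binom{H+c}{m}=(H+c)(H+c-1)\cdots(H+c-m+1)/m!$ lie in $\mathcal U_{\mathbb Z}$; images in $\mathcal U$ are denoted by the same symbols. The elements $Y^{(m)}\binom Hn X^{(m')}$ ($m,n,m'\ge0$) form a $k$-basis of $\mathcal U$. Let ${\rm Fr}':\mathcal U\to\mathcal U$ be the $k$-linear map with $Y^{(m)}\binom Hn X^{(m')}\mapsto Y^{(mp)}\binom H{np}X^{(m'p)}$. For $r\ge 1$ let $\mathcal U_r$ be the subalgebra generated by $X^{(p^i)},Y^{(p^i)}$ ($0\le i\le r-1$); let $\mathcal A$ be the subalgebra generated by all $\binom H{p^i}$ and all $Y^{(p^i)}X^{(p^i)}$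 ($i\ge0$); and put $\mathcal A_r=\mathcal A\cap\mathcal U_r$. **The elements $B^{(\varepsilon)}(a,j)$.** Put $\mu_a=\binom{H-a-1}{p-1}$. Let $\varepsilon\in\{0,1\}$. If $p$ is odd, let $\mathcal P=\{0,\dots,p-1\}\times\{0,\dots,(p-1)/2\}$. In $\mathbb F_p[x]$ put $\varphi_{a,m}(x)=\prod_{i=0}^{m-1}(x-i(i+a+1))$, $\psi_j^{(1)}(x)=\big(\prod_{i\in\mathbb F_p}(x-i^2)\big)/(x-j^2)$, $\psi_0^{(0)}(x)=\prod_{i\in\mathbb F_p^\times}(x-i^2)$ and, for $j\ne0$, $\psi_j^{(0)}(x)=2x(x+j^2)\prod_{i\in\mathbb F_p^\times\setminus\{j,-j\}}(x-i^2)$. For $(a,j)\in\mathcal P$ put $B^{(\varepsilon)}(a,j)=\psi_j^{(\varepsilon)}\big(\mu_aYX+(\tfrac{a+1}2)^2\big)\mu_a$, and let $n^{(\varepsilon)}(a,j)$ be the largest $n\ge0$ such that $\varphi_{a,n}(x)$ divides $\psi_j^{(\varepsilon)}\big(x+(\tfrac{a+1}2)^2\big)$. If $p=2$, let $\mathcal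 P=\{(0,\tfrac12),(1,0),(1,1)\}$ and put $B^{(0)}(0,\tfrac12)=\mu_0$, $B^{(1)}(0,\tfrac12)=\mu_0YX$, $B^{(0)}(1,0)=B^{(1)}(1,0)=\mu_1YX$, $B^{(0)}(1,1)=B^{(1)}(1,1)=\mu_1YX+\mu_1$; $n^{(0)}(0,\tfrac12)=0$, $n^{(1)}(0,\tfrac12)=1$, $n^{(\varepsilon)}(1,0)=1$, $n^{(\varepsilon)}(1,1)=0$. Write $B^{(\varepsilon)}(a,j)=\mu_a\sum_{m=n^{(\varepsilon)}(a,j)}^{p-1}c_m^{(\varepsilon)}Y^mX^m$ with $c_m^{(\varepsilon)}\in k$ (the coefficients exist and are unique). Consider the conditions (A): $a$ is even and $(p-a+1)/2\le j\le(p-1)/2$; and (C): $a$ is odd and $0\le j\le(a-1)/2$. When (A) or (C) holds put $s(a,j)=(p-a+1)/2$ if $p$ is odd and $a$ even, $s(a,j)=(p-a)/2$ if $p$ and $a$ are odd, and $s(a,j)=1$ if $p=2$. For $z\in\mathcal U$ let $$Z^{(\varepsilon)}(z;(a,j))=\mu_a\sum_{m=n^{(\varepsilon)}(a,j)}^{p-1}c_m^{(\varepsilon)}\,Y^mX^{m-s(a,j)}\,{\rm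 Fr}'(z)\,X^{s(a,j)}$$ if (A) or (C) holds, and $Z^{(\varepsilon)}(z;(a,j))={\rm Fr}'(z)B^{(\varepsilon)}(a,j)$ otherwise. For $\boldsymbol\varepsilon=(\varepsilon_0,\dots,\varepsilon_{r-1})\in\{0,1\}^r$ and $(\mathbf a,\mathbf j)=((a_i,j_i))_{i=0}^{r-1}\in\mathcal P^r$ define $B^{(\boldsymbol\varepsilon)}(\mathbf a,\mathbf j)=B^{(\varepsilon_0)}(a_0,j_0)$ if $r=1$, and $B^{(\boldsymbol\varepsilon)}(\mathbf a,\mathbf j)=Z^{(\varepsilon_0)}\big(B^{(\varepsilon_1,\dots,\varepsilon_{r-1})}((a_i,j_i)_{i=1}^{r-1});(a_0,j_0)\big)$ if $r\ge2$. Put $E(\mathbf a,\mathbf j)=B^{(0,\dots,0)}(\mathbf a,\mathbf j)$. **Index sets.** Call an index $i$ *degenerate* if $j_i=0$ (for $p$ odd), respectively $a_i=1$ (for $p=2$). Let $\mathcal X_r(\mathbf a,\mathbf j)$ be the set of $\boldsymbol\varepsilon\in\{0,1\}^r$ with $\varepsilon_i=0$ for all degenerate $i$, ordered componentwise; let $w$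 be the number of non-degenerate indices, and let $\boldsymbol\tau\in\mathcal X_r(\mathbf a,\mathbf j)$ have $\tau_i=1$ exactly at the non-degenerate $i$. Let $d$ be the Hamming distance, $\mathcal W$ the Hamming weight, and $S_{(\mathbf a,\mathbf j)}=\mathcal A_r\cdot B^{(\boldsymbol\tau)}(\mathbf a,\mathbf j)$. For an $\mathcal A_r$-module $M$ let ${\rm rad}^nM=({\rm rad}\,\mathcal A_r)^nM$, with ${\rm rad}\,\mathcal A_r$ the Jacobson radical and ${\rm rad}^0M=M$. The Loewy length of $M$ is the least $n$ with ${\rm rad}^nM=0$, and its head is $M/{\rm rad}^1M$. **Theorem.** Let $r\ge1$ and $(\mathbf a,\mathbf j)\in\mathcal P^r$. Then $S_{(\mathbf a,\mathbf j)}=k\cdot B^{(\boldsymbol\tau)}(\mathbf a,\mathbf j)$ is a simple $\mathcal A_r$-module of dimension one over $k$. For every $\boldsymbol\varepsilon\in\mathcal X_r(\mathbf a,\mathbf j)$, the module $M=\mathcal A_r\cdot B^{(\boldsymbol\varepsilon)}(\mathbf a,\mathbf j)$ satisfies: 1. for every $n\ge0$, $${\rm rad}^nM=\sum_{\substack{\boldsymbol\theta\in\mathcal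 X_r(\mathbf a,\mathbf j),\ \boldsymbol\theta\ge\boldsymbol\varepsilon\\ d(\boldsymbol\theta,\boldsymbol\varepsilon)=n}}\mathcal A_r\cdot B^{(\boldsymbol\theta)}(\mathbf a,\mathbf j)=\sum_{\substack{\boldsymbol\theta\in\mathcal X_r(\mathbf a,\mathbf j),\ \boldsymbol\theta\ge\boldsymbol\varepsilon\\ d(\boldsymbol\theta,\boldsymbol\varepsilon)\ge n}}k\cdot B^{(\boldsymbol\theta)}(\mathbf a,\mathbf j);$$ 2. the Loewy length of $M$ is $w+1-\mathcal W(\boldsymbol\varepsilon)$; 3. for $0\le i\le w-\mathcal W(\boldsymbol\varepsilon)$, ${\rm rad}^iM/{\rm rad}^{i+1}M$ is isomorphic to the direct sum of $\binom{w-\mathcal W(\boldsymbol\varepsilon)}i$ copies of $S_{(\mathbf a,\mathbf j)}$; 4. $M$ is indecomposable and its head is isomorphic to $S_{(\mathbf a,\mathbf j)}$. Moreover, $E(\mathbf a,\mathbf j)$ is a primitive idempotent of $\mathcal A_r$ and of $\mathcal U_r$. -/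

import Mathlib

open Polynomial
open scoped TensorProduct

namespace SL2Hyper

/-! ### The integral form of the enveloping algebra of `sl₂(ℂ)` -/

/-- The complex Lie algebra `sl₂(ℂ)` of traceless `2 × 2` matrices. -/
abbrev sl2C : Type := LieAlgebra.SpecialLinear.sl (Fin 2) ℂ

/-- The universal enveloping algebra of `sl₂(ℂ)`. -/
abbrev UC : Type := UniversalEnvelopingAlgebra ℂ sl2C

def matX : sl2C := ⟨!![0, 1; 0, 0], by
  simp [LieAlgebra.SpecialLinear.sl, Matrix.trace_fin_two]⟩

def matY : sl2C := ⟨!![0, 0; 1, 0], by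
  simp [LieAlgebra.SpecialLinear.sl, Matrix.trace_fin_two]⟩

def matH : sl2C := ⟨!![1, 0; 0, -1], by
  simp [LieAlgebra.SpecialLinear.sl, Matrix.trace_fin_two]⟩

noncomputable def xC : UC := UniversalEnvelopingAlgebra.ι ℂ matX
noncomputable def yC : UC := UniversalEnvelopingAlgebra.ι ℂ matY
noncomputable def hC : UC := UniversalEnvelopingAlgebra.ι ℂ matH

/-- The divided power `u ^ m / m!` in a complex algebra. -/
noncomputable def divPow {A : Type*} [Ring A] [Algebra ℂ A] (u : A) (m : ℕ) : A :=
  ((m.factorial : ℂ)⁻¹) • u ^ m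

/-- The subring `U_ℤ` of the enveloping algebra generated by all `X ^ m / m!`, `Y ^ m / m!`. -/
noncomputable def UZ : Subalgebra ℤ UC :=
  Algebra.adjoin ℤ (Set.range (divPow xC) ∪ Set.range (divPow yC))

/-- The polynomial `(T + c)(T + c - 1) ⋯ (T + c - m + 1) / m!`. -/
noncomputable def binomPoly (c : ℤ) (m : ℕ) : ℂ[X] :=
  C ((m.factorial : ℂ)⁻¹) * ∏ i ∈ Finset.range m, (X + C ((c : ℂ) - (i : ℂ)))

/-- The element `binom(H + c, m)` of the enveloping algebra. -/
noncomputable def binomH (c : ℤ) (m : ℕ) : UC := aeval hC (binomPoly c m)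

theorem binomPoly_zero (c : ℤ) : binomPoly c 0 = 1 := by simp [binomPoly]

theorem binomPoly_succ_mul (c : ℤ) (m : ℕ) :
    C ((m : ℂ) + 1) * binomPoly c (m + 1) = binomPoly c m * (X + C ((c : ℂ) - (m : ℂ))) := by
  have h : ((m : ℂ) + 1) ≠ 0 := by exact_mod_cast Nat.succ_ne_zero m
  have h2 : ((m : ℂ) + 1) * (((m + 1).factorial : ℕ) : ℂ)⁻¹ = ((m.factorial : ℕ) : ℂ)⁻¹ := by
    rw [Nat.factorial_succ]; push_cast
    rw [mul_inv, ← mul_assoc, mul_inv_cancel₀ h, one_mul]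
  unfold binomPoly
  rw [Finset.prod_range_succ, ← mul_assoc, ← C_mul, h2, mul_assoc]

theorem binomPoly_pascal (c : ℤ) (m : ℕ) :
    binomPoly (c + 1) (m + 1) = binomPoly c (m + 1) + binomPoly c m := by
  have h : ((m : ℂ) + 1) ≠ 0 := by exact_mod_cast Nat.succ_ne_zero m
  have hC : C ((m : ℂ) + 1) ≠ 0 := by rw [Ne, C_eq_zero]; exact h
  have key : ∀ m : ℕ, binomPoly (c + 1) m * (X + C ((c : ℂ) + 1 - (m : ℂ)))
      = binomPoly c m * (X + C ((c : ℂ) + 1)) := by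
    intro m
    have e : (∏ i ∈ Finset.range m, (X + C (((c + 1 : ℤ) : ℂ) - (i : ℂ)) : ℂ[X]))
        * (X + C ((c : ℂ) + 1 - (m : ℂ)))
        = (∏ i ∈ Finset.range m, (X + C ((c : ℂ) - (i : ℂ)))) * (X + C ((c : ℂ) + 1)) := by
      have e1 := Finset.prod_range_succ
        (fun i : ℕ => (X + C (((c + 1 : ℤ) : ℂ) - (i : ℂ)) : ℂ[X])) m
      have e2 := Finset.prod_range_succ'
        (fun i : ℕ => (X + C (((c + 1 : ℤ) : ℂ) - (i : ℂ)) : ℂ[X])) m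
      have e3 : ∀ i : ℕ, (((c + 1 : ℤ) : ℂ) - ((i + 1 : ℕ) : ℂ)) = (c : ℂ) - (i : ℂ) := by
        intro i; push_cast; ring
      simp only [e3] at e2
      rw [e2] at e1
      push_cast at e1 ⊢
      simpa using e1.symm
    unfold binomPoly
    rw [mul_assoc, e, mul_assoc]
  apply mul_left_cancel₀ hC
  rw [mul_add, binomPoly_succ_mul, binomPoly_succ_mul]
  have := key m
  push_cast
  rw [this]
  simp only [C_add, C_sub, C_1]
  ring

section Commutation

variable {A : Type*} [Ring A] {x y h : A}

theorem yx_mul_pow (hxy : x * y = y * x + h) (hhx : h * x = x * (h + 2)) (m : ℕ) :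
    (y * x) * x ^ m = x ^ m * (y * x - m * (h + m + 1)) := by
  have hx : ∀ m : ℕ, h * x ^ m = x ^ m * (h + 2 * m) := by
    intro m
    induction m with
    | zero => simp
    | succ m ih =>
      rw [pow_succ, ← mul_assoc, ih, mul_assoc, add_mul, hhx]
      have : (2 * (m : A)) * x = x * (2 * (m : A)) := by
        have := (Nat.cast_commute (2 * m) x).eq
        push_cast at this; exact this
      rw [this]; push_cast; noncomm_ring
  induction m with
  | zero => simp
  | succ m ih =>
    have e : y * x * x ^ (m + 1) = (x * y - h) * x ^ (m + 1) := by rw [hxy]; noncomm_ring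
    have e2 : y * x ^ (m + 1) = x ^ m * (y * x - m * (h + m + 1)) := by
      rw [← ih, pow_succ', mul_assoc]
    rw [e, sub_mul, mul_assoc, e2, hx, ← mul_assoc, ← pow_succ', ← mul_sub]
    congr 1
    push_cast
    have := (Nat.cast_commute m h).eq
    noncomm_ring

theorem xy_mul_pow (hxy : x * y = y * x + h) (hhy : h * y = y * (h - 2)) (m : ℕ) :
    (x * y) * y ^ m = y ^ m * (y * x + (m + 1) * (h - m)) := by
  have hy : ∀ m : ℕ, h * y ^ m = y ^ m * (h - 2 * m) := by
    intro m
    induction m with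
    | zero => simp
    | succ m ih =>
      rw [pow_succ, ← mul_assoc, ih, mul_assoc, sub_mul, hhy]
      have : (2 * (m : A)) * y = y * (2 * (m : A)) := by
        have := (Nat.cast_commute (2 * m) y).eq
        push_cast at this; exact this
      rw [this]; push_cast; noncomm_ring
  induction m with
  | zero => simp [hxy]
  | succ m ih =>
    have e2 : x * y ^ (m + 1) = y ^ m * (y * x + (m + 1) * (h - m)) := by
      rw [← ih, pow_succ', mul_assoc]
    have e : x * y * y ^ (m + 1) = y * (x * y ^ (m + 1)) + h * y ^ (m + 1) := by
      rw [hxy]; noncomm_ring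
    rw [e, e2, hy, ← mul_assoc, ← pow_succ', ← mul_add]
    congr 1
    push_cast
    have := (Nat.cast_commute m h).eq
    noncomm_ring

theorem divPow_yx_succ [Algebra ℂ A] (hxy : x * y = y * x + h) (hhx : h * x = x * (h + 2))
    (m : ℕ) : divPow y m * divPow x m * (y * x - m * (h + m + 1))
      = ((m : ℂ) + 1) ^ 2 • (divPow y (m + 1) * divPow x (m + 1)) := by
  have hm : ((m : ℂ) + 1) ≠ 0 := by exact_mod_cast Nat.succ_ne_zero m
  have hf : ((m.factorial : ℕ) : ℂ) ≠ 0 := by exact_mod_cast m.factorial_ne_zero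
  have e : y ^ (m + 1) * x ^ (m + 1) = y ^ m * x ^ m * (y * x - m * (h + m + 1)) := by
    rw [mul_assoc (y ^ m), ← yx_mul_pow hxy hhx m, pow_succ, pow_succ']
    simp only [mul_assoc]
  simp only [divPow, smul_mul_assoc, mul_smul_comm, smul_smul, e]
  congr 1
  rw [Nat.factorial_succ]; push_cast
  field_simp

theorem divPow_xy_succ [Algebra ℂ A] (hxy : x * y = y * x + h) (hhy : h * y = y * (h - 2))
    (m : ℕ) : divPow x m * divPow y m * (y * x + (m + 1) * (h - m))
      = ((m : ℂ) + 1) ^ 2 • (divPow x (m + 1) * divPow y (m + 1)) := by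
  have hm : ((m : ℂ) + 1) ≠ 0 := by exact_mod_cast Nat.succ_ne_zero m
  have hf : ((m.factorial : ℕ) : ℂ) ≠ 0 := by exact_mod_cast m.factorial_ne_zero
  have e : x ^ (m + 1) * y ^ (m + 1) = x ^ m * y ^ m * (y * x + (m + 1) * (h - m)) := by
    rw [mul_assoc (x ^ m), ← xy_mul_pow hxy hhy m, pow_succ, pow_succ']
    simp only [mul_assoc]
  simp only [divPow, smul_mul_assoc, mul_smul_comm, smul_smul, e]
  congr 1
  rw [Nat.factorial_succ]; push_cast
  field_simp

theorem aeval_binomPoly_mul [Algebra ℂ A] (h : A) (i : ℕ) :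
    aeval h (binomPoly 0 i) * (h - i) = ((i : ℂ) + 1) • aeval h (binomPoly 0 (i + 1)) := by
  have e := congrArg (aeval h) (binomPoly_succ_mul 0 i)
  rw [map_mul, map_mul, aeval_C, ← Algebra.smul_def, map_add, aeval_X, aeval_C] at e
  rw [e]
  congr 1
  simp [sub_eq_add_neg]

/-- `X^(n) Y^(n)` in terms of the `Y^(j) X^(j)` and `binom(H, i)`. -/
theorem divPow_xy_eq_sum [Algebra ℂ A] (hxy : x * y = y * x + h) (hhx : h * x = x * (h + 2))
    (hhy : h * y = y * (h - 2)) (n : ℕ) :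
    divPow x n * divPow y n = ∑ q ∈ Finset.HasAntidiagonal.antidiagonal n,
      divPow y q.2 * divPow x q.2 * aeval h (binomPoly 0 q.1) := by
  have hc : Commute (y * x) h := by
    have e1 : h * (y * x) = y * x * h := by
      rw [← mul_assoc, hhy, mul_assoc, sub_mul, hhx]; noncomm_ring
    exact e1.symm
  have hbh : ∀ i, Commute h (aeval h (binomPoly 0 i)) := fun i => by
    have : aeval h (X * binomPoly 0 i) = aeval h (binomPoly 0 i * X) := by rw [mul_comm]
    simpa [Commute, SemiconjBy] using this
  have hbc : ∀ i, Commute (y * x) (aeval h (binomPoly 0 i)) := fun i => by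
    generalize binomPoly 0 i = P
    induction P using Polynomial.induction_on' with
    | add P Q hP hQ => rw [map_add]; exact hP.add_right hQ
    | monomial k r =>
      rw [aeval_monomial]
      exact (Algebra.commute_algebraMap_right r _).mul_right (hc.pow_right k)
  induction n with
  | zero => simp [divPow, binomPoly_zero]
  | succ n ih =>
    have hn : ((n : ℂ) + 1) ^ 2 ≠ 0 := by
      have : ((n : ℂ) + 1) ≠ 0 := by exact_mod_cast Nat.succ_ne_zero n
      exact pow_ne_zero 2 this
    apply smul_right_injective A hn
    simp only []
    rw [← divPow_xy_succ hxy hhy, ih, Finset.sum_mul, Finset.smul_sum]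
    set a : ℕ → A := fun j => divPow y j * divPow x j with ha
    set b : ℕ → A := fun i => aeval h (binomPoly 0 i) with hb
    have hterm : ∀ q ∈ Finset.HasAntidiagonal.antidiagonal n,
        a q.2 * b q.1 * (y * x + (n + 1) * (h - n))
        = ((q.2 : ℂ) + 1) ^ 2 • (a (q.2 + 1) * b q.1)
          + (((q.1 : ℂ) + 1) * ((n : ℂ) + 1 + q.2)) • (a q.2 * b (q.1 + 1)) := by
      rintro ⟨i, j⟩ hq
      have hij : i + j = n := by simpa using hq
      have e0 : (y * x + (n + 1) * (h - n) : A)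
          = (y * x - j * (h + j + 1)) + ((n + 1 + j : ℕ) : A) * (h - i) := by
        rw [← hij]; push_cast
        have h1 := (Nat.cast_commute i h).eq
        have h2 := (Nat.cast_commute j h).eq
        have h3 := (Nat.cast_commute i (j : A)).eq
        noncomm_ring
        simp only [h3]
        abel
      have e1 : b i * (y * x - j * (h + j + 1)) = (y * x - j * (h + j + 1)) * b i := by
        have : Commute (y * x - j * (h + j + 1)) (b i) := by
          refine (hbc i).sub_left ((Nat.cast_commute j _).mul_left ?_)
          exact ((hbh i).add_left (Nat.cast_commute j _)).add_left (Commute.one_left _)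
        exact this.eq.symm
      show a j * b i * _ = _
      rw [e0, mul_add, mul_assoc (a j), e1, ← mul_assoc (a j), ha]
      simp only []
      rw [divPow_yx_succ hxy hhx j, mul_assoc _ (b i), ← mul_assoc (b i),
        ← (Nat.cast_commute (n + 1 + j) (b i)).eq, mul_assoc _ (b i), hb]
      simp only []
      rw [aeval_binomPoly_mul]
      simp only [smul_mul_assoc, mul_smul_comm]
      congr 1
      rw [mul_smul]
      congr 1
      rw [← mul_assoc, ← (Nat.cast_commute (n + 1 + j) _).eq, mul_assoc,
        ← nsmul_eq_mul, ← Nat.cast_smul_eq_nsmul ℂ]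
      push_cast
      rfl
    rw [Finset.sum_congr rfl hterm, Finset.sum_add_distrib]
    have hsplit : ∀ q ∈ Finset.HasAntidiagonal.antidiagonal (n + 1),
        ((n : ℂ) + 1) ^ 2 • (a q.2 * b q.1)
        = (q.2 : ℂ) ^ 2 • (a q.2 * b q.1)
          + ((q.1 : ℂ) * ((n : ℂ) + 1 + q.2)) • (a q.2 * b q.1) := by
      rintro ⟨i, j⟩ hq
      have hij : i + j = n + 1 := by simpa using hq
      have hij' : (i : ℂ) = (n : ℂ) + 1 - j := by
        have : ((i + j : ℕ) : ℂ) = ((n + 1 : ℕ) : ℂ) := by rw [hij]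
        push_cast at this
        rw [← this]; ring
      rw [← add_smul]
      congr 1
      simp only [hij']
      ring
    have hR : ∑ q ∈ Finset.HasAntidiagonal.antidiagonal (n + 1), ((n : ℂ) + 1) ^ 2 •
          (divPow y q.2 * divPow x q.2 * aeval h (binomPoly 0 q.1))
        = ∑ q ∈ Finset.HasAntidiagonal.antidiagonal (n + 1), ((q.2 : ℂ) ^ 2 • (a q.2 * b q.1)
          + ((q.1 : ℂ) * ((n : ℂ) + 1 + q.2)) • (a q.2 * b q.1)) :=
      Finset.sum_congr rfl hsplit
    rw [hR, Finset.sum_add_distrib, Finset.Nat.sum_antidiagonal_succ',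
      Finset.Nat.sum_antidiagonal_succ
        (f := fun q : ℕ × ℕ => ((q.1 : ℂ) * ((n : ℂ) + 1 + q.2)) • (a q.2 * b q.1))]
    simp

end Commutation

section Bracket

attribute [local instance] LieRing.ofAssociativeRing

theorem xC_mul_yC : xC * yC = yC * xC + hC := by
  have h : ⁅matX, matY⁆ = matH := by
    apply Subtype.ext
    rw [LieAlgebra.SpecialLinear.sl_bracket]
    simp [matX, matY, matH]
  have e := (UniversalEnvelopingAlgebra.ι ℂ (L := sl2C)).map_lie matX matY
  rw [h, LieRing.of_associative_ring_bracket] at e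
  unfold xC yC hC
  rw [e]; abel

theorem hC_mul_xC : hC * xC = xC * (hC + 2) := by
  have h : ⁅matH, matX⁆ = (2 : ℂ) • matX := by
    apply Subtype.ext
    rw [LieAlgebra.SpecialLinear.sl_bracket]
    ext i j; fin_cases i <;> fin_cases j <;> (simp [matX, matH]; try norm_num)
  have e := (UniversalEnvelopingAlgebra.ι ℂ (L := sl2C)).map_lie matH matX
  rw [h, LieRing.of_associative_ring_bracket, map_smul] at e
  unfold xC hC
  rw [mul_add, mul_two, ← two_smul ℂ, e]; abel

theorem hC_mul_yC : hC * yC = yC * (hC - 2) := by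
  have h : ⁅matH, matY⁆ = -((2 : ℂ) • matY) := by
    apply Subtype.ext
    rw [LieAlgebra.SpecialLinear.sl_bracket]
    ext i j; fin_cases i <;> fin_cases j <;> (simp [matY, matH]; try norm_num)
  have e := (UniversalEnvelopingAlgebra.ι ℂ (L := sl2C)).map_lie matH matY
  rw [h, LieRing.of_associative_ring_bracket, map_neg, map_smul] at e
  unfold yC hC
  rw [mul_sub, mul_two, ← two_smul ℂ, sub_eq_add_neg, e]; abel

end Bracket

theorem divPow_xC_mem (m : ℕ) : divPow xC m ∈ UZ :=
  Algebra.subset_adjoin (Or.inl ⟨m, rfl⟩)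

theorem divPow_yC_mem (m : ℕ) : divPow yC m ∈ UZ :=
  Algebra.subset_adjoin (Or.inr ⟨m, rfl⟩)

theorem binomH_zero_mem (n : ℕ) : binomH 0 n ∈ UZ := by
  induction n using Nat.strong_induction_on with
  | _ n ih =>
    cases n with
    | zero => simp [binomH, binomPoly_zero, UZ.one_mem]
    | succ n =>
      have e := divPow_xy_eq_sum xC_mul_yC hC_mul_xC hC_mul_yC (n + 1)
      rw [Finset.Nat.sum_antidiagonal_succ'] at e
      have e' : binomH 0 (n + 1) = divPow xC (n + 1) * divPow yC (n + 1)
          - ∑ q ∈ Finset.HasAntidiagonal.antidiagonal n,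
            divPow yC (q.2 + 1) * divPow xC (q.2 + 1) * binomH 0 q.1 := by
        rw [e]
        simp [binomH, divPow]
      rw [e']
      refine UZ.sub_mem (UZ.mul_mem (divPow_xC_mem _) (divPow_yC_mem _))
        (UZ.sum_mem fun q hq => ?_)
      have hq' : q.1 + q.2 = n := by simpa using hq
      exact UZ.mul_mem (UZ.mul_mem (divPow_yC_mem _) (divPow_xC_mem _)) (ih _ (by omega))

/-- All `binom(H + c, m)` with `c ∈ ℤ` lie in `U_ℤ`. -/
theorem binomH_mem (c : ℤ) (m : ℕ) : binomH c m ∈ UZ := by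
  have pas : ∀ (c : ℤ) (m : ℕ), binomH (c + 1) (m + 1) = binomH c (m + 1) + binomH c m := by
    intro c m
    simp [binomH, binomPoly_pascal]
  have h0 : ∀ c, binomH c 0 ∈ UZ := fun c => by simp [binomH, binomPoly_zero, UZ.one_mem]
  induction c using Int.induction_on generalizing m with
  | zero => exact binomH_zero_mem m
  | succ c ih =>
    cases m with
    | zero => exact h0 _
    | succ m => rw [pas]; exact UZ.add_mem (ih _) (ih _)
  | pred c ih =>
    induction m with
    | zero => exact h0 _
    | succ m ihm =>
      have e := pas (-(c : ℤ) - 1) m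
      rw [sub_add_cancel] at e
      rw [← sub_eq_of_eq_add e]
      exact UZ.sub_mem (ih _) ihm

/-! ### The hyperalgebra and its subalgebras -/

/-- The hyperalgebra `U = U_ℤ ⊗ k` of `SL₂`. -/
def Hyper (k : Type*) [Field k] : Type _ := k ⊗[ℤ] UZ

noncomputable instance Hyper.instRing (k : Type*) [Field k] : Ring (Hyper k) :=
  inferInstanceAs (Ring (k ⊗[ℤ] UZ))

noncomputable instance Hyper.instAlgebra (k : Type*) [Field k] : Algebra k (Hyper k) :=
  inferInstanceAs (Algebra k (k ⊗[ℤ] UZ))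

section Hyperalgebra

variable (k : Type*) [Field k]

/-- The image `1 ⊗ u` in `U` of an element `u` of `U_ℤ`. -/
noncomputable def toHyper (u : UZ) : Hyper k := (1 : k) ⊗ₜ[ℤ] u

/-- The image of `X ^ m / m!` in `U`. -/
noncomputable def eX (m : ℕ) : Hyper k := toHyper k ⟨divPow xC m, divPow_xC_mem m⟩

/-- The image of `Y ^ m / m!` in `U`. -/
noncomputable def eY (m : ℕ) : Hyper k := toHyper k ⟨divPow yC m, divPow_yC_mem m⟩

/-- The image of `binom(H + c, m)` in `U`. -/
noncomputable def eH (c : ℤ) (m : ℕ) : Hyper k := toHyper k ⟨binomH c m, binomH_mem c m⟩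

/-- The standard basis element `Y^(m) binom(H, n) X^(m')` of `U`, for `q = (m, n, m')`. -/
noncomputable def pbw (q : ℕ × ℕ × ℕ) : Hyper k := eY k q.1 * eH k 0 q.2.1 * eX k q.2.2

/-- Coordinates with respect to the basis `pbw`: a left inverse (the inverse, as `pbw` is a basis)
of the map sending a finitely supported family of coefficients to the linear combination. -/
noncomputable def pbwCoord : Hyper k →ₗ[k] (ℕ × ℕ × ℕ →₀ k) :=
  (Finsupp.linearCombination k (pbw k)).leftInverse

/-- The `k`-linear map `Fr'` with
`Y^(m) binom(H, n) X^(m') ↦ Y^(mp) binom(H, np) X^(m'p)`. -/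
noncomputable def frob' (p : ℕ) : Hyper k →ₗ[k] Hyper k :=
  (Finsupp.linearCombination k
    (fun q : ℕ × ℕ × ℕ => pbw k (q.1 * p, q.2.1 * p, q.2.2 * p))) ∘ₗ pbwCoord k

/-- `U_r`, generated by `X^(p^i)`, `Y^(p^i)` with `i < r`. -/
noncomputable def Ur (p r : ℕ) : Subalgebra k (Hyper k) :=
  Algebra.adjoin k ({u | ∃ i < r, u = eX k (p ^ i)} ∪ {u | ∃ i < r, u = eY k (p ^ i)})

/-- `U⁰`, generated by all `binom(H, p^i)`. -/
noncomputable def U0 (p : ℕ) : Subalgebra k (Hyper k) :=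
  Algebra.adjoin k {u | ∃ i : ℕ, u = eH k 0 (p ^ i)}

/-- `𝒜`, generated by `U⁰` and all `Y^(p^i) X^(p^i)`. -/
noncomputable def Ainf (p : ℕ) : Subalgebra k (Hyper k) :=
  Algebra.adjoin k ((U0 k p : Set (Hyper k)) ∪ {u | ∃ i : ℕ, u = eY k (p ^ i) * eX k (p ^ i)})

/-- `𝒜_r = 𝒜 ∩ U_r`. -/
noncomputable def Ar (p r : ℕ) : Subalgebra k (Hyper k) := Ainf k p ⊓ Ur k p r

/-- `μ_a = binom(H - a - 1, p - 1)`. -/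
noncomputable def mu (p a : ℕ) : Hyper k := eH k (-(a : ℤ) - 1) (p - 1)

end Hyperalgebra

/-! ### The index sets and polynomials -/

/-- The set `𝒫` of pairs `(a, j)`. -/
def pairs (p : ℕ) : Set (ℕ × ℚ) :=
  if p = 2 then {(0, 1 / 2), (1, 0), (1, 1)}
  else {q | q.1 < p ∧ ∃ s : ℕ, s ≤ (p - 1) / 2 ∧ q.2 = (s : ℚ)}

section Poly

variable (p : ℕ) [Fact p.Prime]

/-- `φ_{a,m}(x) = ∏_{i < m} (x - i (i + a + 1))`. -/
noncomputable def phi (a m : ℕ) : (ZMod p)[X] :=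
  ∏ i ∈ Finset.range m, (X - C ((i : ZMod p) * ((i : ZMod p) + (a : ZMod p) + 1)))

/-- `ψ_j^{(1)}(x) = ψ(x) / (x - j²)` with `ψ(x) = ∏_{i ∈ 𝔽_p} (x - i²)`. -/
noncomputable def psiOne (j : ZMod p) : (ZMod p)[X] :=
  (∏ i : ZMod p, (X - C (i ^ 2))) /ₘ (X - C (j ^ 2))

/-- `ψ_j^{(0)}(x)`: it is `∏_{i ≠ 0} (x - i²)` for `j = 0`, and
`2 x (x + j²) ∏_{i ≠ 0, j, -j} (x - i²)` otherwise. -/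
noncomputable def psiZero (j : ZMod p) : (ZMod p)[X] :=
  if j = 0 then ∏ i ∈ Finset.univ.filter (fun i : ZMod p => i ≠ 0), (X - C (i ^ 2))
  else 2 * X * (X + C (j ^ 2)) *
    ∏ i ∈ Finset.univ.filter (fun i : ZMod p => i ≠ 0 ∧ i ≠ j ∧ i ≠ -j), (X - C (i ^ 2))

/-- `ψ_j^{(ε)}(x + ((a + 1) / 2)²)` (used for odd `p`). -/
noncomputable def psiShift (ε : Fin 2) (a : ℕ) (j : ℚ) : (ZMod p)[X] :=
  (if ε = 0 then psiZero p (j : ZMod p) else psiOne p (j : ZMod p)).comp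
    (X + C ((((a : ZMod p) + 1) / 2) ^ 2))

/-- `n^{(ε)}(a,j)`: for odd `p` the largest `n` such that `φ_{a,n}(x)` divides
`ψ_j^{(ε)}(x + ((a + 1) / 2)²)`; for `p = 2` the table with rows
`(0,1/2) : 0, 1`, `(1,0) : 1, 1` and `(1,1) : 0, 0` for `ε = 0, 1`. -/
noncomputable def nIdx (ε : Fin 2) (a : ℕ) (j : ℚ) : ℕ :=
  if p = 2 then
    if a = 0 then (if ε = 0 then 0 else 1) else (if j = 0 then 1 else 0)
  else sSup {n : ℕ | phi p a n ∣ psiShift p ε a j}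

end Poly

/-- Condition (A) or (C) on a pair; the other pairs of `𝒫` are those with (B) or (D). -/
def CondAC (p a : ℕ) (j : ℚ) : Prop :=
  (Even a ∧ ((p : ℚ) - a + 1) / 2 ≤ j ∧ j ≤ ((p : ℚ) - 1) / 2) ∨
  (Odd a ∧ 0 ≤ j ∧ j ≤ ((a : ℚ) - 1) / 2)

/-- `s(a,j)`, for pairs in `𝒫` with (A) or (C); the divisions are then exact. -/
def sIdx (p a : ℕ) : ℕ :=
  if p = 2 then 1 else if Even a then (p - a + 1) / 2 else (p - a) / 2

/-! ### The elements `B^{(ε)}(a, j)` -/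

section BElements

variable (k : Type*) [Field k] (p : ℕ) [Fact p.Prime] [CharP k p]

/-- `B^{(ε)}(a,j)` for a single pair. -/
noncomputable def B1 (ε : Fin 2) (a : ℕ) (j : ℚ) : Hyper k :=
  if p = 2 then
    if a = 0 then
      (if ε = 0 then mu k p 0 else mu k p 0 * eY k 1 * eX k 1)
    else
      (if j = 0 then mu k p 1 * eY k 1 * eX k 1 else mu k p 1 * eY k 1 * eX k 1 + mu k p 1)
  else
    aeval (mu k p a * eY k 1 * eX k 1)
      ((psiShift p ε a j).map (ZMod.castHom (dvd_refl p) k)) * mu k p a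

/-- The coefficients `c_m`, `m < p`, in `B^{(ε)}(a,j) = ∑ c_m μ_a Y ^ m X ^ m`: the coordinates of
`B^{(ε)}(a,j)` with respect to the linearly independent elements `μ_a Y ^ m X ^ m`. -/
noncomputable def cCoef (ε : Fin 2) (a : ℕ) (j : ℚ) : Fin p →₀ k :=
  (Finsupp.linearCombination k
    (fun m : Fin p => mu k p a * (eY k 1 ^ (m : ℕ) * eX k 1 ^ (m : ℕ)))).leftInverse
    (B1 k p ε a j)

open Classical in
/-- `Z^{(ε)}(z; (a,j))`. -/
noncomputable def Zmap (ε : Fin 2) (a : ℕ) (j : ℚ) (z : Hyper k) : Hyper k :=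
  if CondAC p a j then
    mu k p a * ∑ m ∈ Finset.univ.filter (fun m : Fin p => nIdx p ε a j ≤ (m : ℕ)),
      cCoef k p ε a j m •
        (eY k 1 ^ (m : ℕ) * eX k 1 ^ ((m : ℕ) - sIdx p a) * frob' k p z * eX k 1 ^ sIdx p a)
  else frob' k p z * B1 k p ε a j

/-- `B^{(ε)}(a,j)` for `r`-tuples, by recursion on `r ≥ 1` (with the convention `1` for `r = 0`,
which is not used). -/
noncomputable def Bvec : (r : ℕ) → (Fin r → Fin 2) → (Fin r → ℕ) → (Fin r → ℚ) → Hyper k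
  | 0, _, _, _ => 1
  | 1, ε, a, j => B1 k p (ε 0) (a 0) (j 0)
  | r + 2, ε, a, j => Zmap k p (ε 0) (a 0) (j 0)
      (Bvec (r + 1) (fun i => ε i.succ) (fun i => a i.succ) (fun i => j i.succ))

/-- The `𝒜_r`-module `𝒜_r · B^{(ε)}(a,j)`, as an `𝒜_r`-submodule of `U`. -/
noncomputable def ABmod (r : ℕ) (ε : Fin r → Fin 2) (a : Fin r → ℕ) (j : Fin r → ℚ) :
    Submodule (Ar k p r) (Hyper k) :=
  Submodule.span (Ar k p r) {Bvec k p r ε a j}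

end BElements

/-- The set `𝒳_r(a,j)`. -/
def Xset (p r : ℕ) (a : Fin r → ℕ) (j : Fin r → ℚ) : Set (Fin r → Fin 2) :=
  if p = 2 then {ε | ∀ i, a i = 1 → ε i = 0} else {ε | ∀ i, j i = 0 → ε i = 0}

/-- The number `w`: the Hamming weight of `j` for odd `p`, and `r` minus that of `a` for `p = 2`. -/
def wt (p r : ℕ) (a : Fin r → ℕ) (j : Fin r → ℚ) : ℕ :=
  if p = 2 then r - hammingNorm a else hammingNorm j

/-- The largest element `τ` of `𝒳_r(a,j)`. -/
def tau (p r : ℕ) (a : Fin r → ℕ) (j : Fin r → ℚ) : Fin r → Fin 2 := fun i =>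
  if p = 2 then (if a i = 1 then 0 else 1) else (if j i = 0 then 0 else 1)

/-- `S_{(a,j)} = 𝒜_r · B^{(τ)}(a,j)`. -/
noncomputable def Smod (k : Type*) [Field k] (p : ℕ) [Fact p.Prime] [CharP k p] (r : ℕ)
    (a : Fin r → ℕ) (j : Fin r → ℚ) : Submodule (Ar k p r) (Hyper k) :=
  ABmod k p r (tau p r a j) a j

/-! ### General module-theoretic notions -/

section Modules

variable {R M : Type*} [Ring R] [AddCommGroup M] [Module R M]

/-- The `n`-th radical `(rad R) ^ n • N` of a module `N`, given as a submodule of `M`. -/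
def radPow (n : ℕ) (N : Submodule R M) : Submodule R M := Ring.jacobson R ^ n • N

/-- The Loewy length: the least `n` such that the `n`-th radical vanishes. -/
noncomputable def loewyLength (N : Submodule R M) : ℕ := sInf {n : ℕ | radPow n N = ⊥}

/-- The `n`-th radical layer `rad^n N / rad^(n+1) N`. -/
abbrev RadLayer (n : ℕ) (N : Submodule R M) : Type _ :=
  ↥(radPow n N) ⧸ (radPow (n + 1) N).submoduleOf (radPow n N)

/-- The head `N / rad N`. -/
abbrev Head (N : Submodule R M) : Type _ := ↥N ⧸ (radPow 1 N).submoduleOf N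

/-- A module is indecomposable if it is nonzero and not a direct sum of two nonzero submodules. -/
def IsIndecomposable (R M : Type*) [Ring R] [AddCommGroup M] [Module R M] : Prop :=
  Nontrivial M ∧ ∀ N₁ N₂ : Submodule R M, IsCompl N₁ N₂ → N₁ = ⊥ ∨ N₂ = ⊥

end Modules

/-- `e` is a primitive idempotent of the ring `R`: a nonzero idempotent that is not the sum of two
orthogonal nonzero idempotents of `R`. -/
def IsPrimitiveIdempotent {R : Type*} [Ring R] (e : R) : Prop :=
  e ≠ 0 ∧ IsIdempotentElem e ∧ ∀ f g : R, IsIdempotentElem f → IsIdempotentElem g →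
    f * g = 0 → g * f = 0 → f + g = e → f = 0 ∨ g = 0

end SL2Hyper

open SL2Hyper

/-!
By the Poincaré–Birkhoff–Witt theorem, an element of the hyperalgebra is uniquely a sum of monomials
`Y^(m) f(H) X^(n)`, where `f` runs over the algebra `W` of functions `ℤ → k` spanned by the
`h ↦ binom(h + c, n)`. In characteristic `p` these are the functions with a period `p ^ N`, so that
`U_r` is spanned by the monomials with `m, n < p ^ r` and `f` of period `p ^ r` (`mem_Ur_iff`), the
element `μ_a` is the indicator function of a residue class modulo `p`, and `Fr'` sends
`Y^(m) f(H) X^(n)` to `Y^(mp) f(⌊H / p⌋) X^(np)` (`frob'_mon`). The part of degree zero is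
commutative, and `𝒜_r` is the part of degree zero of `U_r` (`mem_Ar_iff`).

For a single pair `(a, j)`, the algebra `𝒜_1 μ_a` is `k[x] / φ_{a,p}`, with `x` acting as `μ_a Y X`.
For odd `p` the roots of `φ_{a,p}` are the shifted squares `i²`, double for `i ≠ 0` and simple for
`i = 0`, and `B^{(0)}(a, j)`, `B^{(1)}(a, j)` are the idempotent and (if the pair is nondegenerate)
the square-zero element of the local factor at the root `j²`; for `p = 2` the same is checked by
hand. The maps `Z^{(ε)}` take the form `z ↦ F(z) B^{(ε)}(a, j)`, where `F` is the twist
`Y^(m) f(H) X^(n) ↦ Y^(mp) f(⌊(H + 2 s) / p⌋) X^(np)` of `Fr'` (`Zmap_eq`). What the case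
distinction on the pair achieves is that `F` is multiplicative after multiplication by
`B^{(0)}(a, j)` (`frob'_mul`, `frobS_mul`), as the obstructing terms contain a binomial function
that vanishes on the weight of the relevant vector, or a power of `X` that kills it. Moreover
`𝒜_{r+1}` is spanned by `F(𝒜_r) 𝒜_1` and `F(z) u ≠ 0` for nonzero `z` of degree zero and nonzero
`u ∈ 𝒜_1` (`mem_span_frobS_mul`, `frobS_mul_ne_zero`). By induction on `r` (`IsBlock.succ`) the
elements `B^{(ε)}(𝐚, 𝐣)`, with `ε` in `𝒳_r(𝐚, 𝐣)`, multiply like the square-free monomials in `w`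
variables of square zero and span the ideal `𝒜_r E(𝐚, 𝐣)`; that is, the block of `E(𝐚, 𝐣)` is
`k[t_1, …, t_w] / (t_1², …, t_w²)`. All the assertions on modules follow from this (`IsCube`).

For the primitivity in `U_r`, the idempotent `E(𝐚, 𝐣)` is concentrated on one residue class of
weights modulo `p ^ r`. Hence an element of `E U_r E` has nonzero components only in the degrees `d`
with `|d| < p ^ r` and `p ^ r ∣ 2 d`, that is in degree `0` and, for `p = 2`, in the degrees
`± 2 ^ (r - 1)` (`exists_parts`). The components in these two degrees have square zero, and a
computation modulo the radical of the local ring `𝒜_r E` shows that an idempotent of `E U_r E` is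
`0` or `E` (`IsCube.eq_zero_or_eq`).
-/

namespace SL2Hyper

set_option linter.unusedSectionVars false

/-! ### Commutation relations in characteristic zero -/

section Commutation

variable {A : Type*} [Ring A] [Algebra ℂ A] {x y h : A}

theorem divPow_zero (u : A) : divPow u 0 = 1 := by simp [divPow]

theorem mul_divPow (u : A) (m : ℕ) : u * divPow u m = ((m : ℂ) + 1) • divPow u (m + 1) := by
  have hm : ((m : ℂ) + 1) ≠ 0 := by exact_mod_cast Nat.succ_ne_zero m
  have hf : ((m.factorial : ℕ) : ℂ) ≠ 0 := by exact_mod_cast m.factorial_ne_zero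
  simp only [divPow, mul_smul_comm, smul_smul, ← pow_succ']
  congr 1
  rw [Nat.factorial_succ]; push_cast
  field_simp

theorem divPow_mul_divPow (u : A) (m n : ℕ) :
    divPow u m * divPow u n = (m + n).choose m • divPow u (m + n) := by
  have h1 : ((m.factorial : ℕ) : ℂ) ≠ 0 := by exact_mod_cast m.factorial_ne_zero
  have h2 : ((n.factorial : ℕ) : ℂ) ≠ 0 := by exact_mod_cast n.factorial_ne_zero
  have h3 : (((m + n).factorial : ℕ) : ℂ) ≠ 0 := by exact_mod_cast (m + n).factorial_ne_zero
  simp only [divPow, smul_mul_assoc, mul_smul_comm, smul_smul, ← pow_add,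
    ← Nat.cast_smul_eq_nsmul ℂ]
  congr 1
  rw [Nat.cast_add_choose]
  field_simp

theorem mul_aeval_of_shift {u : A} {c : ℂ} (hu : u * h = (h + algebraMap ℂ A c) * u) (P : ℂ[X]) :
    u * aeval h P = aeval h (P.comp (X + C c)) * u := by
  induction P using Polynomial.induction_on with
  | C a => simp [← Algebra.commutes a u]
  | add P Q hP hQ => simp [mul_add, add_mul, hP, hQ]
  | monomial n a ih =>
    rw [pow_succ, ← mul_assoc, map_mul, aeval_X, ← mul_assoc, ih, mul_assoc, hu,
      mul_comp (C a * X ^ n) X, map_mul _ _ (X.comp _), X_comp, map_add, aeval_X, aeval_C,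
      mul_assoc]

theorem pow_mul_of_shift {u : A} {c : ℂ} (hu : u * h = (h + algebraMap ℂ A c) * u) (m : ℕ) :
    u ^ m * h = (h + algebraMap ℂ A (m * c)) * u ^ m := by
  induction m with
  | zero => simp
  | succ m ih =>
    have e : u * algebraMap ℂ A (m * c) = algebraMap ℂ A (m * c) * u :=
      (Algebra.commutes _ _).symm
    rw [pow_succ', mul_assoc, ih, ← mul_assoc, mul_add, hu, e, ← add_mul, mul_assoc]
    congr 1
    rw [show ((m + 1 : ℕ) : ℂ) * c = c + m * c by push_cast; ring, map_add, add_assoc]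

theorem divPow_mul_of_shift {u : A} {c : ℂ} (hu : u * h = (h + algebraMap ℂ A c) * u) (m : ℕ) :
    divPow u m * h = (h + algebraMap ℂ A (m * c)) * divPow u m := by
  simp only [divPow, smul_mul_assoc, mul_smul_comm, pow_mul_of_shift hu]

theorem binomPoly_comp (c d : ℤ) (t : ℕ) :
    (binomPoly c t).comp (X + C (d : ℂ)) = binomPoly (c + d) t := by
  simp only [binomPoly, mul_comp, C_comp, Polynomial.prod_comp]
  congr 1
  refine Finset.prod_congr rfl fun i _ => ?_
  simp only [add_comp, X_comp, C_comp, add_assoc, ← C_add]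
  push_cast
  congr 2; ring

/-- The family `t ↦ y ^ (n - t) / (n - t)!`, extended by zero beyond `t = n`. -/
noncomputable def downPow (y : A) (n t : ℕ) : A := if t ≤ n then divPow y (n - t) else 0

theorem mul_divPow_succ (hxy : x * y = y * x + h) (hhy : h * y = y * (h - 2)) (n : ℕ) :
    x * divPow y (n + 1) = divPow y (n + 1) * x + divPow y n * (h - n) := by
  have hn : ((n : ℂ) + 1) ≠ 0 := by exact_mod_cast Nat.succ_ne_zero n
  have hf : ((n.factorial : ℕ) : ℂ) ≠ 0 := by exact_mod_cast n.factorial_ne_zero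
  have key : ∀ n : ℕ, x * y ^ (n + 1) = y ^ (n + 1) * x + (n + 1) * (y ^ n * (h - n)) := by
    intro n
    have := xy_mul_pow hxy hhy n
    rw [pow_succ', ← mul_assoc, this, mul_add]
    have e : y ^ n * (y * x) = y * y ^ n * x := by rw [← mul_assoc, ← pow_succ, pow_succ']
    rw [e, ← mul_assoc, ← mul_assoc]
    have := (Nat.cast_commute (n + 1) (y ^ n)).eq
    push_cast at this
    rw [this]
  have hfac : (((n + 1).factorial : ℕ) : ℂ)⁻¹ = ((n : ℂ) + 1)⁻¹ * ((n.factorial : ℕ) : ℂ)⁻¹ := by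
    rw [Nat.factorial_succ]; push_cast; rw [mul_inv]
  simp only [divPow, smul_mul_assoc, mul_smul_comm, key, smul_add]
  congr 1
  have : ((n : A) + 1) * (y ^ n * (h - n)) = ((n : ℂ) + 1) • (y ^ n * (h - n)) := by
    rw [Algebra.smul_def]; simp
  rw [this, smul_smul, hfac]
  congr 1
  field_simp

theorem mul_downPow (hxy : x * y = y * x + h) (hhy : h * y = y * (h - 2)) (n t : ℕ) :
    x * downPow y n t = downPow y n t * x + downPow y n (t + 1) * (h - n + t + 1) := by
  unfold downPow
  rcases lt_trichotomy t n with ht | rfl | ht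
  · obtain ⟨d, rfl⟩ := Nat.exists_eq_add_of_lt ht
    rw [if_pos (by omega), if_pos (by omega), show t + d + 1 - t = d + 1 by omega,
      show t + d + 1 - (t + 1) = d by omega, mul_divPow_succ hxy hhy]
    push_cast
    congr 2
    abel
  · simp [divPow_zero]
  · rw [if_neg (by omega), if_neg (by omega)]; simp

/-- `X^(m) Y^(n) = ∑ t, Y^(n-t) binom(H - m - n + 2 t, t) X^(m-t)`. -/
theorem divPow_mul_divPow_eq_sum (hxy : x * y = y * x + h) (hhx : h * x = x * (h + 2))
    (hhy : h * y = y * (h - 2)) (m n : ℕ) :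
    divPow x m * divPow y n = ∑ t ∈ Finset.range (m + 1),
      downPow y n t * aeval h (binomPoly (2 * t - m - n) t) * divPow x (m - t) := by
  have hx : x * h = (h + algebraMap ℂ A (-2)) * x := by
    rw [add_mul, hhx, map_neg, map_ofNat]; noncomm_ring
  induction m with
  | zero => simp [divPow_zero, downPow, binomPoly_zero]
  | succ m ih =>
    have hm : ((m : ℂ) + 1) ≠ 0 := by exact_mod_cast Nat.succ_ne_zero m
    apply smul_right_injective A hm
    simp only
    rw [← smul_mul_assoc, ← mul_divPow, mul_assoc, ih, Finset.mul_sum]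
    set b : ℕ → A := fun t => aeval h (binomPoly (2 * t - (m + 1) - n) t) with hb
    set b' : ℕ → A := fun t => aeval h (binomPoly (2 * t - m - n) t) with hb'
    have hxb : ∀ t, x * b' t = aeval h (binomPoly (2 * t - m - n - 2) t) * x := by
      intro t
      rw [hb', mul_aeval_of_shift hx]
      have := binomPoly_comp (2 * t - m - n) (-2) t
      push_cast at this
      rw [this]; rfl
    have hterm : ∀ t ∈ Finset.range (m + 1),
        x * (downPow y n t * b' t * divPow x (m - t))
        = ((m : ℂ) + 1 - t) • (downPow y n t * aeval h (binomPoly (2 * t - m - n - 2) t)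
            * divPow x (m + 1 - t))
          + downPow y n (t + 1) * ((h - n + t + 1) * b' t) * divPow x (m - t) := by
      intro t ht
      have ht' : t ≤ m := by simpa [Nat.lt_succ_iff] using ht
      have e2 : x * divPow x (m - t) = ((m : ℂ) + 1 - t) • divPow x (m + 1 - t) := by
        rw [mul_divPow, show m - t + 1 = m + 1 - t by omega]
        congr 1
        push_cast [ht']
        ring
      calc x * (downPow y n t * b' t * divPow x (m - t))
          = (x * downPow y n t) * b' t * divPow x (m - t) := by noncomm_ring
        _ = downPow y n t * (x * b' t) * divPow x (m - t)
            + downPow y n (t + 1) * ((h - n + t + 1) * b' t) * divPow x (m - t) := by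
            rw [mul_downPow hxy hhy]; noncomm_ring
        _ = _ := by
            rw [hxb, ← mul_assoc (downPow y n t), mul_assoc _ x, e2, mul_smul_comm]
    rw [Finset.sum_congr rfl hterm, Finset.sum_add_distrib, Finset.smul_sum]
    -- compare the coefficients of `Y^(n-t)` on both sides
    have hR : ∀ t ∈ Finset.range (m + 1 + 1), ((m : ℂ) + 1) • (downPow y n t *
          aeval h (binomPoly (2 * t - (m + 1 : ℕ) - n) t) * divPow x (m + 1 - t))
        = ((m : ℂ) + 1 - t) • (downPow y n t * aeval h (binomPoly (2 * t - m - n - 2) t)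
            * divPow x (m + 1 - t))
          + (if t = 0 then 0 else
            downPow y n t * ((h - n + t) * b' (t - 1)) * divPow x (m + 1 - t)) := by
      intro t _
      rcases t with _ | t
      · simp [binomPoly_zero]
      · rw [if_neg (Nat.succ_ne_zero t), ← smul_mul_assoc, ← mul_smul_comm, ← smul_mul_assoc,
          ← mul_smul_comm, ← add_mul, ← mul_add]
        congr 2
        have e1 : (h - n + ((t + 1 : ℕ) : A)) = aeval h (X + C (((t : ℂ) + 1 - n))) := by
          simp; abel
        rw [hb', e1]
        simp only [← map_mul, ← map_smul, ← map_add]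
        congr 1
        have hP := binomPoly_pascal (2 * (t + 1 : ℕ) - m - n - 2) t
        have hS := binomPoly_succ_mul (2 * (t + 1 : ℕ) - m - n - 2) t
        have k1 : (2 * ((t + 1 : ℕ) : ℤ) - ((m + 1 : ℕ) : ℤ) - n)
          = 2 * ((t + 1 : ℕ) : ℤ) - m - n - 2 + 1 := by push_cast; ring
        have k2 : (2 * ((t + 1 - 1 : ℕ) : ℤ) - m - n) = 2 * ((t + 1 : ℕ) : ℤ) - m - n - 2 := by
          rw [Nat.add_sub_cancel]; push_cast; ring
        have k3 : t + 1 - 1 = t := rfl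
        rw [k1, k2, k3, hP, smul_eq_C_mul, smul_eq_C_mul]
        push_cast at hS ⊢
        simp only [C_add, C_sub, C_mul, C_1, map_ofNat] at hS ⊢
        linear_combination hS
    rw [Finset.sum_congr rfl hR, Finset.sum_add_distrib]
    congr 1
    · rw [Finset.sum_range_succ _ (m + 1)]
      simp
    · rw [Finset.sum_range_succ' _ (m + 1)]
      simp only [if_true, add_zero, Nat.succ_ne_zero, if_false]
      refine Finset.sum_congr rfl fun t _ => ?_
      simp [add_assoc]

end Commutation

theorem xC_mul_hC : xC * hC = (hC + algebraMap ℂ UC (-2)) * xC := by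
  rw [add_mul, hC_mul_xC, map_neg, map_ofNat]; noncomm_ring

theorem yC_mul_hC : yC * hC = (hC + algebraMap ℂ UC 2) * yC := by
  rw [add_mul, hC_mul_yC, map_ofNat]; noncomm_ring

theorem divPow_xC_mul_aeval (m : ℕ) (P : ℂ[X]) :
    divPow xC m * aeval hC P = aeval hC (P.comp (X + C ((-2 * m : ℤ) : ℂ))) * divPow xC m := by
  apply mul_aeval_of_shift
  rw [divPow_mul_of_shift xC_mul_hC, show ((-2 * m : ℤ) : ℂ) = m * (-2) by push_cast; ring]

theorem divPow_yC_mul_aeval (m : ℕ) (P : ℂ[X]) :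
    divPow yC m * aeval hC P = aeval hC (P.comp (X + C ((2 * m : ℤ) : ℂ))) * divPow yC m := by
  apply mul_aeval_of_shift
  rw [divPow_mul_of_shift yC_mul_hC, show ((2 * m : ℤ) : ℂ) = m * 2 by push_cast; ring]

/-! ### Linear independence of the monomials `Y^m P(H) X^n` over `ℂ` -/

section Model

/-- Arrays `g` of polynomials, read as formal sums `∑ Y^m g_{m,n}(H) X^n`. -/
abbrev Arr : Type := ℕ → ℕ → ℂ[X]

/-- Left multiplication by `Y` on formal sums `∑ Y^m g_{m,n}(H) X^n`. -/
noncomputable def opY : Module.End ℂ Arr where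
  toFun g := fun m n => match m with
    | 0 => 0
    | m + 1 => g m n
  map_add' f g := by
    funext m n; cases m <;> simp
  map_smul' c g := by
    funext m n; cases m <;> simp

/-- Left multiplication by `H` on formal sums `∑ Y^m g_{m,n}(H) X^n`. -/
noncomputable def opH : Module.End ℂ Arr where
  toFun g := fun m n => (X - C (2 * (m : ℂ))) * g m n
  map_add' f g := by
    funext m n; simp [mul_add]
  map_smul' c g := by
    funext m n; simp

/-- Left multiplication by `X` on formal sums `∑ Y^m g_{m,n}(H) X^n`. -/
noncomputable def opX : Module.End ℂ Arr where
  toFun g := fun m n => (match n with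
    | 0 => 0
    | n + 1 => (g m n).comp (X - C 2)) + C ((m : ℂ) + 1) * (X - C (m : ℂ)) * g (m + 1) n
  map_add' f g := by
    funext m n; cases n <;> simp [mul_add, add_assoc, add_left_comm]
  map_smul' c g := by
    funext m n; cases n <;> simp [smul_comp]

theorem opX_apply_zero (g : Arr) (m : ℕ) :
    opX g m 0 = C ((m : ℂ) + 1) * (X - C (m : ℂ)) * g (m + 1) 0 := zero_add _

theorem opX_apply_succ (g : Arr) (m n : ℕ) : opX g m (n + 1) =
    (g m n).comp (X - C 2) + C ((m : ℂ) + 1) * (X - C (m : ℂ)) * g (m + 1) (n + 1) := rfl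

theorem opY_apply_zero (g : Arr) (n : ℕ) : opY g 0 n = 0 := rfl

theorem opY_apply_succ (g : Arr) (m n : ℕ) : opY g (m + 1) n = g m n := rfl

theorem opH_apply (g : Arr) (m n : ℕ) : opH g m n = (X - C (2 * (m : ℂ))) * g m n := rfl

theorem opX_mul_opY : opX * opY = opY * opX + opH := by
  refine LinearMap.ext fun g => ?_
  funext m n
  rcases m with _ | m <;> rcases n with _ | n <;>
    simp only [Module.End.mul_apply, LinearMap.add_apply, Pi.add_apply, opX_apply_zero,
      opX_apply_succ, opY_apply_zero, opY_apply_succ, opH_apply, zero_comp] <;>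
    push_cast <;> simp only [C_add, C_mul, C_1, map_ofNat, C_0] <;> ring

theorem opH_mul_opX : opH * opX = opX * opH + (2 : ℂ) • opX := by
  refine LinearMap.ext fun g => ?_
  funext m n
  rcases n with _ | n <;>
    simp only [Module.End.mul_apply, LinearMap.add_apply, Pi.add_apply, opX_apply_zero,
      LinearMap.smul_apply, Pi.smul_apply, smul_eq_C_mul, mul_comp, sub_comp, X_comp, C_comp,
      opX_apply_succ, opH_apply] <;>
    push_cast <;> simp only [C_add, C_mul, C_1, map_ofNat] <;> ring

theorem opH_mul_opY : opH * opY = opY * opH - (2 : ℂ) • opY := by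
  refine LinearMap.ext fun g => ?_
  funext m n
  rcases m with _ | m <;>
    simp only [Module.End.mul_apply, LinearMap.sub_apply, Pi.sub_apply, opY_apply_zero,
      LinearMap.smul_apply, Pi.smul_apply, smul_eq_C_mul, opY_apply_succ, opH_apply] <;>
    push_cast <;> simp only [C_add, C_mul, C_1, map_ofNat] <;> ring

attribute [local instance] LieRing.ofAssociativeRing

/-- The action of `sl₂(ℂ)` on formal sums `∑ Y^m g_{m,n}(H) X^n` by left multiplication. -/
noncomputable def arrLie : sl2C →ₗ⁅ℂ⁆ Module.End ℂ Arr where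
  toFun M := M.1 0 1 • opX + M.1 1 0 • opY + M.1 0 0 • opH
  map_add' M N := by
    show (M.1 0 1 + N.1 0 1) • opX + (M.1 1 0 + N.1 1 0) • opY + (M.1 0 0 + N.1 0 0) • opH = _
    module
  map_smul' c M := by
    show (c * M.1 0 1) • opX + (c * M.1 1 0) • opY + (c * M.1 0 0) • opH
      = c • (M.1 0 1 • opX + M.1 1 0 • opY + M.1 0 0 • opH)
    module
  map_lie' {M N} := by
    have tr : ∀ M : sl2C, M.1 1 1 = - M.1 0 0 := by
      intro M
      have h := M.2
      simp only [LieAlgebra.SpecialLinear.sl] at h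
      have h : Matrix.trace M.1 = 0 := h
      rw [Matrix.trace_fin_two] at h
      linear_combination h
    rw [LieRing.of_associative_ring_bracket]
    show (M.1 * N.1 - N.1 * M.1) 0 1 • opX + (M.1 * N.1 - N.1 * M.1) 1 0 • opY
      + (M.1 * N.1 - N.1 * M.1) 0 0 • opH = (M.1 0 1 • opX + M.1 1 0 • opY + M.1 0 0 • opH)
        * (N.1 0 1 • opX + N.1 1 0 • opY + N.1 0 0 • opH)
        - (N.1 0 1 • opX + N.1 1 0 • opY + N.1 0 0 • opH)
        * (M.1 0 1 • opX + M.1 1 0 • opY + M.1 0 0 • opH)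
    simp only [Matrix.sub_apply, Matrix.mul_apply, Fin.sum_univ_two, tr, add_mul, mul_add,
      smul_mul_smul_comm, opX_mul_opY, opH_mul_opX, opH_mul_opY, smul_add, smul_sub, smul_smul]
    module

/-- The action of the enveloping algebra on formal sums by left multiplication. -/
noncomputable def arrHom : UC →ₐ[ℂ] Module.End ℂ Arr :=
  UniversalEnvelopingAlgebra.lift ℂ arrLie

theorem arrHom_xC : arrHom xC = opX := by
  have : arrHom xC = arrLie matX := UniversalEnvelopingAlgebra.lift_ι_apply ℂ arrLie matX
  rw [this]
  show matX.1 0 1 • opX + matX.1 1 0 • opY + matX.1 0 0 • opH = _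
  simp [matX]

theorem arrHom_yC : arrHom yC = opY := by
  have : arrHom yC = arrLie matY := UniversalEnvelopingAlgebra.lift_ι_apply ℂ arrLie matY
  rw [this]
  show matY.1 0 1 • opX + matY.1 1 0 • opY + matY.1 0 0 • opH = _
  simp [matY]

theorem arrHom_hC : arrHom hC = opH := by
  have : arrHom hC = arrLie matH := UniversalEnvelopingAlgebra.lift_ι_apply ℂ arrLie matH
  rw [this]
  show matH.1 0 1 • opX + matH.1 1 0 • opY + matH.1 0 0 • opH = _
  simp [matH]

/-- The array with the single entry `P` at `(m, n)`. -/
noncomputable def arrSingle (m n : ℕ) (P : ℂ[X]) : Arr :=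
  fun m' n' => if m' = m ∧ n' = n then P else 0

theorem opX_single (n : ℕ) : opX (arrSingle 0 n 1) = arrSingle 0 (n + 1) 1 := by
  funext m' n'
  rcases n' with _ | n'
  · simp [opX_apply_zero, arrSingle]
  · rw [opX_apply_succ]
    by_cases h : m' = 0 ∧ n' = n <;> simp [arrSingle, h]

theorem opY_single (m n : ℕ) (P : ℂ[X]) : opY (arrSingle m n P) = arrSingle (m + 1) n P := by
  funext m' n'
  rcases m' with _ | m'
  · simp [opY_apply_zero, arrSingle]
  · simp [opY_apply_succ, arrSingle]

theorem opH_single (n : ℕ) (P : ℂ[X]) : opH (arrSingle 0 n P) = arrSingle 0 n (X * P) := by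
  funext m' n'
  rw [opH_apply]
  by_cases h : m' = 0 ∧ n' = n <;> simp [arrSingle, h]

theorem aeval_opH_single (n : ℕ) (P : ℂ[X]) :
    aeval opH P (arrSingle 0 n 1) = arrSingle 0 n P := by
  induction P using Polynomial.induction_on with
  | C a =>
    funext m' n'
    by_cases h : m' = 0 ∧ n' = n <;>
      simp [arrSingle, h, Module.algebraMap_end_apply, Algebra.smul_def]
  | add P Q hP hQ =>
    rw [map_add, LinearMap.add_apply, hP, hQ]
    funext m' n'
    by_cases h : m' = 0 ∧ n' = n <;> simp [arrSingle, h]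
  | monomial k a ih =>
    rw [pow_succ', mul_left_comm, map_mul, aeval_X, Module.End.mul_apply, ih, opH_single]

theorem arrHom_monomial_apply (m n : ℕ) (P : ℂ[X]) :
    arrHom (divPow yC m * aeval hC P * divPow xC n) (arrSingle 0 0 1)
      = ((m.factorial : ℂ)⁻¹ * (n.factorial : ℂ)⁻¹) • arrSingle m n P := by
  have hX : ∀ n : ℕ, (opX ^ n) (arrSingle 0 0 1) = arrSingle 0 n 1 := by
    intro n
    induction n with
    | zero => simp
    | succ n ih => rw [pow_succ', Module.End.mul_apply, ih, opX_single]
  have hY : ∀ m : ℕ, (opY ^ m) (arrSingle 0 n P) = arrSingle m n P := by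
    intro m
    induction m with
    | zero => simp
    | succ m ih => rw [pow_succ', Module.End.mul_apply, ih, opY_single]
  rw [map_mul, map_mul, divPow, divPow, map_smul, map_smul, map_pow, map_pow, arrHom_xC, arrHom_yC,
    ← aeval_algHom_apply, arrHom_hC]
  simp only [Module.End.mul_apply, LinearMap.smul_apply, hX, map_smul, aeval_opH_single, hY,
    smul_smul]
  rw [mul_comm]

end Model

theorem eval_binomPoly (c : ℤ) (m : ℕ) (h : ℤ) :
    (binomPoly c m).eval (h : ℂ) = ((Ring.choose (h + c) m : ℤ) : ℂ) := by
  have hf : ((m.factorial : ℕ) : ℂ) ≠ 0 := by exact_mod_cast m.factorial_ne_zero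
  have e : ((m.factorial : ℕ) : ℤ) * Ring.choose (h + c) m
      = ∏ i ∈ Finset.range m, (h + c - i) := by
    have := Ring.descPochhammer_eq_factorial_smul_choose (h + c) m
    rw [nsmul_eq_mul] at this
    rw [← this, ← Polynomial.eval_eq_smeval, descPochhammer_eval_eq_prod_range]
  have e' := congrArg (Int.cast : ℤ → ℂ) e
  push_cast at e'
  rw [binomPoly, eval_mul, eval_C, eval_prod, inv_mul_eq_iff_eq_mul₀ hf, e']
  refine Finset.prod_congr rfl fun i _ => ?_
  simp
  ring

theorem binomPoly_natDegree_le (c : ℤ) (m : ℕ) : (binomPoly c m).natDegree ≤ m := by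
  unfold binomPoly
  refine (natDegree_C_mul_le _ _).trans ((natDegree_prod_le _ _).trans ?_)
  simp only [natDegree_X_add_C]
  simp

/-- The polynomials with integral values at all integers. -/
def intValued : Subalgebra ℤ ℂ[X] where
  carrier := {P | ∀ h : ℤ, ∃ z : ℤ, P.eval (h : ℂ) = z}
  mul_mem' {P Q} hP hQ h := by
    obtain ⟨a, ha⟩ := hP h
    obtain ⟨b, hb⟩ := hQ h
    exact ⟨a * b, by simp [ha, hb]⟩
  add_mem' {P Q} hP hQ h := by
    obtain ⟨a, ha⟩ := hP h
    obtain ⟨b, hb⟩ := hQ h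
    exact ⟨a + b, by simp [ha, hb]⟩
  algebraMap_mem' a h := ⟨a, by simp⟩

theorem binomPoly_mem_intValued (c : ℤ) (m : ℕ) : binomPoly c m ∈ intValued :=
  fun h => ⟨_, eval_binomPoly c m h⟩

theorem comp_mem_intValued {P : ℂ[X]} (hP : P ∈ intValued) (c : ℤ) :
    P.comp (X + C (c : ℂ)) ∈ intValued := fun h => by
  obtain ⟨z, hz⟩ := hP (h + c)
  exact ⟨z, by simpa using hz⟩

/-- An integer-valued polynomial is an integral combination of binomial polynomials
(Newton interpolation at `0, 1, 2, …`). -/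
theorem intValued_eq_span :
    Subalgebra.toSubmodule intValued = Submodule.span ℤ (Set.range (binomPoly 0)) := by
  apply le_antisymm
  · intro P hP
    have key : ∀ N : ℕ, ∃ Q ∈ Submodule.span ℤ (binomPoly 0 '' Set.Iio N),
        ∀ i < N, Q.eval (i : ℂ) = P.eval (i : ℂ) := by
      intro N
      induction N with
      | zero => exact ⟨0, zero_mem _, by simp⟩
      | succ N ih =>
        obtain ⟨Q, hQ, hQP⟩ := ih
        have hQI : Q ∈ intValued := by
          have : Submodule.span ℤ (binomPoly 0 '' Set.Iio N) ≤ Subalgebra.toSubmodule intValued := by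
            rw [Submodule.span_le]
            rintro _ ⟨i, _, rfl⟩
            exact binomPoly_mem_intValued 0 i
          exact this hQ
        obtain ⟨z, hz⟩ := sub_mem (show P ∈ intValued from hP) hQI N
        refine ⟨Q + z • binomPoly 0 N, add_mem
          (Submodule.span_mono (Set.image_mono fun i hi => Nat.lt_succ_of_lt hi) hQ)
          (Submodule.smul_mem _ _ (Submodule.subset_span ⟨N, Nat.lt_succ_self N, rfl⟩)), ?_⟩
        intro i hi
        have e : (binomPoly 0 N).eval (i : ℂ) = ((i.choose N : ℕ) : ℂ) := by
          have := eval_binomPoly 0 N i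
          rw [add_zero, Ring.choose_natCast] at this
          exact_mod_cast this
        rw [eval_add, eval_smul, e]
        rcases Nat.lt_succ_iff_lt_or_eq.1 hi with hi | rfl
        · rw [Nat.choose_eq_zero_of_lt hi, hQP i hi]; simp
        · have hz' : P.eval (i : ℂ) - Q.eval (i : ℂ) = z := by simpa using hz
          rw [Nat.choose_self]
          simp [← hz']
    obtain ⟨Q, hQ, hQP⟩ := key (P.natDegree + 1)
    have hdeg : Q.natDegree ≤ P.natDegree := by
      have hle : Submodule.span ℤ (binomPoly 0 '' Set.Iio (P.natDegree + 1))
          ≤ (degreeLE ℂ P.natDegree).restrictScalars ℤ := by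
        rw [Submodule.span_le]
        rintro _ ⟨i, hi, rfl⟩
        have : (binomPoly 0 i).natDegree ≤ P.natDegree :=
          (binomPoly_natDegree_le 0 i).trans (Nat.lt_succ_iff.1 hi)
        exact mem_degreeLE.2 (natDegree_le_iff_degree_le.1 this)
      exact natDegree_le_iff_degree_le.2 (mem_degreeLE.1 (hle hQ))
    have : P = Q := by
      apply eq_of_natDegree_lt_card_of_eval_eq (ι := Fin (P.natDegree + 1)) P Q
        (f := fun i => ((i : ℕ) : ℂ))
      · intro i j hij
        exact Fin.ext (Nat.cast_injective (R := ℂ) hij)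
      · intro i
        exact (hQP i i.2).symm
      · simp; omega
    rw [this]
    exact Submodule.span_mono (Set.image_subset_range _ _) hQ
  · rw [Submodule.span_le]
    rintro _ ⟨i, rfl⟩
    exact binomPoly_mem_intValued 0 i

theorem linearIndependent_binomPoly : LinearIndependent ℂ (binomPoly 0) := by
  rw [linearIndependent_iff]
  intro l hl
  ext n
  induction n using Nat.strong_induction_on with
  | _ n ih =>
    have e := congrArg (eval (n : ℂ)) hl
    rw [Finsupp.linearCombination_apply, Finsupp.sum, eval_finsetSum, eval_zero] at e
    have hb : ∀ i : ℕ, (binomPoly 0 i).eval (n : ℂ) = ((n.choose i : ℕ) : ℂ) := by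
      intro i
      have := eval_binomPoly 0 i n
      rw [add_zero, Ring.choose_natCast] at this
      exact_mod_cast this
    rw [Finset.sum_eq_single n] at e
    · simpa [hb] using e
    · intro i _ hin
      rcases lt_or_gt_of_ne hin with h | h
      · simp [ih i h]
      · simp [hb, Nat.choose_eq_zero_of_lt h]
    · intro h
      simpa using Or.inl (Finsupp.notMem_support_iff.1 h)

/-- The element `Y^(m) binom(H, n) X^(m')` of `U_ℤ`, for `q = (m, n, m')`. -/
noncomputable def pbwZ (q : ℕ × ℕ × ℕ) : UZ :=
  ⟨divPow yC q.1, divPow_yC_mem q.1⟩ * ⟨binomH 0 q.2.1, binomH_mem 0 q.2.1⟩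
    * ⟨divPow xC q.2.2, divPow_xC_mem q.2.2⟩

/-- The independence half of the Poincaré–Birkhoff–Witt theorem for `sl₂(ℂ)`. -/
theorem linearIndependent_pbwZ : LinearIndependent ℤ pbwZ := by
  have hC : LinearIndependent ℂ (fun q : ℕ × ℕ × ℕ => (pbwZ q : UC)) := by
    rw [linearIndependent_iff]
    intro l hl
    have e := congrArg (fun u => arrHom u (arrSingle 0 0 1)) hl
    simp only [Finsupp.linearCombination_apply, Finsupp.sum, map_sum, map_smul, map_zero,
      LinearMap.sum_apply, LinearMap.smul_apply, LinearMap.zero_apply] at e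
    have hp : ∀ q : ℕ × ℕ × ℕ, arrHom (pbwZ q : UC) (arrSingle 0 0 1)
        = ((q.1.factorial : ℂ)⁻¹ * (q.2.2.factorial : ℂ)⁻¹)
          • arrSingle q.1 q.2.2 (binomPoly 0 q.2.1) :=
      fun q => arrHom_monomial_apply q.1 q.2.2 (binomPoly 0 q.2.1)
    simp only [hp] at e
    ext ⟨m, n, m'⟩
    have e1 := congrFun (congrFun e m) m'
    simp only [Finset.sum_apply, Pi.smul_apply, arrSingle, Pi.zero_apply] at e1
    obtain ⟨l', hl'⟩ : ∃ l' : ℕ →₀ ℂ, ∀ n, l' n = l (m, n, m') :=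
      ⟨l.comapDomain (fun n => (m, n, m')) (fun a _ b _ h => by simpa using h), fun _ => rfl⟩
    have hgz : ((m.factorial : ℂ)⁻¹ * (m'.factorial : ℂ)⁻¹) • l' = 0 := by
      apply linearIndependent_iff.1 linearIndependent_binomPoly
      rw [map_smul, Finsupp.linearCombination_apply, Finsupp.sum, Finset.smul_sum]
      rw [← e1]
      refine Finset.sum_of_injOn (fun n => (m, n, m')) (fun a _ b _ h => by simpa using h) ?_ ?_ ?_
      · intro n hn
        simpa [hl'] using hn
      · rintro ⟨m1, n1, m2⟩ h1 h2
        by_cases h : m = m1 ∧ m' = m2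
        · obtain ⟨rfl, rfl⟩ := h
          exact absurd ⟨n1, by simpa [hl'] using h1, rfl⟩ h2
        · simp [h]
      · intro n _
        simp [smul_smul, mul_comm, hl']
    have hn := DFunLike.congr_fun hgz n
    have f1 : ((m.factorial : ℕ) : ℂ) ≠ 0 := by exact_mod_cast m.factorial_ne_zero
    have f2 : ((m'.factorial : ℕ) : ℂ) ≠ 0 := by exact_mod_cast m'.factorial_ne_zero
    simpa [hl', f1, f2] using hn
  have hZ : LinearIndependent ℤ (fun q : ℕ × ℕ × ℕ => (pbwZ q : UC)) :=
    hC.restrict_scalars (by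
      intro a b hab
      simpa using hab)
  exact LinearIndependent.of_comp UZ.val.toLinearMap hZ

/-- Kostant's integral form: `U_ℤ` is spanned by the `Y^(m) binom(H, n) X^(m')`. -/
theorem span_pbwZ : ⊤ ≤ Submodule.span ℤ (Set.range pbwZ) := by
  set S : Submodule ℤ UC := Submodule.span ℤ
    {u | ∃ m n : ℕ, ∃ P ∈ intValued, u = divPow yC m * aeval hC P * divPow xC n} with hS
  have hx : ∀ n : ℕ, ∀ u ∈ S, divPow xC n * u ∈ S := by
    intro n u hu
    induction hu using Submodule.span_induction with
    | zero => simp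
    | add u v _ _ hu hv => rw [mul_add]; exact add_mem hu hv
    | smul c u _ hu => rw [mul_smul_comm]; exact Submodule.smul_mem _ _ hu
    | mem u hu =>
      obtain ⟨m, m', P, hP, rfl⟩ := hu
      rw [mul_assoc (divPow yC m), ← mul_assoc, divPow_mul_divPow_eq_sum xC_mul_yC hC_mul_xC
        hC_mul_yC, Finset.sum_mul]
      refine Submodule.sum_mem _ fun t _ => ?_
      unfold downPow
      split_ifs with ht
      · have e : divPow yC (m - t) * aeval hC (binomPoly (2 * t - n - m) t) * divPow xC (n - t)
            * (aeval hC P * divPow xC m')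
            = (n - t + m').choose (n - t) • (divPow yC (m - t)
              * aeval hC (binomPoly (2 * t - n - m) t
                * P.comp (X + C ((-2 * (n - t : ℕ) : ℤ) : ℂ))) * divPow xC (n - t + m')) := by
          rw [← mul_assoc _ (aeval hC P), mul_assoc _ (divPow xC (n - t)), divPow_xC_mul_aeval,
            mul_assoc, mul_assoc, mul_assoc, divPow_mul_divPow, map_mul]
          simp only [mul_smul_comm, mul_assoc]
        rw [e]
        refine nsmul_mem (Submodule.subset_span ?_) _
        exact ⟨_, _, _, mul_mem (binomPoly_mem_intValued _ _) (comp_mem_intValued hP _), rfl⟩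
      · simp
  have hy : ∀ n : ℕ, ∀ u ∈ S, divPow yC n * u ∈ S := by
    intro n u hu
    induction hu using Submodule.span_induction with
    | zero => simp
    | add u v _ _ hu hv => rw [mul_add]; exact add_mem hu hv
    | smul c u _ hu => rw [mul_smul_comm]; exact Submodule.smul_mem _ _ hu
    | mem u hu =>
      obtain ⟨m, m', P, hP, rfl⟩ := hu
      rw [← mul_assoc, ← mul_assoc, divPow_mul_divPow, smul_mul_assoc, smul_mul_assoc]
      refine nsmul_mem (Submodule.subset_span ?_) _
      exact ⟨_, _, P, hP, rfl⟩
  have h1 : (1 : UC) ∈ S :=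
    Submodule.subset_span ⟨0, 0, 1, one_mem _, by simp [divPow_zero]⟩
  have hall : ∀ u ∈ UZ, ∀ v ∈ S, u * v ∈ S := by
    intro u hu
    induction hu using Algebra.adjoin_induction with
    | mem u hu =>
      rcases hu with ⟨n, rfl⟩ | ⟨n, rfl⟩
      · exact hx n
      · exact hy n
    | algebraMap c =>
      intro v hv
      rw [← Algebra.smul_def]
      exact Submodule.smul_mem _ _ hv
    | add u v _ _ hu hv => intro w hw; rw [add_mul]; exact add_mem (hu w hw) (hv w hw)
    | mul u v _ _ hu hv => intro w hw; rw [mul_assoc]; exact hu _ (hv w hw)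
  have hSle : S ≤ Submodule.map UZ.val.toLinearMap (Submodule.span ℤ (Set.range pbwZ)) := by
    rw [hS, Submodule.span_le]
    rintro _ ⟨m, n, P, hP, rfl⟩
    have hP' : P ∈ Submodule.span ℤ (Set.range (binomPoly 0)) := by
      rw [← intValued_eq_span]; exact hP
    clear hP
    induction hP' using Submodule.span_induction with
    | zero => simp
    | add P Q _ _ h1 h2 => rw [map_add, mul_add, add_mul]; exact add_mem h1 h2
    | smul c P _ h =>
      rw [map_zsmul, mul_smul_comm, smul_mul_assoc]
      exact Submodule.smul_mem _ c h
    | mem P h =>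
      obtain ⟨l, rfl⟩ := h
      exact ⟨pbwZ (m, l, n), Submodule.subset_span ⟨_, rfl⟩, rfl⟩
  intro u _
  have := hall u u.2 1 h1
  rw [mul_one] at this
  obtain ⟨v, hv, hvu⟩ := hSle this
  have : v = u := Subtype.ext hvu
  rwa [← this]

/-! ### The Poincaré–Birkhoff–Witt basis and the torus part of the hyperalgebra -/

/-- The `ℤ`-basis of `U_ℤ`. -/
noncomputable def pbwZBasis : Module.Basis (ℕ × ℕ × ℕ) ℤ UZ :=
  Module.Basis.mk linearIndependent_pbwZ span_pbwZ

/-- The values of an integer-valued polynomial at the integers. -/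
noncomputable def evalInt : intValued →+* (ℤ → ℤ) where
  toFun P h := (P.2 h).choose
  map_one' := by
    funext h
    have := ((1 : intValued).2 h).choose_spec
    apply Int.cast_injective (α := ℂ)
    rw [← this]; simp
  map_zero' := by
    funext h
    have := ((0 : intValued).2 h).choose_spec
    apply Int.cast_injective (α := ℂ)
    rw [← this]; simp
  map_mul' P Q := by
    funext h
    have := ((P * Q).2 h).choose_spec
    apply Int.cast_injective (α := ℂ)
    rw [← this]
    simp [← (P.2 h).choose_spec, ← (Q.2 h).choose_spec]
  map_add' P Q := by
    funext h
    have := ((P + Q).2 h).choose_spec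
    apply Int.cast_injective (α := ℂ)
    rw [← this]
    simp [← (P.2 h).choose_spec, ← (Q.2 h).choose_spec]

theorem evalInt_cast (P : intValued) (h : ℤ) : ((evalInt P h : ℤ) : ℂ) = (P : ℂ[X]).eval (h : ℂ) :=
  (P.2 h).choose_spec.symm

/-- The polynomial `binom(T + c, m)` as an integer-valued polynomial. -/
noncomputable def binomI (c : ℤ) (m : ℕ) : intValued :=
  ⟨binomPoly c m, binomPoly_mem_intValued c m⟩

theorem evalInt_binomI (c : ℤ) (m : ℕ) (h : ℤ) :
    evalInt (binomI c m) h = Ring.choose (h + c) m := by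
  apply Int.cast_injective (α := ℂ)
  rw [evalInt_cast]
  exact eval_binomPoly c m h

/-- The binomial basis of the ring of integer-valued polynomials. -/
noncomputable def binomBasis : Module.Basis ℕ ℤ intValued :=
  Module.Basis.mk (v := binomI 0)
    (LinearIndependent.of_comp intValued.val.toLinearMap
      (linearIndependent_binomPoly.restrict_scalars (by intro a b hab; simpa using hab)))
    (by
      intro P _
      have hP : (P : ℂ[X]) ∈ Submodule.span ℤ (Set.range (binomPoly 0)) := by
        rw [← intValued_eq_span]; exact P.2
      have e : Submodule.span ℤ (Set.range (binomPoly 0))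
          = Submodule.map intValued.val.toLinearMap (Submodule.span ℤ (Set.range (binomI 0))) := by
        rw [Submodule.map_span, ← Set.range_comp]; rfl
      rw [e] at hP
      obtain ⟨Q, hQ, hQP⟩ := hP
      have : Q = P := Subtype.ext hQP
      rwa [← this])

/-- Substitution of `H` in integer-valued polynomials. -/
noncomputable def torusZ : intValued →ₐ[ℤ] UZ :=
  ((((aeval hC : ℂ[X] →ₐ[ℂ] UC).restrictScalars ℤ).comp intValued.val).codRestrict UZ (by
    intro P
    have hP : (P : ℂ[X]) ∈ Submodule.span ℤ (Set.range (binomPoly 0)) := by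
      rw [← intValued_eq_span]; exact P.2
    show aeval hC (P : ℂ[X]) ∈ UZ
    generalize (P : ℂ[X]) = Q at hP ⊢
    induction hP using Submodule.span_induction with
    | zero => simp
    | add P Q _ _ h1 h2 => rw [map_add]; exact add_mem h1 h2
    | smul c P _ h => rw [map_zsmul]; exact zsmul_mem h c
    | mem P h =>
      obtain ⟨l, rfl⟩ := h
      exact binomH_mem 0 l))

section

variable (k : Type*) [Field k]

theorem toHyper_mul (u v : UZ) : toHyper k (u * v) = toHyper k u * toHyper k v := by
  have := Algebra.TensorProduct.tmul_mul_tmul (R := ℤ) (1 : k) (1 : k) u v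
  rw [mul_one] at this
  exact this.symm

theorem toHyper_add (u v : UZ) : toHyper k (u + v) = toHyper k u + toHyper k v :=
  TensorProduct.tmul_add _ _ _

theorem toHyper_one : toHyper k 1 = 1 := rfl

/-- The map `U_ℤ → U` as a ring homomorphism. -/
noncomputable def toHyperHom : UZ →+* Hyper k where
  toFun := toHyper k
  map_one' := rfl
  map_mul' := toHyper_mul k
  map_zero' := TensorProduct.tmul_zero _ _
  map_add' := toHyper_add k

theorem toHyperHom_apply (u : UZ) : toHyperHom k u = toHyper k u := rfl

/-- The basis `Y^(m) binom(H, n) X^(m')` of the hyperalgebra. -/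
noncomputable def pbwBasis : Module.Basis (ℕ × ℕ × ℕ) k (Hyper k) :=
  pbwZBasis.baseChange k

theorem pbwBasis_apply (q : ℕ × ℕ × ℕ) : pbwBasis k q = pbw k q := by
  have : pbwBasis k q = toHyper k (pbwZ q) := by
    refine (Module.Basis.baseChange_apply k pbwZBasis q).trans ?_
    rw [pbwZBasis, Module.Basis.mk_apply]
    rfl
  rw [this, pbwZ, toHyper_mul, toHyper_mul]
  rfl

theorem coe_pbwBasis : ⇑(pbwBasis k) = pbw k := funext (pbwBasis_apply k)

/-- Integer-valued polynomials as `k`-valued functions on `ℤ`. -/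
noncomputable def evalHom : intValued →ₐ[ℤ] (ℤ → k) where
  toRingHom := (RingHom.pi fun h =>
    (Int.castRingHom k).comp (Pi.evalRingHom (fun _ : ℤ => ℤ) h)).comp evalInt
  commutes' c := map_intCast ((RingHom.pi fun h =>
    (Int.castRingHom k).comp (Pi.evalRingHom (fun _ : ℤ => ℤ) h)).comp evalInt) c

/-- Integer-valued polynomials with coefficients in `k`, as functions on `ℤ`. -/
noncomputable def toFun : k ⊗[ℤ] intValued →ₐ[k] (ℤ → k) :=
  Algebra.TensorProduct.lift (Algebra.ofId k (ℤ → k)) (evalHom k) (fun _ _ => Commute.all _ _)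

theorem toFun_tmul (c : k) (P : intValued) (h : ℤ) :
    toFun k (c ⊗ₜ P) h = c * ((evalInt P h : ℤ) : k) := by
  rw [toFun, Algebra.TensorProduct.lift_tmul]
  rfl

/-- A combination of integer-valued polynomials with coefficients in `k` is determined by its values:
the matrix of the `binom(n, i)` with `n, i ≥ 0` is unitriangular. -/
theorem toFun_injective : Function.Injective (toFun k) := by
  rw [injective_iff_map_eq_zero]
  intro t ht
  set b := binomBasis.baseChange k with hb
  have hbn : ∀ (n i : ℕ), toFun k (b i) (n : ℤ) = ((n.choose i : ℕ) : k) := by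
    intro n i
    rw [hb, Module.Basis.baseChange_apply, toFun_tmul, binomBasis, Module.Basis.mk_apply,
      evalInt_binomI, add_zero, Ring.choose_natCast]
    simp
  have hrep : b.repr t = 0 := by
    ext n
    induction n using Nat.strong_induction_on with
    | _ n ih =>
      have e := congrFun ht (n : ℤ)
      rw [← b.linearCombination_repr t, Finsupp.linearCombination_apply, Finsupp.sum, map_sum,
        Finset.sum_apply, Pi.zero_apply, Finset.sum_eq_single n] at e
      · rw [map_smul, Pi.smul_apply, hbn] at e
        simpa using e
      · intro i _ hin
        rw [map_smul, Pi.smul_apply, hbn]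
        rcases lt_or_gt_of_ne hin with h | h
        · rw [ih i h]; simp
        · simp [Nat.choose_eq_zero_of_lt h]
      · intro h
        rw [Finsupp.notMem_support_iff.1 h]; simp
  simpa using hrep

/-- The algebra of functions on `ℤ` spanned by the binomial functions `h ↦ binom(h, n)`. -/
noncomputable def W : Subalgebra k (ℤ → k) := (toFun k).range

/-- The embedding of the algebra `W` of functions on `ℤ` in the hyperalgebra: the function
`h ↦ binom(h + c, n)` goes to `binom(H + c, n)`. -/
noncomputable def torus : W k →ₐ[k] Hyper k :=
  (Algebra.TensorProduct.map (AlgHom.id k k) torusZ : k ⊗[ℤ] intValued →ₐ[k] k ⊗[ℤ] UZ).comp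
    (AlgEquiv.ofInjective (toFun k) (toFun_injective k)).symm.toAlgHom

/-- The element of `W` given by an integer-valued polynomial with coefficients in `k`. -/
noncomputable def ofTensor : k ⊗[ℤ] intValued ≃ₐ[k] W k :=
  AlgEquiv.ofInjective (toFun k) (toFun_injective k)

theorem ofTensor_coe (t : k ⊗[ℤ] intValued) : (ofTensor k t : ℤ → k) = toFun k t := rfl

theorem torus_ofTensor (c : k) (P : intValued) :
    torus k (ofTensor k (c ⊗ₜ P)) = c • toHyper k (torusZ P) := by
  have : torus k (ofTensor k (c ⊗ₜ P)) = (c ⊗ₜ[ℤ] torusZ P : k ⊗[ℤ] UZ) := by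
    show (Algebra.TensorProduct.map (AlgHom.id k k) torusZ : k ⊗[ℤ] intValued →ₐ[k] k ⊗[ℤ] UZ)
      ((AlgEquiv.ofInjective (toFun k) (toFun_injective k)).symm
        ((AlgEquiv.ofInjective (toFun k) (toFun_injective k)) (c ⊗ₜ P))) = _
    rw [AlgEquiv.symm_apply_apply]
    rfl
  rw [this]
  have e : (c ⊗ₜ[ℤ] torusZ P : k ⊗[ℤ] UZ) = c • ((1 : k) ⊗ₜ[ℤ] torusZ P) := by
    rw [TensorProduct.smul_tmul', smul_eq_mul, mul_one]
  exact e

/-- The function `h ↦ binom(h + c, n)` as an element of `W`. -/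
noncomputable def binW (c : ℤ) (n : ℕ) : W k := ofTensor k (1 ⊗ₜ binomI c n)

variable {k}

theorem binW_apply (c : ℤ) (n : ℕ) (h : ℤ) :
    (binW k c n : ℤ → k) h = ((Ring.choose (h + c) n : ℤ) : k) := by
  rw [binW, ofTensor_coe, toFun_tmul, evalInt_binomI, one_mul]

theorem torus_binW (c : ℤ) (n : ℕ) : torus k (binW k c n) = eH k c n := by
  rw [binW, torus_ofTensor, one_smul]
  rfl

/-- The binomial basis of `W`. -/
noncomputable def basisW : Module.Basis ℕ k (W k) :=
  (binomBasis.baseChange k).map (ofTensor k).toLinearEquiv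

theorem basisW_apply (n : ℕ) : basisW n = binW k 0 n := by
  rw [basisW, Module.Basis.map_apply, Module.Basis.baseChange_apply, binomBasis,
    Module.Basis.mk_apply]
  rfl

/-- An induction principle for `W`. -/
theorem W_induction {motive : W k → Prop}
    (tmul : ∀ (c : k) (P : intValued), motive (ofTensor k (c ⊗ₜ P)))
    (add : ∀ f g, motive f → motive g → motive (f + g)) (f : W k) : motive f := by
  obtain ⟨t, rfl⟩ := (ofTensor k).surjective f
  induction t with
  | zero => simpa using tmul 0 0
  | tmul c P => exact tmul c P
  | add s t hs ht => rw [map_add]; exact add _ _ hs ht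

/-- The translate `P(T + c)` of an integer-valued polynomial. -/
noncomputable def shiftI (c : ℤ) (P : intValued) : intValued :=
  ⟨(P : ℂ[X]).comp (X + C (c : ℂ)), comp_mem_intValued P.2 c⟩

theorem evalInt_shiftI (c : ℤ) (P : intValued) (h : ℤ) :
    evalInt (shiftI c P) h = evalInt P (h + c) := by
  apply Int.cast_injective (α := ℂ)
  rw [evalInt_cast, evalInt_cast]
  simp [shiftI]

theorem shift_tmul (c : ℤ) (d : k) (P : intValued) :
    (fun h => (ofTensor k (d ⊗ₜ P) : ℤ → k) (h + c)) = (ofTensor k (d ⊗ₜ shiftI c P) : ℤ → k) := by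
  funext h
  rw [ofTensor_coe, ofTensor_coe, toFun_tmul, toFun_tmul, evalInt_shiftI]

/-- The translation `f ↦ f(· + c)` of `W`. -/
noncomputable def shiftW (c : ℤ) : W k →ₐ[k] W k where
  toFun f := ⟨fun h => (f : ℤ → k) (h + c), by
    induction f using W_induction with
    | tmul d P => rw [shift_tmul]; exact (ofTensor k (d ⊗ₜ shiftI c P)).2
    | add f g hf hg => exact add_mem hf hg⟩
  map_one' := rfl
  map_zero' := rfl
  map_mul' _ _ := rfl
  map_add' _ _ := rfl
  commutes' _ := rfl

theorem shiftW_apply (c : ℤ) (f : W k) (h : ℤ) : (shiftW c f : ℤ → k) h = (f : ℤ → k) (h + c) :=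
  rfl

theorem shiftW_shiftW (c d : ℤ) (f : W k) : shiftW c (shiftW d f) = shiftW (c + d) f := by
  apply Subtype.ext
  funext h
  rw [shiftW_apply, shiftW_apply, shiftW_apply, add_assoc]

theorem shiftW_zero (f : W k) : shiftW 0 f = f := by
  apply Subtype.ext
  funext h
  rw [shiftW_apply, add_zero]

theorem shiftW_binW (c d : ℤ) (n : ℕ) : shiftW c (binW k d n) = binW k (c + d) n := by
  apply Subtype.ext
  funext h
  rw [shiftW_apply, binW_apply, binW_apply, add_assoc]

theorem shiftW_ofTensor (c : ℤ) (d : k) (P : intValued) :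
    shiftW c (ofTensor k (d ⊗ₜ P)) = ofTensor k (d ⊗ₜ shiftI c P) :=
  Subtype.ext (shift_tmul c d P)

/-! ### Relations in the hyperalgebra -/

theorem eX_zero : eX k 0 = 1 := by
  rw [eX, ← toHyper_one]
  congr 1
  exact Subtype.ext (divPow_zero xC)

theorem eY_zero : eY k 0 = 1 := by
  rw [eY, ← toHyper_one]
  congr 1
  exact Subtype.ext (divPow_zero yC)

theorem eX_mul_eX (m n : ℕ) : eX k m * eX k n = ((m + n).choose m : k) • eX k (m + n) := by
  rw [Nat.cast_smul_eq_nsmul]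
  simp only [eX, ← toHyperHom_apply, ← map_mul, ← map_nsmul]
  congr 1
  exact Subtype.ext (divPow_mul_divPow xC m n)

theorem eY_mul_eY (m n : ℕ) : eY k m * eY k n = ((m + n).choose m : k) • eY k (m + n) := by
  rw [Nat.cast_smul_eq_nsmul]
  simp only [eY, ← toHyperHom_apply, ← map_mul, ← map_nsmul]
  congr 1
  exact Subtype.ext (divPow_mul_divPow yC m n)

theorem eX_mul_torus (m : ℕ) (f : W k) :
    eX k m * torus k f = torus k (shiftW (-2 * m) f) * eX k m := by
  induction f using W_induction with
  | add f g hf hg => simp only [map_add, mul_add, add_mul, hf, hg]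
  | tmul d P =>
    rw [shiftW_ofTensor, torus_ofTensor, torus_ofTensor, mul_smul_comm, smul_mul_assoc, eX,
      ← toHyper_mul, ← toHyper_mul]
    congr 2
    exact Subtype.ext (divPow_xC_mul_aeval m P)

theorem eY_mul_torus (m : ℕ) (f : W k) :
    eY k m * torus k f = torus k (shiftW (2 * m) f) * eY k m := by
  induction f using W_induction with
  | add f g hf hg => simp only [map_add, mul_add, add_mul, hf, hg]
  | tmul d P =>
    rw [shiftW_ofTensor, torus_ofTensor, torus_ofTensor, mul_smul_comm, smul_mul_assoc, eY,
      ← toHyper_mul, ← toHyper_mul]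
    congr 2
    exact Subtype.ext (divPow_yC_mul_aeval m P)

theorem torus_mul_eX (m : ℕ) (f : W k) :
    torus k f * eX k m = eX k m * torus k (shiftW (2 * m) f) := by
  rw [eX_mul_torus, shiftW_shiftW, show (-2 * m + 2 * m : ℤ) = 0 by ring, shiftW_zero]

theorem torus_mul_eY (m : ℕ) (f : W k) :
    torus k f * eY k m = eY k m * torus k (shiftW (-2 * m) f) := by
  rw [eY_mul_torus, shiftW_shiftW, show (2 * m + -2 * m : ℤ) = 0 by ring, shiftW_zero]

/-- The commutation formula for `X^(m) Y^(n)`. -/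
theorem eX_mul_eY (m n : ℕ) :
    eX k m * eY k n = ∑ t ∈ Finset.range (m + 1), if t ≤ n then
      eY k (n - t) * torus k (binW k (2 * t - m - n) t) * eX k (m - t) else 0 := by
  have h := divPow_mul_divPow_eq_sum xC_mul_yC hC_mul_xC hC_mul_yC m n
  have h' : (⟨divPow xC m, divPow_xC_mem m⟩ : UZ) * ⟨divPow yC n, divPow_yC_mem n⟩
      = ∑ t ∈ Finset.range (m + 1), if t ≤ n then
        (⟨divPow yC (n - t), divPow_yC_mem _⟩ : UZ) * ⟨binomH (2 * t - m - n) t, binomH_mem _ _⟩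
          * ⟨divPow xC (m - t), divPow_xC_mem _⟩ else 0 := by
    apply Subtype.ext
    refine h.trans ?_
    rw [AddSubmonoidClass.coe_finsetSum]
    refine Finset.sum_congr rfl fun t _ => ?_
    unfold downPow
    split_ifs
    · rfl
    · simp
  rw [eX, eY, ← toHyper_mul, h', ← toHyperHom_apply, map_sum]
  refine Finset.sum_congr rfl fun t _ => ?_
  split_ifs
  · rw [map_mul, map_mul, torus_binW]; rfl
  · exact map_zero _

/-- The monomial `Y^(m) f(H) X^(n)`. -/
noncomputable def mon (m : ℕ) (f : W k) (n : ℕ) : Hyper k := eY k m * torus k f * eX k n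

theorem pbw_eq_mon (q : ℕ × ℕ × ℕ) : pbw k q = mon q.1 (binW k 0 q.2.1) q.2.2 := by
  rw [mon, torus_binW]; rfl

theorem mon_add (m n : ℕ) (f g : W k) : mon m (f + g) n = mon m f n + mon m g n := by
  simp only [mon, map_add, mul_add, add_mul]

theorem mon_smul (m n : ℕ) (c : k) (f : W k) : mon m (c • f) n = c • mon m f n := by
  simp only [mon, map_smul, mul_smul_comm, smul_mul_assoc]

/-- `f ↦ Y^(m) f(H) X^(n)` as a linear map. -/
noncomputable def monL (m n : ℕ) : W k →ₗ[k] Hyper k where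
  toFun f := mon m f n
  map_add' := mon_add m n
  map_smul' := mon_smul m n

theorem monL_apply (m n : ℕ) (f : W k) : monL m n f = mon m f n := rfl

theorem mon_zero (m n : ℕ) : mon m (0 : W k) n = 0 := (monL m n).map_zero

/-- Linear maps on the hyperalgebra can be prescribed on the monomials `Y^(m) f(H) X^(n)`. -/
theorem exists_linearMap {V : Type*} [AddCommGroup V] [Module k V]
    (φ : ℕ → ℕ → W k →ₗ[k] V) : ∃ L : Hyper k →ₗ[k] V, ∀ m n f, L (mon m f n) = φ m n f := by
  refine ⟨(pbwBasis k).constr k fun q => φ q.1 q.2.2 (binW k 0 q.2.1), fun m n f => ?_⟩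
  have : ((pbwBasis k).constr k fun q => φ q.1 q.2.2 (binW k 0 q.2.1)) ∘ₗ monL m n = φ m n := by
    refine basisW.ext fun l => ?_
    rw [basisW_apply, LinearMap.comp_apply, monL_apply]
    have := (pbwBasis k).constr_basis k (fun q => φ q.1 q.2.2 (binW k 0 q.2.1)) (m, l, n)
    rw [pbwBasis_apply, pbw_eq_mon] at this
    exact this
  exact LinearMap.congr_fun this f

/-- An induction principle: the monomials `Y^(m) f(H) X^(n)` span the hyperalgebra. -/
theorem hyper_induction {motive : Hyper k → Prop} (zero : motive 0)
    (mon : ∀ m (f : W k) n, motive (mon m f n))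
    (add : ∀ u v, motive u → motive v → motive (u + v)) (u : Hyper k) : motive u := by
  have hu : u ∈ Submodule.span k (Set.range (pbwBasis k)) := by
    rw [(pbwBasis k).span_eq]; trivial
  have : ∀ c : k, motive (c • u) := by
    induction hu using Submodule.span_induction with
    | zero => intro c; rwa [smul_zero]
    | add u v _ _ hu hv => intro c; rw [smul_add]; exact add _ _ (hu c) (hv c)
    | smul d u _ hu => intro c; rw [smul_smul]; exact hu _
    | mem u hu =>
      obtain ⟨q, rfl⟩ := hu
      intro c
      rw [pbwBasis_apply, pbw_eq_mon, ← mon_smul]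
      exact mon _ _ _
  simpa using this 1

end

/-! ### Periodic functions in characteristic `p` -/

section

variable {k : Type*} [Field k] (p : ℕ) [Fact p.Prime] [CharP k p]

/-- In characteristic `p`, the function `h ↦ binom(h, n)` with `n < p ^ N` has period `p ^ N`. -/
theorem cast_choose_add_pow {N n : ℕ} (hn : n < p ^ N) (h : ℤ) :
    ((Ring.choose (h + (p : ℤ) ^ N) n : ℤ) : k) = ((Ring.choose h n : ℤ) : k) := by
  rw [Ring.add_choose_eq _ (Commute.all _ _), Int.cast_sum, Finset.sum_eq_single (n, 0)]
  · simp
  · rintro ⟨i, j⟩ hij hne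
    have hij' : i + j = n := by simpa using hij
    have hj : j ≠ 0 := by
      rintro rfl
      exact hne (by simp [← hij'])
    have hd : p ∣ (p ^ N).choose j := (Fact.out : p.Prime).dvd_choose_pow hj (by omega)
    have : Ring.choose ((p : ℤ) ^ N) j = (((p ^ N).choose j : ℕ) : ℤ) := by
      rw [← Ring.choose_natCast]; push_cast; rfl
    rw [this, Int.cast_mul, Int.cast_natCast, (CharP.cast_eq_zero_iff k p _).2 hd, mul_zero]
  · intro h
    simp at h

theorem cast_choose_add_mul_pow {N n : ℕ} (hn : n < p ^ N) (h c : ℤ) :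
    ((Ring.choose (h + c * (p : ℤ) ^ N) n : ℤ) : k) = ((Ring.choose h n : ℤ) : k) := by
  induction c using Int.induction_on with
  | zero => simp
  | succ c ih =>
    rw [← ih, add_mul, one_mul, ← add_assoc, cast_choose_add_pow p hn]
  | pred c ih =>
    rw [← ih, sub_mul, one_mul, ← cast_choose_add_pow p hn (h + (-c * (p : ℤ) ^ N - (p : ℤ) ^ N)),
      show h + (-c * (p : ℤ) ^ N - (p : ℤ) ^ N) + (p : ℤ) ^ N = h + -c * (p : ℤ) ^ N by ring]

/-- The functions in `W` of period `p ^ N`. -/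
def perW (N : ℕ) : Subalgebra k (W k) where
  carrier := {f | ∀ h : ℤ, (f : ℤ → k) (h + (p : ℤ) ^ N) = (f : ℤ → k) h}
  mul_mem' {f g} hf hg h := by
    show (f : ℤ → k) _ * (g : ℤ → k) _ = (f : ℤ → k) _ * (g : ℤ → k) _
    rw [hf, hg]
  add_mem' {f g} hf hg h := by
    show (f : ℤ → k) _ + (g : ℤ → k) _ = (f : ℤ → k) _ + (g : ℤ → k) _
    rw [hf, hg]
  algebraMap_mem' _ _ := rfl

variable {p}

theorem perW_apply_add_mul {N : ℕ} {f : W k} (hf : f ∈ perW p N) (h c : ℤ) :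
    (f : ℤ → k) (h + c * (p : ℤ) ^ N) = (f : ℤ → k) h := by
  induction c using Int.induction_on with
  | zero => simp
  | succ c ih => rw [← ih, add_mul, one_mul, ← add_assoc, hf]
  | pred c ih =>
    rw [← ih, sub_mul, one_mul, ← hf (h + (-c * (p : ℤ) ^ N - (p : ℤ) ^ N)),
      show h + (-c * (p : ℤ) ^ N - (p : ℤ) ^ N) + (p : ℤ) ^ N = h + -c * (p : ℤ) ^ N by ring]

theorem perW_apply_eq {N : ℕ} {f : W k} (hf : f ∈ perW p N) {h h' : ℤ}
    (hh : (p : ℤ) ^ N ∣ h - h') : (f : ℤ → k) h = (f : ℤ → k) h' := by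
  obtain ⟨c, hc⟩ := hh
  rw [show h = h' + c * (p : ℤ) ^ N by linear_combination hc, perW_apply_add_mul hf]

theorem perW_mono {N M : ℕ} (hNM : N ≤ M) : perW p N ≤ perW (k := k) p M := by
  intro f hf h
  apply perW_apply_eq hf
  rw [add_sub_cancel_left]
  exact pow_dvd_pow _ hNM

theorem binW_mem_perW {N n : ℕ} (c : ℤ) (hn : n < p ^ N) : binW k c n ∈ perW p N := by
  intro h
  rw [binW_apply, binW_apply, add_right_comm, cast_choose_add_pow p hn]

theorem shiftW_mem_perW {N : ℕ} {f : W k} (hf : f ∈ perW p N) (c : ℤ) :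
    shiftW c f ∈ perW p N := by
  intro h
  rw [shiftW_apply, shiftW_apply, add_right_comm, hf]

theorem exists_mem_perW (p : ℕ) [Fact p.Prime] [CharP k p] (f : W k) : ∃ N, f ∈ perW p N := by
  have hf : f ∈ Submodule.span k (Set.range (basisW (k := k))) := by
    rw [basisW.span_eq]; trivial
  induction hf using Submodule.span_induction with
  | zero => exact ⟨0, zero_mem _⟩
  | add f g _ _ hf hg =>
    obtain ⟨N, hN⟩ := hf
    obtain ⟨M, hM⟩ := hg
    exact ⟨max N M, add_mem (perW_mono (le_max_left _ _) hN) (perW_mono (le_max_right _ _) hM)⟩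
  | smul c f _ hf =>
    obtain ⟨N, hN⟩ := hf
    exact ⟨N, Subalgebra.smul_mem _ hN c⟩
  | mem f hf =>
    obtain ⟨n, rfl⟩ := hf
    rw [basisW_apply]
    exact ⟨n, binW_mem_perW 0 (Nat.lt_pow_self (Fact.out : p.Prime).one_lt)⟩

variable (k p) in
/-- The indicator function of the residue class of `b` modulo `p ^ N`. -/
noncomputable def ind (N : ℕ) (b : ℤ) : W k := binW k (-b - 1) (p ^ N - 1)

theorem pow_pos_of_prime (p : ℕ) [Fact p.Prime] (N : ℕ) : 0 < p ^ N :=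
  pow_pos (Fact.out : p.Prime).pos N

theorem ind_mem_perW (N : ℕ) (b : ℤ) : ind k p N b ∈ perW p N :=
  binW_mem_perW _ (by have := pow_pos_of_prime p N; omega)

open Classical in
theorem ind_apply (N : ℕ) (b h : ℤ) :
    (ind k p N b : ℤ → k) h = if (p : ℤ) ^ N ∣ h - b then 1 else 0 := by
  have hp : 0 < p ^ N := pow_pos_of_prime p N
  have hp' : (0 : ℤ) < (p : ℤ) ^ N := by exact_mod_cast hp
  set n : ℤ := h + (-b - 1) with hn
  obtain ⟨m, hm⟩ := Int.eq_ofNat_of_zero_le (Int.emod_nonneg n hp'.ne')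
  have hmlt : m < p ^ N := by
    have := Int.emod_lt_of_pos n hp'
    rw [hm] at this
    exact_mod_cast this
  have hnm : n = (m : ℤ) + n / (p : ℤ) ^ N * (p : ℤ) ^ N := by
    have := Int.emod_add_ediv_mul n ((p : ℤ) ^ N)
    rw [hm] at this
    exact this.symm
  rw [ind, binW_apply, ← hn, hnm, cast_choose_add_mul_pow p (by omega), Ring.choose_natCast]
  have key : (p : ℤ) ^ N ∣ h - b ↔ m = p ^ N - 1 := by
    have e : h - b = (m + 1 : ℤ) + n / (p : ℤ) ^ N * (p : ℤ) ^ N := by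
      rw [show h - b = n + 1 by rw [hn]; ring]
      linear_combination hnm
    rw [e, Int.dvd_add_left (Dvd.intro_left _ rfl)]
    constructor
    · intro hd
      have hd' : p ^ N ∣ m + 1 := by exact_mod_cast hd
      have := Nat.le_of_dvd (by omega) hd'
      omega
    · intro hm
      have : (m + 1 : ℤ) = (p : ℤ) ^ N := by
        have : m + 1 = p ^ N := by omega
        exact_mod_cast this
      rw [this]
  by_cases hm1 : m = p ^ N - 1
  · rw [if_pos (key.2 hm1), hm1, Nat.choose_self]; simp
  · rw [if_neg (fun h => hm1 (key.1 h)), Nat.choose_eq_zero_of_lt (by omega)]; simp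

theorem eq_sum_ind_of_periodic {N : ℕ} {f : ℤ → k} (hf : ∀ h, f (h + (p : ℤ) ^ N) = f h) :
    f = ∑ b ∈ Finset.range (p ^ N), f b • (ind k p N b : ℤ → k) := by
  classical
  have hp : 0 < p ^ N := pow_pos_of_prime p N
  have hp' : (0 : ℤ) < (p : ℤ) ^ N := by exact_mod_cast hp
  have hper : ∀ h c : ℤ, f (h + c * (p : ℤ) ^ N) = f h := by
    intro h c
    induction c using Int.induction_on with
    | zero => simp
    | succ c ih => rw [← ih, add_mul, one_mul, ← add_assoc, hf]
    | pred c ih =>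
      rw [← ih, sub_mul, one_mul, ← hf (h + (-c * (p : ℤ) ^ N - (p : ℤ) ^ N)),
        show h + (-c * (p : ℤ) ^ N - (p : ℤ) ^ N) + (p : ℤ) ^ N = h + -c * (p : ℤ) ^ N by ring]
  funext n
  obtain ⟨m, hm⟩ := Int.eq_ofNat_of_zero_le (Int.emod_nonneg n hp'.ne')
  have hmlt : m < p ^ N := by
    have := Int.emod_lt_of_pos n hp'
    rw [hm] at this
    exact_mod_cast this
  have hnm : n = (m : ℤ) + n / (p : ℤ) ^ N * (p : ℤ) ^ N := by
    have := Int.emod_add_ediv_mul n ((p : ℤ) ^ N)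
    rw [hm] at this
    exact this.symm
  rw [Finset.sum_apply, Finset.sum_eq_single m]
  · rw [Pi.smul_apply, ind_apply, if_pos, smul_eq_mul, mul_one]
    · conv_lhs => rw [hnm]
      exact hper _ _
    · exact ⟨n / (p : ℤ) ^ N, by linear_combination hnm⟩
  · intro b hb hbm
    rw [Pi.smul_apply, ind_apply, if_neg, smul_zero]
    intro hd
    have hd' : (p : ℤ) ^ N ∣ (m : ℤ) - b := by
      have : (m : ℤ) - b = (n - b) + (-(n / (p : ℤ) ^ N)) * (p : ℤ) ^ N := by
        linear_combination -hnm
      rw [this]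
      exact dvd_add hd (Dvd.intro_left _ rfl)
    apply hbm
    have h1 : (b : ℤ) ≡ m [ZMOD ((p ^ N : ℕ) : ℤ)] := (Int.modEq_iff_dvd).2 (by exact_mod_cast hd')
    have h2 := (Int.natCast_modEq_iff).1 h1
    rw [Nat.ModEq, Nat.mod_eq_of_lt (Finset.mem_range.1 hb), Nat.mod_eq_of_lt hmlt] at h2
    exact h2
  · intro h
    exact absurd (Finset.mem_range.2 hmlt) h

theorem mem_W_of_periodic {N : ℕ} {f : ℤ → k} (hf : ∀ h, f (h + (p : ℤ) ^ N) = f h) :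
    f ∈ W k := by
  rw [eq_sum_ind_of_periodic hf]
  exact sum_mem fun b _ => Subalgebra.smul_mem _ (ind k p N b).2 _

theorem eq_sum_ind {N : ℕ} {f : W k} (hf : f ∈ perW p N) :
    f = ∑ b ∈ Finset.range (p ^ N), (f : ℤ → k) b • ind k p N b := by
  apply Subtype.ext
  rw [AddSubmonoidClass.coe_finsetSum]
  exact eq_sum_ind_of_periodic hf

/-- The functions of period `p ^ N` are the combinations of `binom(h, n)` with `n < p ^ N`. -/
theorem mem_span_binW {N : ℕ} {f : W k} (hf : f ∈ perW p N) :
    f ∈ Submodule.span k {g | ∃ n < p ^ N, g = binW k 0 n} := by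
  have hp : 0 < p ^ N := pow_pos_of_prime p N
  rw [eq_sum_ind hf]
  refine Submodule.sum_mem _ fun b _ => Submodule.smul_mem _ _ ?_
  have : ind k p N b = ∑ ij ∈ Finset.HasAntidiagonal.antidiagonal (p ^ N - 1),
      ((Ring.choose (-(b : ℤ) - 1) ij.2 : ℤ) : k) • binW k 0 ij.1 := by
    apply Subtype.ext
    rw [AddSubmonoidClass.coe_finsetSum]
    funext h
    rw [Finset.sum_apply, ind, binW_apply, Ring.add_choose_eq _ (Commute.all _ _), Int.cast_sum]
    refine Finset.sum_congr rfl fun ij _ => ?_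
    show _ = _ * (binW k 0 ij.1 : ℤ → k) h
    rw [binW_apply, add_zero, Int.cast_mul, mul_comm]
  rw [this]
  refine Submodule.sum_mem _ fun ij hij => Submodule.smul_mem _ _ (Submodule.subset_span ?_)
  have : ij.1 + ij.2 = p ^ N - 1 := by simpa using hij
  exact ⟨ij.1, by omega, rfl⟩

theorem floor_periodic {N : ℕ} {f : W k} (hf : f ∈ perW p N) (h : ℤ) :
    (f : ℤ → k) ((h + (p : ℤ) ^ (N + 1)) / p) = (f : ℤ → k) (h / p) := by
  have hp : (p : ℤ) ≠ 0 := by exact_mod_cast (Fact.out : p.Prime).ne_zero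
  rw [pow_succ, Int.add_mul_ediv_right _ _ hp, hf]

variable (k p) in
/-- The map `f ↦ f(⌊· / p⌋)` on `W`, through which `Fr'` acts on the torus part. -/
noncomputable def floorW : W k →ₐ[k] W k where
  toFun f := ⟨fun h => (f : ℤ → k) (h / p), by
    obtain ⟨N, hN⟩ := exists_mem_perW p f
    exact mem_W_of_periodic (floor_periodic hN)⟩
  map_one' := rfl
  map_zero' := rfl
  map_mul' _ _ := rfl
  map_add' _ _ := rfl
  commutes' _ := rfl

theorem floorW_apply (f : W k) (h : ℤ) : (floorW k p f : ℤ → k) h = (f : ℤ → k) (h / p) := rfl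

theorem floorW_mem_perW {N : ℕ} {f : W k} (hf : f ∈ perW p N) : floorW k p f ∈ perW p (N + 1) :=
  floor_periodic hf

variable (p) in
theorem cast_choose_eq (n m : ℕ) : ((n.choose m : ℕ) : k)
    = (((n % p).choose (m % p) : ℕ) : k) * (((n / p).choose (m / p) : ℕ) : k) := by
  have := (Choose.choose_modEq_choose_mod_mul_choose_div_nat (n := n) (k := m) (p := p))
  rw [← Nat.cast_mul]
  exact (CharP.cast_eq_iff_mod_eq k p).2 this

variable (p) in
theorem cast_choose_mul_mul (n m : ℕ) :
    (((n * p).choose (m * p) : ℕ) : k) = ((n.choose m : ℕ) : k) := by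
  have hp := (Fact.out : p.Prime).pos
  rw [cast_choose_eq p]
  simp [Nat.mul_div_cancel _ hp]

/-- Lucas' theorem: in characteristic `p`, `binom(h, n p) = binom(⌊h / p⌋, n)` for all integers `h`.
-/
theorem cast_choose_floor (h : ℤ) (n : ℕ) :
    ((Ring.choose h (n * p) : ℤ) : k) = ((Ring.choose (h / p) n : ℤ) : k) := by
  have hp := (Fact.out : p.Prime).pos
  have hp0 : (p : ℤ) ≠ 0 := by exact_mod_cast hp.ne'
  have hp1 := (Fact.out : p.Prime).one_lt
  set N := n * p + 1 with hN
  have h1 : n * p < p ^ (N + 1) := lt_of_lt_of_le (Nat.lt_pow_self hp1)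
    (Nat.pow_le_pow_right hp (by omega))
  have h2 : n < p ^ N := lt_of_le_of_lt (Nat.le_mul_of_pos_right n hp)
    (lt_of_lt_of_le (Nat.lt_pow_self hp1) (Nat.pow_le_pow_right hp (by omega)))
  obtain ⟨m, hm⟩ : ∃ m : ℕ, h + |h| * (p : ℤ) ^ (N + 1) = m := by
    apply Int.eq_ofNat_of_zero_le
    have : (1 : ℤ) ≤ (p : ℤ) ^ (N + 1) := by exact_mod_cast Nat.one_le_pow _ _ hp
    have := mul_le_mul_of_nonneg_left this (abs_nonneg h)
    have := neg_abs_le h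
    linarith
  rw [← cast_choose_add_mul_pow p h1 h |h|, ← cast_choose_add_mul_pow p h2 (h / p) |h|,
    ← Int.add_mul_ediv_right _ _ hp0, mul_assoc, ← pow_succ, hm, Ring.choose_natCast]
  have : ((m : ℤ) / (p : ℤ)) = ((m / p : ℕ) : ℤ) := by push_cast; rfl
  rw [this, Ring.choose_natCast, Int.cast_natCast, Int.cast_natCast, cast_choose_eq p]
  simp [Nat.mul_div_cancel _ hp]

theorem floorW_binW (n : ℕ) : floorW k p (binW k 0 n) = binW k 0 (n * p) := by
  apply Subtype.ext
  funext h
  rw [floorW_apply, binW_apply, binW_apply, add_zero, add_zero, cast_choose_floor]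

/-- The map `Fr'` on the monomials `Y^(m) f(H) X^(n)` for an arbitrary `f` in `W`. -/
theorem frob'_mon (m n : ℕ) (f : W k) :
    frob' k p (mon m f n) = mon (m * p) (floorW k p f) (n * p) := by
  have hker : LinearMap.ker (Finsupp.linearCombination k (pbw k)) = ⊥ := by
    have := (pbwBasis k).linearIndependent
    rw [coe_pbwBasis] at this
    exact LinearMap.ker_eq_bot.2 this
  have : (frob' k p) ∘ₗ monL m n = monL (m * p) (n * p) ∘ₗ (floorW k p).toLinearMap := by
    refine basisW.ext fun l => ?_
    rw [basisW_apply, LinearMap.comp_apply, LinearMap.comp_apply, monL_apply, monL_apply]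
    have h1 : mon m (binW k 0 l) n
        = Finsupp.linearCombination k (pbw k) (Finsupp.single (m, l, n) 1) := by
      rw [Finsupp.linearCombination_single, one_smul, pbw_eq_mon]
    have h2 : pbwCoord k (mon m (binW k 0 l) n) = Finsupp.single (m, l, n) 1 := by
      rw [h1]
      exact LinearMap.leftInverse_apply_of_inj hker _
    rw [frob', LinearMap.comp_apply, h2, Finsupp.linearCombination_single, one_smul, pbw_eq_mon]
    show _ = mon _ (floorW k p (binW k 0 l)) _
    rw [floorW_binW]
  exact LinearMap.congr_fun this f

end

/-! ### The grading of the hyperalgebra and its finite-dimensional subalgebras -/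

section

variable {k : Type*} [Field k]

theorem torus_mul_mon (g f : W k) (m n : ℕ) :
    torus k g * mon m f n = mon m (shiftW (-2 * m) g * f) n := by
  rw [mon, mon, ← mul_assoc, ← mul_assoc, torus_mul_eY, map_mul, mul_assoc (eY k m)]

theorem mon_mul_torus (g f : W k) (m n : ℕ) :
    mon m f n * torus k g = mon m (f * shiftW (-2 * n) g) n := by
  rw [mon, mon, mul_assoc, eX_mul_torus, map_mul]
  simp only [mul_assoc]

theorem eY_mul_mon (l : ℕ) (f : W k) (m n : ℕ) :
    eY k l * mon m f n = ((l + m).choose l : k) • mon (l + m) f n := by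
  rw [mon, mon, ← mul_assoc, ← mul_assoc, eY_mul_eY, smul_mul_assoc, smul_mul_assoc]

/-- The product of `X^(l)` and a monomial. -/
theorem eX_mul_mon (l : ℕ) (f : W k) (m n : ℕ) :
    eX k l * mon m f n = ∑ t ∈ Finset.range (l + 1), if t ≤ m then
      ((l - t + n).choose (l - t) : k) •
        mon (m - t) (binW k (2 * t - l - m) t * shiftW (-2 * (l - t : ℕ)) f) (l - t + n) else 0 := by
  have e : eX k l * mon m f n = eX k l * eY k m * (torus k f * eX k n) := by
    simp only [mon, mul_assoc]
  rw [e, eX_mul_eY, Finset.sum_mul]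
  refine Finset.sum_congr rfl fun t _ => ?_
  split_ifs with ht
  · rw [← mul_assoc, mul_assoc _ (eX k (l - t)), eX_mul_torus, ← mul_assoc, mul_assoc _ (eX k (l - t)),
      eX_mul_eX, mul_smul_comm, mon, map_mul]
    simp only [mul_assoc]
  · exact zero_mul _

variable (k) in
/-- The elements of degree `d` of the hyperalgebra, graded by `deg X = 1`, `deg Y = -1`. -/
noncomputable def homog (d : ℤ) : Submodule k (Hyper k) :=
  Submodule.span k {u | ∃ (m : ℕ) (f : W k) (n : ℕ), (n : ℤ) - m = d ∧ u = mon m f n}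

theorem mon_mem_homog {d : ℤ} {m n : ℕ} (h : (n : ℤ) - m = d) (f : W k) :
    mon m f n ∈ homog k d := Submodule.subset_span ⟨m, f, n, h, rfl⟩

theorem torus_mul_mem_homog {d : ℤ} {u : Hyper k} (hu : u ∈ homog k d) (g : W k) :
    torus k g * u ∈ homog k d := by
  induction hu using Submodule.span_induction with
  | zero => simp
  | add u v _ _ hu hv => rw [mul_add]; exact add_mem hu hv
  | smul c u _ hu => rw [mul_smul_comm]; exact Submodule.smul_mem _ _ hu
  | mem u hu =>
    obtain ⟨m, f, n, h, rfl⟩ := hu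
    rw [torus_mul_mon]; exact mon_mem_homog h _

theorem eY_mul_mem_homog {d : ℤ} {u : Hyper k} (hu : u ∈ homog k d) (l : ℕ) :
    eY k l * u ∈ homog k (d - l) := by
  induction hu using Submodule.span_induction with
  | zero => simp
  | add u v _ _ hu hv => rw [mul_add]; exact add_mem hu hv
  | smul c u _ hu => rw [mul_smul_comm]; exact Submodule.smul_mem _ _ hu
  | mem u hu =>
    obtain ⟨m, f, n, h, rfl⟩ := hu
    rw [eY_mul_mon]
    exact Submodule.smul_mem _ _ (mon_mem_homog (by push_cast; linarith) _)

theorem eX_mul_mem_homog {d : ℤ} {u : Hyper k} (hu : u ∈ homog k d) (l : ℕ) :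
    eX k l * u ∈ homog k (d + l) := by
  induction hu using Submodule.span_induction with
  | zero => simp
  | add u v _ _ hu hv => rw [mul_add]; exact add_mem hu hv
  | smul c u _ hu => rw [mul_smul_comm]; exact Submodule.smul_mem _ _ hu
  | mem u hu =>
    obtain ⟨m, f, n, h, rfl⟩ := hu
    rw [eX_mul_mon]
    refine Submodule.sum_mem _ fun t ht => ?_
    have htl : t ≤ l := Nat.lt_succ_iff.1 (Finset.mem_range.1 ht)
    split_ifs with htm
    · exact Submodule.smul_mem _ _ (mon_mem_homog (by push_cast [htl, htm]; linarith) _)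
    · exact zero_mem _

theorem mul_mem_homog {d e : ℤ} {u v : Hyper k} (hu : u ∈ homog k d) (hv : v ∈ homog k e) :
    u * v ∈ homog k (d + e) := by
  induction hu using Submodule.span_induction with
  | zero => simp
  | add u v _ _ hu hv => rw [add_mul]; exact add_mem hu hv
  | smul c u _ hu => rw [smul_mul_assoc]; exact Submodule.smul_mem _ _ hu
  | mem u hu =>
    obtain ⟨m, f, n, h, rfl⟩ := hu
    have := eY_mul_mem_homog (torus_mul_mem_homog (eX_mul_mem_homog hv n) f) m
    rw [← mul_assoc, ← mul_assoc] at this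
    rw [← h, mon]
    convert this using 2
    ring

theorem torus_mem_homog (f : W k) : torus k f ∈ homog k 0 := by
  have : torus k f = mon 0 f 0 := by rw [mon, eX_zero, eY_zero, one_mul, mul_one]
  rw [this]; exact mon_mem_homog (by simp) f

theorem one_mem_homog : (1 : Hyper k) ∈ homog k 0 := by
  have := torus_mem_homog (1 : W k)
  rwa [map_one] at this

theorem eX_mem_homog (l : ℕ) : eX k l ∈ homog k l := by
  have := eX_mul_mem_homog (one_mem_homog (k := k)) l
  rwa [mul_one, zero_add] at this

theorem eY_mem_homog (l : ℕ) : eY k l ∈ homog k (-l) := by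
  have := eY_mul_mem_homog (one_mem_homog (k := k)) l
  rwa [mul_one, zero_sub] at this

theorem torus_mul_of_mem_homog {d : ℤ} {u : Hyper k} (hu : u ∈ homog k d) (f : W k) :
    torus k f * u = u * torus k (shiftW (2 * d) f) := by
  induction hu using Submodule.span_induction with
  | zero => simp
  | add u v _ _ hu hv => rw [mul_add, add_mul, hu, hv]
  | smul c u _ hu => rw [mul_smul_comm, smul_mul_assoc, hu]
  | mem u hu =>
    obtain ⟨m, g, n, h, rfl⟩ := hu
    rw [torus_mul_mon, mon_mul_torus, mul_comm, shiftW_shiftW, ← h]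
    congr 4
    ring

variable (k) in
/-- The projections to the homogeneous components. -/
theorem exists_proj (d : ℤ) : ∃ π : Hyper k →ₗ[k] Hyper k,
    ∀ m n (f : W k), π (mon m f n) = if (n : ℤ) - m = d then mon m f n else 0 := by
  obtain ⟨π, hπ⟩ := exists_linearMap (V := Hyper k)
    (fun m n => if (n : ℤ) - m = d then monL (k := k) m n else 0)
  refine ⟨π, fun m n f => ?_⟩
  rw [hπ]
  split_ifs <;> rfl

variable (k) in
/-- The projection of the hyperalgebra to its component of degree `d`. -/
noncomputable def proj (d : ℤ) : Hyper k →ₗ[k] Hyper k := (exists_proj k d).choose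

theorem proj_mon (d : ℤ) (m n : ℕ) (f : W k) :
    proj k d (mon m f n) = if (n : ℤ) - m = d then mon m f n else 0 :=
  (exists_proj k d).choose_spec m n f

theorem proj_of_mem {d : ℤ} {u : Hyper k} (hu : u ∈ homog k d) : proj k d u = u := by
  induction hu using Submodule.span_induction with
  | zero => simp
  | add u v _ _ hu hv => rw [map_add, hu, hv]
  | smul c u _ hu => rw [map_smul, hu]
  | mem u hu =>
    obtain ⟨m, f, n, h, rfl⟩ := hu
    rw [proj_mon, if_pos h]

theorem proj_of_mem_ne {d e : ℤ} {u : Hyper k} (hu : u ∈ homog k d) (hde : d ≠ e) :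
    proj k e u = 0 := by
  induction hu using Submodule.span_induction with
  | zero => simp
  | add u v _ _ hu hv => rw [map_add, hu, hv, add_zero]
  | smul c u _ hu => rw [map_smul, hu, smul_zero]
  | mem u hu =>
    obtain ⟨m, f, n, h, rfl⟩ := hu
    rw [proj_mon, if_neg (h ▸ hde)]

/-! ### Commutativity of the degree zero part -/

theorem commute_divPow_mul_divPow {z : UC} (h1 : Commute z (yC * xC)) (h2 : Commute z hC) (m : ℕ) :
    Commute z (divPow yC m * divPow xC m) := by
  induction m with
  | zero => simp [divPow_zero]
  | succ m ih =>
    have hm : ((m : ℂ) + 1) ^ 2 ≠ 0 := by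
      have : ((m : ℂ) + 1) ≠ 0 := by exact_mod_cast Nat.succ_ne_zero m
      exact pow_ne_zero 2 this
    have e := divPow_yx_succ xC_mul_yC hC_mul_xC m
    rw [← inv_smul_smul₀ hm (divPow yC (m + 1) * divPow xC (m + 1)), ← e]
    refine Commute.smul_right (ih.mul_right ?_) _
    refine h1.sub_right ((Nat.cast_commute m z).symm.mul_right ?_)
    exact (h2.add_right (Nat.cast_commute m z).symm).add_right (Commute.one_right z)

theorem commute_eY_mul_eX (m n : ℕ) :
    Commute (eY k m * eX k m) (eY k n * eX k n) := by
  have hc : Commute (yC * xC) hC := by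
    have e1 : hC * (yC * xC) = yC * xC * hC := by
      rw [← mul_assoc, hC_mul_yC, mul_assoc, sub_mul, hC_mul_xC]; noncomm_ring
    exact e1.symm
  have h1 : ∀ n, Commute (yC * xC) (divPow yC n * divPow xC n) :=
    commute_divPow_mul_divPow (Commute.refl _) hc
  have h2 : ∀ n, Commute hC (divPow yC n * divPow xC n) :=
    commute_divPow_mul_divPow hc.symm (Commute.refl _)
  have h3 : Commute (divPow yC m * divPow xC m) (divPow yC n * divPow xC n) :=
    commute_divPow_mul_divPow (h1 m).symm (h2 m).symm n
  have h4 : Commute ((⟨divPow yC m, divPow_yC_mem m⟩ : UZ) * ⟨divPow xC m, divPow_xC_mem m⟩)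
      (⟨divPow yC n, divPow_yC_mem n⟩ * ⟨divPow xC n, divPow_xC_mem n⟩) := Subtype.ext h3
  have h5 := h4.map (toHyperHom k)
  rwa [map_mul, map_mul] at h5

theorem mon_self (m : ℕ) (f : W k) : mon m f m = torus k (shiftW (2 * m) f) * (eY k m * eX k m) := by
  rw [mon, eY_mul_torus, mul_assoc]

/-- The elements of degree zero commute with each other. -/
theorem mul_comm_of_mem_homog {u v : Hyper k} (hu : u ∈ homog k 0) (hv : v ∈ homog k 0) :
    u * v = v * u := by
  have ht : ∀ f : W k, ∀ v ∈ homog k 0, Commute (torus k f) v := by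
    intro f v hv
    have := torus_mul_of_mem_homog hv f
    rwa [mul_zero, shiftW_zero] at this
  have hY : ∀ n, eY k n * eX k n ∈ homog k 0 := by
    intro n
    have := mul_mem_homog (eY_mem_homog (k := k) n) (eX_mem_homog n)
    rwa [neg_add_cancel] at this
  have hC : Commute u v := by
    induction hu using Submodule.span_induction with
    | zero => exact Commute.zero_left _
    | add u v _ _ hu hv => exact hu.add_left hv
    | smul c u _ hu => exact hu.smul_left c
    | mem u hu =>
      obtain ⟨m, f, n, h, rfl⟩ := hu
      obtain rfl : n = m := by omega
      rw [mon_self]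
      refine (ht _ _ hv).mul_left ?_
      induction hv using Submodule.span_induction with
      | zero => exact Commute.zero_right _
      | add u v _ _ hu hv => exact hu.add_right hv
      | smul c u _ hu => exact hu.smul_right c
      | mem u hu =>
        obtain ⟨m', f', n', h', rfl⟩ := hu
        obtain rfl : n' = m' := by omega
        rw [mon_self]
        exact (ht _ _ (hY _)).symm.mul_right (commute_eY_mul_eX _ _)
  exact hC.eq

/-! ### The subalgebras `U_r` and `𝒜_r` -/

variable (p : ℕ) [Fact p.Prime] [CharP k p]

theorem cast_choose_eq_zero {r a b : ℕ} (ha : a < p ^ r) (hb : b < p ^ r) (hab : p ^ r ≤ a + b) :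
    (((a + b).choose a : ℕ) : k) = 0 := by
  obtain ⟨c, hc⟩ := Nat.exists_eq_add_of_le hab
  have := cast_choose_add_pow (k := k) p ha (c : ℤ)
  have e : (c : ℤ) + (p : ℤ) ^ r = ((a + b : ℕ) : ℤ) := by rw [hc]; push_cast; ring
  rw [e, Ring.choose_natCast, Ring.choose_natCast, Nat.choose_eq_zero_of_lt (show c < a by omega)]
    at this
  simpa using this

theorem cast_choose_mul_pow (n m i : ℕ) :
    (((n * p ^ i).choose (m * p ^ i) : ℕ) : k) = ((n.choose m : ℕ) : k) := by
  induction i with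
  | zero => simp
  | succ i ih => rw [pow_succ, ← mul_assoc, ← mul_assoc, cast_choose_mul_mul p, ih]

theorem exists_choose_pow_ne_zero {m : ℕ} (hm : m ≠ 0) :
    ∃ i, p ^ i ≤ m ∧ ((m.choose (p ^ i) : ℕ) : k) ≠ 0 := by
  obtain ⟨i, m', hm', rfl⟩ := Nat.exists_eq_pow_mul_and_not_dvd hm p
    (Fact.out : p.Prime).ne_one
  have hpos : 0 < m' := Nat.pos_of_ne_zero (by rintro rfl; simp at hm')
  refine ⟨i, Nat.le_mul_of_pos_right _ hpos, ?_⟩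
  have := cast_choose_mul_pow (k := k) p m' 1 i
  rw [one_mul, mul_comm] at this
  rw [this, Nat.choose_one_right]
  exact fun h => hm' ((CharP.cast_eq_zero_iff k p m').1 h)

variable (k)

/-- The span of the monomials `Y^(m) f(H) X^(n)` with `m, n < p ^ r` and `f` of period `p ^ r`. -/
noncomputable def Vr (r : ℕ) : Submodule k (Hyper k) :=
  Submodule.span k {u | ∃ m f n, m < p ^ r ∧ n < p ^ r ∧ f ∈ perW p r ∧ u = mon m f n}

/-- The span of the monomials `Y^(m) f(H) X^(m)` with `m < p ^ r` and `f` of period `p ^ r`. -/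
noncomputable def Dr (r : ℕ) : Submodule k (Hyper k) :=
  Submodule.span k {u | ∃ m f, m < p ^ r ∧ f ∈ perW p r ∧ u = mon m f m}

variable {k p}

theorem Dr_le_Vr (r : ℕ) : Dr k p r ≤ Vr k p r :=
  Submodule.span_mono fun _ ⟨m, f, hm, hf, h⟩ => ⟨m, f, m, hm, hm, hf, h⟩

theorem Dr_le_homog (r : ℕ) : Dr k p r ≤ homog k 0 :=
  Submodule.span_mono fun _ ⟨m, f, _, _, h⟩ => ⟨m, f, m, by simp, h⟩

theorem eY_mul_mem_Vr {r l : ℕ} (hl : l < p ^ r) {u : Hyper k} (hu : u ∈ Vr k p r) :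
    eY k l * u ∈ Vr k p r := by
  induction hu using Submodule.span_induction with
  | zero => simp
  | add u v _ _ hu hv => rw [mul_add]; exact add_mem hu hv
  | smul c u _ hu => rw [mul_smul_comm]; exact Submodule.smul_mem _ _ hu
  | mem u hu =>
    obtain ⟨m, f, n, hm, hn, hf, rfl⟩ := hu
    rw [eY_mul_mon]
    by_cases h : l + m < p ^ r
    · exact Submodule.smul_mem _ _ (Submodule.subset_span ⟨_, f, n, h, hn, hf, rfl⟩)
    · rw [cast_choose_eq_zero p hl hm (not_lt.1 h), zero_smul]
      exact zero_mem _

theorem eX_mul_mem_Vr {r l : ℕ} (hl : l < p ^ r) {u : Hyper k} (hu : u ∈ Vr k p r) :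
    eX k l * u ∈ Vr k p r := by
  induction hu using Submodule.span_induction with
  | zero => simp
  | add u v _ _ hu hv => rw [mul_add]; exact add_mem hu hv
  | smul c u _ hu => rw [mul_smul_comm]; exact Submodule.smul_mem _ _ hu
  | mem u hu =>
    obtain ⟨m, f, n, hm, hn, hf, rfl⟩ := hu
    rw [eX_mul_mon]
    refine Submodule.sum_mem _ fun t ht => ?_
    have htl : t ≤ l := Nat.lt_succ_iff.1 (Finset.mem_range.1 ht)
    split_ifs with htm
    · by_cases h : l - t + n < p ^ r
      · refine Submodule.smul_mem _ _ (Submodule.subset_span ⟨_, _, _, by omega, h, ?_, rfl⟩)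
        exact mul_mem (binW_mem_perW _ (by omega)) (shiftW_mem_perW hf _)
      · rw [cast_choose_eq_zero p (show l - t < p ^ r by omega) hn (not_lt.1 h), zero_smul]
        exact zero_mem _
    · exact zero_mem _

theorem one_mem_Vr (r : ℕ) : (1 : Hyper k) ∈ Vr k p r :=
  Submodule.subset_span ⟨0, 1, 0, pow_pos_of_prime p r, pow_pos_of_prime p r, one_mem _, by
    rw [mon, eX_zero, eY_zero, map_one, mul_one, mul_one]⟩

theorem Ur_le_Vr (r : ℕ) : Subalgebra.toSubmodule (Ur k p r) ≤ Vr k p r := by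
  have hall : ∀ u ∈ Ur k p r, ∀ v ∈ Vr k p r, u * v ∈ Vr k p r := by
    intro u hu
    have hlt : ∀ i < r, p ^ i < p ^ r := fun i hi =>
      Nat.pow_lt_pow_right (Fact.out : p.Prime).one_lt hi
    induction hu using Algebra.adjoin_induction with
    | mem u hu =>
      rcases hu with ⟨i, hi, rfl⟩ | ⟨i, hi, rfl⟩
      · exact fun v hv => eX_mul_mem_Vr (hlt i hi) hv
      · exact fun v hv => eY_mul_mem_Vr (hlt i hi) hv
    | algebraMap c =>
      intro v hv
      rw [← Algebra.smul_def]
      exact Submodule.smul_mem _ _ hv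
    | add u v _ _ hu hv => intro w hw; rw [add_mul]; exact add_mem (hu w hw) (hv w hw)
    | mul u v _ _ hu hv => intro w hw; rw [mul_assoc]; exact hu _ (hv w hw)
  intro u hu
  have := hall u hu 1 (one_mem_Vr r)
  rwa [mul_one] at this

theorem eX_mem_Ur {r m : ℕ} (hm : m < p ^ r) : eX k m ∈ Ur k p r := by
  induction m using Nat.strong_induction_on with
  | _ m ih =>
    rcases eq_or_ne m 0 with rfl | hm0
    · rw [eX_zero]; exact one_mem _
    · obtain ⟨i, hi, hc⟩ := exists_choose_pow_ne_zero (k := k) p hm0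
      have e := eX_mul_eX (k := k) (p ^ i) (m - p ^ i)
      rw [Nat.add_sub_cancel' hi] at e
      rw [← inv_smul_smul₀ hc (eX k m), ← e]
      have hpos := pow_pos_of_prime p i
      have hir : i < r :=
        (Nat.pow_lt_pow_iff_right (Fact.out : p.Prime).one_lt).1 (lt_of_le_of_lt hi hm)
      have hmem : eX k (p ^ i) ∈ Ur k p r := Algebra.subset_adjoin (Or.inl ⟨i, hir, rfl⟩)
      exact Subalgebra.smul_mem _ (mul_mem hmem (ih _ (by omega) (by omega))) _

theorem eY_mem_Ur {r m : ℕ} (hm : m < p ^ r) : eY k m ∈ Ur k p r := by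
  induction m using Nat.strong_induction_on with
  | _ m ih =>
    rcases eq_or_ne m 0 with rfl | hm0
    · rw [eY_zero]; exact one_mem _
    · obtain ⟨i, hi, hc⟩ := exists_choose_pow_ne_zero (k := k) p hm0
      have e := eY_mul_eY (k := k) (p ^ i) (m - p ^ i)
      rw [Nat.add_sub_cancel' hi] at e
      rw [← inv_smul_smul₀ hc (eY k m), ← e]
      have hpos := pow_pos_of_prime p i
      have hir : i < r :=
        (Nat.pow_lt_pow_iff_right (Fact.out : p.Prime).one_lt).1 (lt_of_le_of_lt hi hm)
      have hmem : eY k (p ^ i) ∈ Ur k p r := Algebra.subset_adjoin (Or.inr ⟨i, hir, rfl⟩)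
      exact Subalgebra.smul_mem _ (mul_mem hmem (ih _ (by omega) (by omega))) _

variable (k) in
theorem binW_mem_span (c : ℤ) (n : ℕ) :
    binW k c n ∈ Submodule.span k {g | ∃ l ≤ n, g = binW k 0 l} := by
  have : binW k c n = ∑ ij ∈ Finset.HasAntidiagonal.antidiagonal n,
      ((Ring.choose c ij.2 : ℤ) : k) • binW k 0 ij.1 := by
    apply Subtype.ext
    rw [AddSubmonoidClass.coe_finsetSum]
    funext h
    rw [Finset.sum_apply, binW_apply, Ring.add_choose_eq _ (Commute.all _ _), Int.cast_sum]
    refine Finset.sum_congr rfl fun ij _ => ?_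
    show _ = _ * (binW k 0 ij.1 : ℤ → k) h
    rw [binW_apply, add_zero, Int.cast_mul, mul_comm]
  rw [this]
  refine Submodule.sum_mem _ fun ij hij => Submodule.smul_mem _ _ (Submodule.subset_span ?_)
  have : ij.1 + ij.2 = n := by simpa using hij
  exact ⟨ij.1, by omega, rfl⟩

theorem torus_binW_mem_of_forall {S : Submodule k (Hyper k)} {n : ℕ}
    (h : ∀ l ≤ n, torus k (binW k 0 l) ∈ S) (c : ℤ) : torus k (binW k c n) ∈ S := by
  have : Submodule.span k {g | ∃ l ≤ n, g = binW k 0 l} ≤ S.comap (torus k).toLinearMap := by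
    rw [Submodule.span_le]
    rintro _ ⟨l, hl, rfl⟩
    exact h l hl
  exact this (binW_mem_span k c n)

theorem torus_binW_mem_Ur {r n : ℕ} (hn : n < p ^ r) : torus k (binW k 0 n) ∈ Ur k p r := by
  induction n using Nat.strong_induction_on with
  | _ n ih =>
    have e := eX_mul_eY (k := k) n n
    rw [Finset.sum_range_succ, if_pos le_rfl, Nat.sub_self, eX_zero, eY_zero, one_mul, mul_one,
      show (2 * n - n - n : ℤ) = 0 by ring] at e
    rw [← sub_eq_of_eq_add' e]
    refine sub_mem (mul_mem (eX_mem_Ur hn) (eY_mem_Ur hn)) (sum_mem fun t ht => ?_)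
    have ht' : t < n := Finset.mem_range.1 ht
    rw [if_pos ht'.le]
    refine mul_mem (mul_mem (eY_mem_Ur (by omega)) ?_) (eX_mem_Ur (by omega))
    exact torus_binW_mem_of_forall (S := Subalgebra.toSubmodule (Ur k p r))
      (fun l hl => ih l (by omega) (by omega)) _

theorem torus_mem_Ur {r : ℕ} {f : W k} (hf : f ∈ perW p r) : torus k f ∈ Ur k p r := by
  have : Submodule.span k {g | ∃ n < p ^ r, g = binW k 0 n}
      ≤ (Subalgebra.toSubmodule (Ur k p r)).comap (torus k).toLinearMap := by
    rw [Submodule.span_le]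
    rintro _ ⟨l, hl, rfl⟩
    exact torus_binW_mem_Ur hl
  exact this (mem_span_binW hf)

theorem Vr_le_Ur (r : ℕ) : Vr k p r ≤ Subalgebra.toSubmodule (Ur k p r) := by
  rw [Vr, Submodule.span_le]
  rintro _ ⟨m, f, n, hm, hn, hf, rfl⟩
  exact (Ur k p r).mul_mem ((Ur k p r).mul_mem (eY_mem_Ur hm) (torus_mem_Ur hf)) (eX_mem_Ur hn)

theorem mem_Ur_iff {r : ℕ} {u : Hyper k} : u ∈ Ur k p r ↔ u ∈ Vr k p r :=
  ⟨fun h => Ur_le_Vr r h, fun h => Vr_le_Ur r h⟩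

theorem torus_binW_mem_U0 (n : ℕ) : torus k (binW k 0 n) ∈ U0 k p := by
  induction n using Nat.strong_induction_on with
  | _ n ih =>
    rcases eq_or_ne n 0 with rfl | hn0
    · have : binW k 0 0 = 1 := by
        apply Subtype.ext
        funext h
        rw [binW_apply, Ring.choose_zero_right, Int.cast_one]; rfl
      rw [this, map_one]; exact one_mem _
    · obtain ⟨i, hi, hc⟩ := exists_choose_pow_ne_zero (k := k) p hn0
      have e : ((n.choose (p ^ i) : ℕ) : k) • binW k 0 n
          = binW k 0 (p ^ i) * binW k (-(p ^ i : ℕ)) (n - p ^ i) := by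
        apply Subtype.ext
        funext h
        show _ * (binW k 0 n : ℤ → k) h = (binW k 0 _ : ℤ → k) h * (binW k _ _ : ℤ → k) h
        have := congrArg (Int.cast : ℤ → k) (Ring.choose_smul_choose h hi)
        rw [nsmul_eq_mul, Int.cast_mul, Int.cast_mul, Int.cast_natCast] at this
        rw [binW_apply, binW_apply, binW_apply, add_zero, this, sub_eq_add_neg]
      rw [← inv_smul_smul₀ hc (binW k 0 n), e, map_smul, map_mul]
      have hpos := pow_pos_of_prime p i
      have hmem : torus k (binW k 0 (p ^ i)) ∈ U0 k p :=
        Algebra.subset_adjoin ⟨i, torus_binW _ _⟩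
      refine Subalgebra.smul_mem _ (mul_mem hmem ?_) _
      exact torus_binW_mem_of_forall (S := Subalgebra.toSubmodule (U0 k p))
        (fun l hl => ih l (by omega)) _

theorem torus_mem_Ainf (f : W k) : torus k f ∈ Ainf k p := by
  obtain ⟨r, hf⟩ := exists_mem_perW p f
  have : Submodule.span k {g | ∃ n < p ^ r, g = binW k 0 n}
      ≤ (Subalgebra.toSubmodule (Ainf k p)).comap (torus k).toLinearMap := by
    rw [Submodule.span_le]
    rintro _ ⟨l, hl, rfl⟩
    exact Algebra.subset_adjoin (Or.inl (torus_binW_mem_U0 l))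
  exact this (mem_span_binW hf)

/-- Although `𝒜` is generated only by the `Y^(p^i) X^(p^i)` over `U⁰`, it contains all `Y^(m)
X^(m)`: the product of `Y^(q) X^(q)` and `Y^(m-q) X^(m-q)` is a multiple of `Y^(m) X^(m)` up to
terms with smaller exponents, and the factor `binom(m, q)²` does not vanish for a suitable power `q`
of `p`. -/
theorem eY_mul_eX_mem_Ainf (m : ℕ) : eY k m * eX k m ∈ Ainf k p := by
  induction m using Nat.strong_induction_on with
  | _ m ih =>
    rcases eq_or_ne m 0 with rfl | hm0
    · rw [eX_zero, eY_zero, one_mul]; exact one_mem _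
    · obtain ⟨i, hi, hc⟩ := exists_choose_pow_ne_zero (k := k) p hm0
      have hpos := pow_pos_of_prime p i
      by_cases hmi : m = p ^ i
      · exact Algebra.subset_adjoin (Or.inr ⟨i, by rw [hmi]⟩)
      have e := eX_mul_mon (k := k) (p ^ i) 1 (m - p ^ i) (m - p ^ i)
      rw [Finset.sum_range_succ', if_pos (Nat.zero_le _), Nat.sub_zero, Nat.add_sub_cancel' hi,
        Nat.sub_zero] at e
      have e1 : eY k (p ^ i) * eX k (p ^ i) * (eY k (m - p ^ i) * eX k (m - p ^ i))
          = eY k (p ^ i) * (eX k (p ^ i) * mon (m - p ^ i) (1 : W k) (m - p ^ i)) := by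
        rw [mon, map_one, mul_one, mul_assoc]
      have e2 : binW k (2 * (0 : ℕ) - (p ^ i : ℕ) - (m - p ^ i : ℕ)) 0 = 1 := by
        apply Subtype.ext
        funext h
        rw [binW_apply, Ring.choose_zero_right, Int.cast_one]; rfl
      rw [e2, map_one, mul_one] at e
      rw [e, mul_add, mul_smul_comm, eY_mul_mon, Nat.add_sub_cancel' hi, smul_smul] at e1
      have e3 : mon m (1 : W k) m = eY k m * eX k m := by rw [mon, map_one, mul_one]
      rw [e3] at e1
      have hc2 : ((m.choose (p ^ i) : ℕ) : k) * ((m.choose (p ^ i) : ℕ) : k) ≠ 0 := mul_ne_zero hc hc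
      rw [← inv_smul_smul₀ hc2 (eY k m * eX k m)]
      refine Subalgebra.smul_mem _ ?_ _
      rw [← sub_eq_of_eq_add' e1]
      refine sub_mem (mul_mem (Algebra.subset_adjoin (Or.inr ⟨i, rfl⟩)) (ih _ (by omega))) ?_
      rw [Finset.mul_sum]
      refine sum_mem fun t ht => ?_
      have ht' : t < p ^ i := Finset.mem_range.1 ht
      split_ifs with htm
      · rw [mul_smul_comm, eY_mul_mon, smul_smul]
        refine Subalgebra.smul_mem _ ?_ _
        have h1 : p ^ i + (m - p ^ i - (t + 1)) = m - (t + 1) := by omega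
        have h2 : p ^ i - (t + 1) + (m - p ^ i) = m - (t + 1) := by omega
        rw [h1, h2, mon_self]
        exact mul_mem (torus_mem_Ainf _) (ih _ (by omega))
      · rw [mul_zero]; exact zero_mem _

theorem Ainf_le_homog : Subalgebra.toSubmodule (Ainf k p) ≤ homog k 0 := by
  have h0 : ∀ u v : Hyper k, u ∈ homog k 0 → v ∈ homog k 0 → u * v ∈ homog k 0 := by
    intro u v hu hv
    simpa using mul_mem_homog hu hv
  have hU : ∀ u ∈ U0 k p, u ∈ homog k 0 := by
    intro u hu
    induction hu using Algebra.adjoin_induction with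
    | mem u hu =>
      obtain ⟨i, rfl⟩ := hu
      rw [← torus_binW]; exact torus_mem_homog _
    | algebraMap c => rw [Algebra.algebraMap_eq_smul_one]; exact Submodule.smul_mem _ _ one_mem_homog
    | add u v _ _ hu hv => exact add_mem hu hv
    | mul u v _ _ hu hv => exact h0 u v hu hv
  intro u hu
  change u ∈ Ainf k p at hu
  induction hu using Algebra.adjoin_induction with
  | mem u hu =>
    rcases hu with hu | ⟨i, rfl⟩
    · exact hU u hu
    · have := mul_mem_homog (eY_mem_homog (k := k) (p ^ i)) (eX_mem_homog (p ^ i))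
      rwa [neg_add_cancel] at this
  | algebraMap c => rw [Algebra.algebraMap_eq_smul_one]; exact Submodule.smul_mem _ _ one_mem_homog
  | add u v _ _ hu hv => exact add_mem hu hv
  | mul u v _ _ hu hv => exact h0 u v hu hv

theorem proj_mem_Vr {r : ℕ} {u : Hyper k} (hu : u ∈ Vr k p r) (d : ℤ) :
    proj k d u ∈ Vr k p r := by
  induction hu using Submodule.span_induction with
  | zero => simp
  | add u v _ _ hu hv => rw [map_add]; exact add_mem hu hv
  | smul c u _ hu => rw [map_smul]; exact Submodule.smul_mem _ _ hu
  | mem u hu =>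
    rw [show u = _ from hu.choose_spec.choose_spec.choose_spec.2.2.2, proj_mon]
    split_ifs
    · rw [← hu.choose_spec.choose_spec.choose_spec.2.2.2]; exact Submodule.subset_span hu
    · exact zero_mem _

theorem proj_zero_mem_Dr {r : ℕ} {u : Hyper k} (hu : u ∈ Vr k p r) :
    proj k 0 u ∈ Dr k p r := by
  induction hu using Submodule.span_induction with
  | zero => simp
  | add u v _ _ hu hv => rw [map_add]; exact add_mem hu hv
  | smul c u _ hu => rw [map_smul]; exact Submodule.smul_mem _ _ hu
  | mem u hu =>
    obtain ⟨m, f, n, hm, hn, hf, rfl⟩ := hu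
    rw [proj_mon]
    split_ifs with h
    · obtain rfl : n = m := by omega
      exact Submodule.subset_span ⟨n, f, hm, hf, rfl⟩
    · exact zero_mem _

/-- `𝒜_r` has the basis `Y^(m) binom(H, n) X^(m)` with `m, n < p ^ r`. -/
theorem mem_Ar_iff {r : ℕ} {u : Hyper k} : u ∈ Ar k p r ↔ u ∈ Dr k p r := by
  constructor
  · rintro ⟨h1, h2⟩
    rw [← proj_of_mem (Ainf_le_homog h1)]
    exact proj_zero_mem_Dr (Ur_le_Vr r h2)
  · intro hu
    refine ⟨?_, Vr_le_Ur r (Dr_le_Vr r hu)⟩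
    have : Dr k p r ≤ Subalgebra.toSubmodule (Ainf k p) := by
      rw [Dr, Submodule.span_le]
      rintro _ ⟨m, f, _, _, rfl⟩
      rw [mon_self]
      exact (Ainf k p).mul_mem (torus_mem_Ainf _) (eY_mul_eX_mem_Ainf _)
    exact this hu

theorem mul_mem_Dr {r : ℕ} {u v : Hyper k} (hu : u ∈ Dr k p r) (hv : v ∈ Dr k p r) :
    u * v ∈ Dr k p r :=
  mem_Ar_iff.1 (mul_mem (mem_Ar_iff.2 hu) (mem_Ar_iff.2 hv))

end

/-! ### The twisted Frobenius splittings -/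

section

variable {k : Type*} [Field k]

theorem eX_one_pow (m : ℕ) : eX k 1 ^ m = (m.factorial : k) • eX k m := by
  induction m with
  | zero => simp [eX_zero]
  | succ m ih =>
    rw [pow_succ, ih, smul_mul_assoc, eX_mul_eX, smul_smul, Nat.choose_succ_self_right,
      Nat.factorial_succ, Nat.cast_mul, mul_comm]

theorem eY_one_pow (m : ℕ) : eY k 1 ^ m = (m.factorial : k) • eY k m := by
  induction m with
  | zero => simp [eY_zero]
  | succ m ih =>
    rw [pow_succ, ih, smul_mul_assoc, eY_mul_eY, smul_smul, Nat.choose_succ_self_right,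
      Nat.factorial_succ, Nat.cast_mul, mul_comm]

theorem commute_eX (m n : ℕ) : Commute (eX k m) (eX k n) := by
  show _ = _
  rw [eX_mul_eX, eX_mul_eX, add_comm n m, ← Nat.choose_symm_add]

theorem commute_eY (m n : ℕ) : Commute (eY k m) (eY k n) := by
  show _ = _
  rw [eY_mul_eY, eY_mul_eY, add_comm n m, ← Nat.choose_symm_add]

theorem eX_pow_mem_homog (s : ℕ) : eX k 1 ^ s ∈ homog k s := by
  rw [eX_one_pow]; exact Submodule.smul_mem _ _ (eX_mem_homog s)

theorem eY_pow_mem_homog (s : ℕ) : eY k 1 ^ s ∈ homog k (-s) := by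
  rw [eY_one_pow]; exact Submodule.smul_mem _ _ (eY_mem_homog s)

theorem eX_one_mul_eY_one : eX k 1 * eY k 1 = eY k 1 * eX k 1 + torus k (binW k 0 1) := by
  have hb : ∀ c, binW k c 0 = 1 := by
    intro c
    apply Subtype.ext
    funext h
    rw [binW_apply, Ring.choose_zero_right, Int.cast_one]; rfl
  rw [eX_mul_eY]
  simp [Finset.sum_range_succ, hb, eX_zero, eY_zero]

theorem shiftW_binW_one (c : ℤ) : shiftW c (binW k 0 1) = binW k 0 1 + algebraMap k (W k) c := by
  apply Subtype.ext
  funext h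
  rw [shiftW_apply, binW_apply, add_zero, Ring.choose_one_right]
  show _ = (binW k 0 1 : ℤ → k) h + _
  rw [binW_apply, add_zero, Ring.choose_one_right, Int.cast_add]
  rfl

theorem torus_mul_eX_one : torus k (binW k 0 1) * eX k 1 = eX k 1 * (torus k (binW k 0 1) + 2) := by
  have h2 : algebraMap k (Hyper k) 2 = 2 := map_ofNat _ 2
  rw [torus_mul_eX, shiftW_binW_one, map_add, AlgHom.commutes]
  simp [h2]

theorem torus_mul_eY_one : torus k (binW k 0 1) * eY k 1 = eY k 1 * (torus k (binW k 0 1) - 2) := by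
  have h2 : algebraMap k (Hyper k) 2 = 2 := map_ofNat _ 2
  rw [torus_mul_eY, shiftW_binW_one, map_add, AlgHom.commutes]
  simp [h2, sub_eq_add_neg]

theorem eY_pow_mul_eX_pow_succ (m : ℕ) : eY k 1 ^ (m + 1) * eX k 1 ^ (m + 1)
    = eY k 1 ^ m * eX k 1 ^ m * (eY k 1 * eX k 1 - m * (torus k (binW k 0 1) + m + 1)) := by
  rw [mul_assoc (eY k 1 ^ m), ← yx_mul_pow eX_one_mul_eY_one torus_mul_eX_one m, pow_succ, pow_succ']
  simp only [mul_assoc]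

theorem eX_pow_mul_eY_pow_succ (m : ℕ) : eX k 1 ^ (m + 1) * eY k 1 ^ (m + 1)
    = eX k 1 ^ m * eY k 1 ^ m * (eY k 1 * eX k 1 + (m + 1) * (torus k (binW k 0 1) - m)) := by
  rw [mul_assoc (eX k 1 ^ m), ← xy_mul_pow eX_one_mul_eY_one torus_mul_eY_one m, pow_succ, pow_succ']
  simp only [mul_assoc]

theorem commute_eY_pow_mul_eX_pow {z : Hyper k} (h1 : Commute z (eY k 1 * eX k 1))
    (h2 : Commute z (torus k (binW k 0 1))) (m : ℕ) : Commute z (eY k 1 ^ m * eX k 1 ^ m) := by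
  induction m with
  | zero => simp
  | succ m ih =>
    rw [eY_pow_mul_eX_pow_succ]
    refine ih.mul_right (h1.sub_right ((Nat.cast_commute m z).symm.mul_right ?_))
    exact (h2.add_right (Nat.cast_commute m z).symm).add_right (Commute.one_right z)

variable {p : ℕ} [Fact p.Prime] [CharP k p]

theorem cast_p_eq_zero : ((p : ℕ) : k) = 0 := CharP.cast_eq_zero k p

theorem commute_eX_mul_eY_one_mul_eX_one (l : ℕ) :
    Commute (eX k (l * p)) (eY k 1 * eX k 1) := by
  rcases l with _ | l
  · rw [zero_mul, eX_zero]; exact Commute.one_left _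
  have hp := (Fact.out : p.Prime).pos
  set n := (l + 1) * p with hn
  have hn1 : 1 ≤ n := Nat.mul_pos (Nat.succ_pos l) hp
  have hb : ∀ c, binW k c 0 = 1 := by
    intro c
    apply Subtype.ext
    funext h
    rw [binW_apply, Ring.choose_zero_right, Int.cast_one]; rfl
  have e : eX k n * eY k 1 = eY k 1 * eX k n + torus k (binW k (2 * 1 - n - 1) 1) * eX k (n - 1) := by
    rw [eX_mul_eY]
    have h2 : ∀ t ∈ Finset.range (n + 1), t ∉ Finset.range 2 → (if t ≤ 1 then
        eY k (1 - t) * torus k (binW k (2 * t - n - (1 : ℕ)) t) * eX k (n - t) else 0) = 0 := by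
      intro t _ ht
      rw [if_neg]
      simp at ht; omega
    rw [← Finset.sum_subset (Finset.range_mono (by omega)) h2, Finset.sum_range_succ,
      Finset.sum_range_one]
    simp [hb, eY_zero]
  have e0 : eX k (n - 1) * eX k 1 = 0 := by
    rw [eX_mul_eX, Nat.sub_add_cancel hn1]
    have : n.choose (n - 1) = n := by
      rw [Nat.choose_symm hn1, Nat.choose_one_right]
    rw [this, hn, Nat.cast_mul, cast_p_eq_zero (p := p), mul_zero, zero_smul]
  show _ = _
  rw [← mul_assoc, e, add_mul, mul_assoc _ (eX k (n - 1)), e0, mul_zero, add_zero, mul_assoc,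
    (commute_eX n 1).eq, mul_assoc]

theorem commute_eY_mul_eY_one_mul_eX_one (l : ℕ) :
    Commute (eY k (l * p)) (eY k 1 * eX k 1) := by
  rcases l with _ | l
  · rw [zero_mul, eY_zero]; exact Commute.one_left _
  have hp := (Fact.out : p.Prime).pos
  set n := (l + 1) * p with hn
  have hn1 : 1 ≤ n := Nat.mul_pos (Nat.succ_pos l) hp
  have hb : ∀ c, binW k c 0 = 1 := by
    intro c
    apply Subtype.ext
    funext h
    rw [binW_apply, Ring.choose_zero_right, Int.cast_one]; rfl
  have e : eX k 1 * eY k n = eY k n * eX k 1 + eY k (n - 1) * torus k (binW k (2 * 1 - 1 - n) 1) := by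
    rw [eX_mul_eY, Finset.sum_range_succ, Finset.sum_range_one]
    simp [hb, eX_zero, hn1]
  have e0 : eY k 1 * eY k (n - 1) = 0 := by
    rw [eY_mul_eY, Nat.add_sub_cancel' hn1, Nat.choose_one_right, hn, Nat.cast_mul,
      cast_p_eq_zero (p := p), mul_zero, zero_smul]
  show _ = _
  rw [mul_assoc (eY k 1), e, mul_add, ← mul_assoc _ (eY k (n - 1)), e0, zero_mul, add_zero,
    ← mul_assoc, ← mul_assoc, (commute_eY n 1).eq]

theorem shiftW_eq_self {f : W k} (hf : f ∈ perW p 1) (c : ℤ) : shiftW (c * p) f = f := by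
  apply Subtype.ext
  funext h
  rw [shiftW_apply]
  have := perW_apply_add_mul hf h c
  rwa [pow_one] at this

theorem one_lt_p_pow_one : 1 < p ^ 1 := by rw [pow_one]; exact (Fact.out : p.Prime).one_lt

theorem factorial_ne_zero_of_lt {m : ℕ} (hm : m < p) : ((m.factorial : ℕ) : k) ≠ 0 := by
  intro h
  rw [CharP.cast_eq_zero_iff k p, (Fact.out : p.Prime).dvd_factorial] at h
  omega

/-- The elements of `𝒜₁` commute with all `X^(lp)`. -/
theorem commute_eX_of_mem_Dr {u : Hyper k} (hu : u ∈ Dr k p 1) (l : ℕ) :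
    Commute (eX k (l * p)) u := by
  have ht : ∀ f ∈ perW p 1, Commute (eX k (l * p)) (torus k f) := by
    intro f hf
    show _ = _
    rw [eX_mul_torus]
    have := shiftW_eq_self (k := k) hf (-2 * l)
    push_cast
    rw [← mul_assoc, this]
  induction hu using Submodule.span_induction with
  | zero => exact Commute.zero_right _
  | add u v _ _ hu hv => exact hu.add_right hv
  | smul c u _ hu => exact hu.smul_right c
  | mem u hu =>
    obtain ⟨m, f, hm, hf, rfl⟩ := hu
    rw [pow_one] at hm
    have hm0 : (m.factorial : k) ≠ 0 := factorial_ne_zero_of_lt hm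
    rw [mon_self]
    refine (ht _ (shiftW_mem_perW hf _)).mul_right ?_
    have := commute_eY_pow_mul_eX_pow (commute_eX_mul_eY_one_mul_eX_one l)
      (ht _ (binW_mem_perW 0 one_lt_p_pow_one)) m
    rw [eY_one_pow, eX_one_pow, smul_mul_smul_comm] at this
    have h2 := this.smul_right ((m.factorial : k) * m.factorial)⁻¹
    rwa [inv_smul_smul₀ (mul_ne_zero hm0 hm0)] at h2

/-- The elements of `𝒜₁` commute with all `Y^(lp)`. -/
theorem commute_eY_of_mem_Dr {u : Hyper k} (hu : u ∈ Dr k p 1) (l : ℕ) :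
    Commute (eY k (l * p)) u := by
  have ht : ∀ f ∈ perW p 1, Commute (eY k (l * p)) (torus k f) := by
    intro f hf
    show _ = _
    rw [eY_mul_torus]
    have := shiftW_eq_self (k := k) hf (2 * l)
    push_cast
    rw [← mul_assoc, this]
  induction hu using Submodule.span_induction with
  | zero => exact Commute.zero_right _
  | add u v _ _ hu hv => exact hu.add_right hv
  | smul c u _ hu => exact hu.smul_right c
  | mem u hu =>
    obtain ⟨m, f, hm, hf, rfl⟩ := hu
    rw [pow_one] at hm
    have hm0 : (m.factorial : k) ≠ 0 := factorial_ne_zero_of_lt hm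
    rw [mon_self]
    refine (ht _ (shiftW_mem_perW hf _)).mul_right ?_
    have := commute_eY_pow_mul_eX_pow (commute_eY_mul_eY_one_mul_eX_one l)
      (ht _ (binW_mem_perW 0 one_lt_p_pow_one)) m
    rw [eY_one_pow, eX_one_pow, smul_mul_smul_comm] at this
    have h2 := this.smul_right ((m.factorial : k) * m.factorial)⁻¹
    rwa [inv_smul_smul₀ (mul_ne_zero hm0 hm0)] at h2

theorem mem_Dr_of_mem_Ur {r : ℕ} {u : Hyper k} (hu : u ∈ Ur k p r) (h0 : u ∈ homog k 0) :
    u ∈ Dr k p r := by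
  rw [← proj_of_mem h0]
  exact proj_zero_mem_Dr (Ur_le_Vr r hu)

theorem eX_one_mem_Ur : eX k 1 ∈ Ur k p 1 := eX_mem_Ur one_lt_p_pow_one

theorem eY_one_mem_Ur : eY k 1 ∈ Ur k p 1 := eY_mem_Ur one_lt_p_pow_one

theorem Dr_le_Ur {r : ℕ} {u : Hyper k} (hu : u ∈ Dr k p r) : u ∈ Ur k p r :=
  Vr_le_Ur r (Dr_le_Vr r hu)

theorem eY_pow_mul_mul_eX_pow_mem {K : Hyper k} (hK : K ∈ Dr k p 1) (s : ℕ) :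
    eY k 1 ^ s * K * eX k 1 ^ s ∈ Dr k p 1 := by
  refine mem_Dr_of_mem_Ur (mul_mem (mul_mem (pow_mem eY_one_mem_Ur s) (Dr_le_Ur hK))
    (pow_mem eX_one_mem_Ur s)) ?_
  have := mul_mem_homog (mul_mem_homog (eY_pow_mem_homog (k := k) s) (Dr_le_homog 1 hK))
    (eX_pow_mem_homog s)
  simpa using this

theorem eX_pow_mul_mul_eY_pow_mem {K : Hyper k} (hK : K ∈ Dr k p 1) (s : ℕ) :
    eX k 1 ^ s * K * eY k 1 ^ s ∈ Dr k p 1 := by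
  refine mem_Dr_of_mem_Ur (mul_mem (mul_mem (pow_mem eX_one_mem_Ur s) (Dr_le_Ur hK))
    (pow_mem eY_one_mem_Ur s)) ?_
  have := mul_mem_homog (mul_mem_homog (eX_pow_mem_homog (k := k) s) (Dr_le_homog 1 hK))
    (eY_pow_mem_homog s)
  simpa using this

theorem one_mem_Dr (r : ℕ) : (1 : Hyper k) ∈ Dr k p r :=
  mem_Dr_of_mem_Ur (one_mem _) one_mem_homog

theorem torus_mem_Dr {r : ℕ} {f : W k} (hf : f ∈ perW p r) : torus k f ∈ Dr k p r :=
  mem_Dr_of_mem_Ur (torus_mem_Ur hf) (torus_mem_homog f)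

variable (k p) in
theorem exists_frobS (c : ℤ) : ∃ F : Hyper k →ₗ[k] Hyper k, ∀ m n (f : W k),
    F (mon m f n) = mon (m * p) (shiftW c (floorW k p f)) (n * p) := by
  obtain ⟨F, hF⟩ := exists_linearMap (V := Hyper k) (fun m n =>
    monL (k := k) (m * p) (n * p) ∘ₗ ((shiftW c).comp (floorW k p)).toLinearMap)
  exact ⟨F, fun m n f => hF m n f⟩

variable (k p) in
/-- The twist `Y^(m) f(H) X^(n) ↦ Y^(mp) f(⌊(H + c) / p⌋) X^(np)` of `Fr'`. -/
noncomputable def frobS (c : ℤ) : Hyper k →ₗ[k] Hyper k := (exists_frobS k p c).choose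

theorem frobS_mon (c : ℤ) (m n : ℕ) (f : W k) :
    frobS k p c (mon m f n) = mon (m * p) (shiftW c (floorW k p f)) (n * p) :=
  (exists_frobS k p c).choose_spec m n f

theorem frobS_zero : frobS k p 0 = frob' k p := by
  refine LinearMap.ext fun u => ?_
  induction u using hyper_induction with
  | zero => simp
  | mon m f n => rw [frobS_mon, frob'_mon, shiftW_zero]
  | add u v hu hv => rw [map_add, map_add, hu, hv]

theorem frobS_mem_homog (c : ℤ) {u : Hyper k} (hu : u ∈ homog k 0) : frobS k p c u ∈ homog k 0 := by
  induction hu using Submodule.span_induction with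
  | zero => simp
  | add u v _ _ hu hv => rw [map_add]; exact add_mem hu hv
  | smul c u _ hu => rw [map_smul]; exact Submodule.smul_mem _ _ hu
  | mem u hu =>
    obtain ⟨m, f, n, h, rfl⟩ := hu
    obtain rfl : n = m := by omega
    rw [frobS_mon]
    exact mon_mem_homog (by simp) _

theorem frobS_mem_Dr (c : ℤ) {r : ℕ} {u : Hyper k} (hu : u ∈ Dr k p r) :
    frobS k p c u ∈ Dr k p (r + 1) := by
  induction hu using Submodule.span_induction with
  | zero => simp
  | add u v _ _ hu hv => rw [map_add]; exact add_mem hu hv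
  | smul c u _ hu => rw [map_smul]; exact Submodule.smul_mem _ _ hu
  | mem u hu =>
    obtain ⟨m, f, hm, hf, rfl⟩ := hu
    rw [frobS_mon]
    refine Submodule.subset_span ⟨_, _, ?_, shiftW_mem_perW (floorW_mem_perW hf) _, rfl⟩
    rw [pow_succ]
    exact Nat.mul_lt_mul_of_pos_right hm (Fact.out : p.Prime).pos

theorem frobS_one (c : ℤ) : frobS k p c 1 = 1 := by
  have h : (1 : Hyper k) = mon 0 1 0 := by rw [mon, eX_zero, eY_zero, map_one, mul_one, mul_one]
  rw [h, frobS_mon, zero_mul, map_one, map_one]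

theorem floorW_shiftW (c : ℤ) (f : W k) :
    floorW k p (shiftW c f) = shiftW (c * p) (floorW k p f) := by
  have hp : (p : ℤ) ≠ 0 := by exact_mod_cast (Fact.out : p.Prime).ne_zero
  apply Subtype.ext
  funext h
  rw [floorW_apply, shiftW_apply, shiftW_apply, floorW_apply, Int.add_mul_ediv_right _ _ hp]

theorem frobS_mul_torus (c : ℤ) (f : W k) (u : Hyper k) :
    frobS k p c (u * torus k f) = frobS k p c u * torus k (shiftW c (floorW k p f)) := by
  induction u using hyper_induction with
  | zero => simp
  | add u v hu hv => rw [add_mul, map_add, map_add, hu, hv, add_mul]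
  | mon m g n =>
    rw [mon_mul_torus, frobS_mon, frobS_mon, mon_mul_torus, map_mul, map_mul, floorW_shiftW,
      shiftW_shiftW, shiftW_shiftW]
    congr 3
    push_cast; ring_nf

/-- Conjugating `Fr'` by powers of `X` and `Y` twists it by a translation. -/
theorem eY_pow_mul_frob'_mul_eX_pow {K : Hyper k} (hK : K ∈ Dr k p 1) (s : ℕ) {z : Hyper k}
    (hz : z ∈ homog k 0) : eY k 1 ^ s * K * frob' k p z * eX k 1 ^ s
      = frobS k p (2 * s) z * (eY k 1 ^ s * K * eX k 1 ^ s) := by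
  induction hz using Submodule.span_induction with
  | zero => simp
  | add u v _ _ hu hv => rw [map_add, map_add, mul_add, add_mul, add_mul, hu, hv]
  | smul c u _ hu => rw [map_smul, map_smul, mul_smul_comm, smul_mul_assoc, smul_mul_assoc, hu]
  | mem u hu =>
    obtain ⟨l, f, n, h, rfl⟩ := hu
    obtain rfl : n = l := by omega
    rw [frob'_mon, frobS_mon]
    set g := floorW k p f
    have h1 : Commute (eY k 1 ^ s) (eY k (n * p)) := (commute_eY 1 (n * p)).pow_left s
    have h2 : Commute (eX k (n * p)) (eX k 1 ^ s) := (commute_eX (n * p) 1).pow_right s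
    have h3 := (commute_eY_of_mem_Dr hK n).symm
    have h4 := commute_eX_of_mem_Dr (eY_pow_mul_mul_eX_pow_mem hK s) n
    have h5 : K * torus k g = torus k g * K :=
      mul_comm_of_mem_homog (Dr_le_homog 1 hK) (torus_mem_homog g)
    have h6 : eY k 1 ^ s * torus k g = torus k (shiftW (2 * s) g) * eY k 1 ^ s := by
      rw [eY_one_pow, smul_mul_assoc, eY_mul_torus, mul_smul_comm]
    calc eY k 1 ^ s * K * mon (n * p) g (n * p) * eX k 1 ^ s
        = eY k 1 ^ s * (K * eY k (n * p)) * torus k g * (eX k (n * p) * eX k 1 ^ s) := by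
          rw [mon]; simp only [mul_assoc]
      _ = (eY k 1 ^ s * eY k (n * p)) * (K * torus k g) * eX k 1 ^ s * eX k (n * p) := by
          rw [h3.eq, h2.eq]; simp only [mul_assoc]
      _ = eY k (n * p) * (eY k 1 ^ s * torus k g) * K * eX k 1 ^ s * eX k (n * p) := by
          rw [h1.eq, h5]; simp only [mul_assoc]
      _ = eY k (n * p) * torus k (shiftW (2 * s) g) * ((eY k 1 ^ s * K * eX k 1 ^ s)
            * eX k (n * p)) := by
          rw [h6]; simp only [mul_assoc]
      _ = _ := by
          rw [← h4.eq, mon]; simp only [mul_assoc]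

/-! ### Multiplicativity of `Fr'` on suitable vectors -/

theorem frob'_eY_mul (l : ℕ) (z : Hyper k) :
    frob' k p (eY k l * z) = eY k (l * p) * frob' k p z := by
  induction z using hyper_induction with
  | zero => simp
  | add u v hu hv => rw [mul_add, map_add, map_add, hu, hv, mul_add]
  | mon m f n =>
    rw [eY_mul_mon, map_smul, frob'_mon, frob'_mon, eY_mul_mon, ← add_mul, cast_choose_mul_mul p]

theorem frob'_torus_mul (f : W k) (z : Hyper k) :
    frob' k p (torus k f * z) = torus k (floorW k p f) * frob' k p z := by
  induction z using hyper_induction with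
  | zero => simp
  | add u v hu hv => rw [mul_add, map_add, map_add, hu, hv, mul_add]
  | mon m g n =>
    rw [torus_mul_mon, frob'_mon, frob'_mon, torus_mul_mon, map_mul, floorW_shiftW]
    congr 4
    push_cast; ring_nf

theorem floorW_binW' (c : ℤ) (n : ℕ) :
    floorW k p (binW k c n) = binW k (c * p) (n * p) := by
  have : binW k c n = shiftW c (binW k 0 n) := by rw [shiftW_binW, add_zero]
  rw [this, floorW_shiftW, floorW_binW, shiftW_binW, add_zero]

theorem eX_add_of_lt {l s : ℕ} (hs : s < p) : eX k (l * p + s) = eX k (l * p) * eX k s := by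
  have hp := (Fact.out : p.Prime).pos
  rw [eX_mul_eX, cast_choose_eq p]
  have h1 : (l * p + s) % p = s := by rw [Nat.mul_add_mod', Nat.mod_eq_of_lt hs]
  have h2 : (l * p + s) / p = l := by
    rw [mul_comm, Nat.mul_add_div hp, Nat.div_eq_of_lt hs, add_zero]
  rw [h1, h2, Nat.mul_mod_left, Nat.mul_div_cancel _ hp]
  simp

theorem eY_add_of_lt {l s : ℕ} (hs : s < p) : eY k (l * p + s) = eY k (l * p) * eY k s := by
  have hp := (Fact.out : p.Prime).pos
  rw [eY_mul_eY, cast_choose_eq p]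
  have h1 : (l * p + s) % p = s := by rw [Nat.mul_add_mod', Nat.mod_eq_of_lt hs]
  have h2 : (l * p + s) / p = l := by
    rw [mul_comm, Nat.mul_add_div hp, Nat.div_eq_of_lt hs, add_zero]
  rw [h1, h2, Nat.mul_mod_left, Nat.mul_div_cancel _ hp]
  simp

/-- If `x` is congruent to `a` modulo `p`, with `a` smaller than the last digit of `t` in base `p`,
then `binom(x, t) = 0` in characteristic `p`. -/
theorem cast_choose_eq_zero_of_mod {x : ℤ} {a t : ℕ} (hx : (p : ℤ) ∣ x - a)
    (ht : a < t % p) : ((Ring.choose x t : ℤ) : k) = 0 := by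
  have hp := (Fact.out : p.Prime).pos
  set t0 := t % p with ht0
  have ht0p : t0 < p := Nat.mod_lt _ hp
  have h1 := congrArg (Int.cast : ℤ → k) (Ring.choose_smul_choose x (Nat.mod_le t p))
  rw [nsmul_eq_mul, Int.cast_mul, Int.cast_mul, Int.cast_natCast, ← ht0] at h1
  have h2 : ((t.choose t0 : ℕ) : k) = 1 := by
    rw [cast_choose_eq p, Nat.mod_eq_of_lt ht0p, ← ht0, Nat.div_eq_of_lt ht0p]
    simp
  obtain ⟨c, hc⟩ := hx
  have h3 : ((Ring.choose x t0 : ℤ) : k) = 0 := by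
    have := cast_choose_add_mul_pow (k := k) p (N := 1) (n := t0) (by rwa [pow_one]) a c
    rw [show (a : ℤ) + c * (p : ℤ) ^ 1 = x by rw [pow_one]; linear_combination -hc,
      Ring.choose_natCast, Nat.choose_eq_zero_of_lt ht] at this
    rw [this]; simp
  rw [h2, h3, one_mul, zero_mul] at h1
  exact h1

/-- The commutation of `X^(lp)` past `Fr'(z)`, applied to a vector `Q` of weight `a` modulo `p`:
the terms of the commutation formula that are not in the image of `Fr'` annihilate `Q`. -/
theorem frob'_eX_mul {Q : Hyper k} {a : ℕ} (hQ : torus k (ind k p 1 a) * Q = Q)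
    (hX : ∀ t, 1 ≤ t → t ≤ a → eX k (p - t) * Q = 0) (l : ℕ) (z : Hyper k) :
    frob' k p (eX k l * z) * Q = eX k (l * p) * frob' k p z * Q := by
  have hp := (Fact.out : p.Prime).pos
  induction z using hyper_induction with
  | zero => simp
  | add u v hu hv => rw [mul_add, map_add, map_add, add_mul, hu, hv, mul_add, add_mul]
  | mon m f n =>
    rw [eX_mul_mon, frob'_mon, eX_mul_mon, map_sum, Finset.sum_mul, Finset.sum_mul]
    refine Finset.sum_of_injOn (fun t => t * p) (fun a _ b _ h => Nat.eq_of_mul_eq_mul_right hp h)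
      ?_ ?_ ?_
    · intro t ht
      have : t ≤ l := Nat.lt_succ_iff.1 (by simpa using ht)
      have := Nat.mul_le_mul_right p this
      simpa using Nat.lt_succ_of_le this
    · intro t ht hnt
      have htl : t ≤ l * p := Nat.lt_succ_iff.1 (Finset.mem_range.1 ht)
      split_ifs with htm
      swap
      · exact zero_mul _
      have ht0 : t % p ≠ 0 := by
        intro h0
        obtain ⟨c, rfl⟩ := Nat.dvd_of_mod_eq_zero h0
        refine hnt ⟨c, ?_, mul_comm _ _⟩
        have : c ≤ l := Nat.le_of_mul_le_mul_left (by rwa [mul_comm l p] at htl) hp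
        simpa using Nat.lt_succ_of_le this
      have ht0p : t % p < p := Nat.mod_lt _ hp
      have htd := Nat.div_add_mod t p
      rw [smul_mul_assoc]
      refine smul_eq_zero_of_right _ ?_
      rcases lt_or_ge a (t % p) with h | h
      · -- the binomial function vanishes on the weights of `Q`
        rw [← hQ, ← mul_assoc, mon_mul_torus]
        have : binW k (2 * t - (l * p : ℕ) - (m * p : ℕ)) t
            * shiftW (-2 * (l * p - t : ℕ)) (floorW k p f)
            * shiftW (-2 * (l * p - t + n * p : ℕ)) (ind k p 1 a) = 0 := by
          apply Subtype.ext
          funext x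
          show (binW k _ t : ℤ → k) x * _ * (shiftW _ (ind k p 1 a) : ℤ → k) x = 0
          rw [shiftW_apply (-2 * (l * p - t + n * p : ℕ) : ℤ), ind_apply]
          split_ifs with hd
          · rw [binW_apply, cast_choose_eq_zero_of_mod ?_ h, zero_mul, zero_mul]
            rw [pow_one] at hd
            obtain ⟨c, hc⟩ := hd
            push_cast [htl] at hc ⊢
            exact ⟨c + l - m + 2 * n, by linear_combination hc⟩
          · rw [mul_zero]
        rw [this, mon_zero, zero_mul]
      · -- a factor `X^(p - t)` kills `Q`
        obtain ⟨q, hq⟩ : ∃ q, l * p - t + n * p = q * p + (p - t % p) := by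
          have h1 : t / p < l := by
            rw [Nat.div_lt_iff_lt_mul hp]
            refine lt_of_le_of_ne htl ?_
            rintro rfl
            simp at ht0
          refine ⟨l - t / p - 1 + n, ?_⟩
          obtain ⟨d, hd⟩ := Nat.exists_eq_add_of_lt h1
          have h2 : l - t / p - 1 = d := by omega
          rw [h2, hd, add_mul, add_mul, add_mul, one_mul]
          have h3 : t = t / p * p + t % p := by rw [mul_comm]; exact htd.symm
          generalize hA : t / p * p = A at *
          generalize hB : d * p = B at *
          omega
        rw [hq, mon, eX_add_of_lt (by omega), mul_assoc, mul_assoc (eX k (q * p)),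
          hX _ (by omega) h, mul_zero, mul_zero]
    · intro t ht
      have htl : t ≤ l := Nat.lt_succ_iff.1 (Finset.mem_range.1 ht)
      have hiff : t * p ≤ m * p ↔ t ≤ m := Nat.mul_le_mul_right_iff hp
      by_cases htm : t ≤ m
      · rw [if_pos htm, if_pos (hiff.2 htm), map_smul, frob'_mon, map_mul, floorW_binW',
          floorW_shiftW, ← Nat.sub_mul, ← Nat.sub_mul, ← add_mul, cast_choose_mul_mul p]
        congr 4
        · push_cast; ring_nf
        · congr 2
          push_cast; ring_nf
      · rw [if_neg htm, if_neg (fun h => htm (hiff.1 h)), map_zero]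

/-- `Fr'` is multiplicative when applied to suitable vectors `Q`. -/
theorem frob'_mul {Q : Hyper k} {a : ℕ} (hQ : torus k (ind k p 1 a) * Q = Q)
    (hX : ∀ t, 1 ≤ t → t ≤ a → eX k (p - t) * Q = 0) (u z : Hyper k) :
    frob' k p (u * z) * Q = frob' k p u * frob' k p z * Q := by
  induction u using hyper_induction with
  | zero => simp
  | add u v hu hv => rw [add_mul, map_add, map_add, add_mul, hu, hv, add_mul, add_mul]
  | mon m f n =>
    have e : mon m f n * z = eY k m * (torus k f * (eX k n * z)) := by simp only [mon, mul_assoc]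
    rw [e, frob'_eY_mul, frob'_torus_mul, frob'_mon, mon, mul_assoc, mul_assoc,
      frob'_eX_mul hQ hX]
    simp only [mul_assoc]

/-- The twisted Frobenius splitting is multiplicative on the block of a suitable idempotent `E`. -/
theorem frobS_mul {E G : Hyper k} {s a : ℕ} (hG : G ∈ Dr k p 1)
    (hEG : E = eY k 1 ^ s * G * eX k 1 ^ s) (hE : E * E = E)
    (hQ : torus k (ind k p 1 a) * (eX k 1 ^ s * E) = eX k 1 ^ s * E)
    (hX : ∀ t, 1 ≤ t → t ≤ a → eX k (p - t) * (eX k 1 ^ s * E) = 0) {z z' : Hyper k}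
    (hz : z ∈ homog k 0) (hz' : z' ∈ homog k 0) :
    frobS k p (2 * s) z * frobS k p (2 * s) z' * E = frobS k p (2 * s) (z * z') * E := by
  have hED : E ∈ Dr k p 1 := hEG ▸ eY_pow_mul_mul_eX_pow_mem hG s
  have hzz : z * z' ∈ homog k 0 := by simpa using mul_mem_homog hz hz'
  have hF : ∀ {z : Hyper k}, z ∈ homog k 0 →
      frobS k p (2 * s) z * E = eY k 1 ^ s * G * frob' k p z * eX k 1 ^ s := by
    intro z hz
    rw [eY_pow_mul_frob'_mul_eX_pow hG s hz, ← hEG]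
  have hK : eX k 1 ^ s * eY k 1 ^ s * G ∈ Dr k p 1 := by
    have h1 := eX_pow_mul_mul_eY_pow_mem (one_mem_Dr (k := k) (p := p) 1) s
    rw [mul_one] at h1
    exact mul_mem_Dr h1 hG
  set K := eX k 1 ^ s * eY k 1 ^ s * G with hKdef
  have hcomm : frob' k p z * K = K * frob' k p z := by
    rw [← frobS_zero]
    exact mul_comm_of_mem_homog (frobS_mem_homog 0 hz) (Dr_le_homog 1 hK)
  have hcE : frobS k p (2 * s) z' * E = E * frobS k p (2 * s) z' :=
    mul_comm_of_mem_homog (frobS_mem_homog _ hz') (Dr_le_homog 1 hED)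
  calc frobS k p (2 * s) z * frobS k p (2 * s) z' * E
      = frobS k p (2 * s) z * (frobS k p (2 * s) z' * E) * E * E := by
        rw [mul_assoc _ E E, hE, mul_assoc, mul_assoc, mul_assoc, hE]
    _ = (frobS k p (2 * s) z * E) * (frobS k p (2 * s) z' * E) * E := by
        conv_lhs => rw [hcE]
        simp only [mul_assoc]
    _ = eY k 1 ^ s * G * (frob' k p z * K) * (frob' k p z' * (eX k 1 ^ s * E)) := by
        rw [hF hz, hF hz', hKdef]; simp only [mul_assoc]
    _ = eY k 1 ^ s * (G * K) * (frob' k p z * frob' k p z' * (eX k 1 ^ s * E)) := by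
        rw [hcomm]; simp only [mul_assoc]
    _ = eY k 1 ^ s * (G * K) * frob' k p (z * z') * eX k 1 ^ s * E := by
        rw [← frob'_mul hQ hX]; simp only [mul_assoc]
    _ = frobS k p (2 * s) (z * z') * ((eY k 1 ^ s * G * eX k 1 ^ s)
          * (eY k 1 ^ s * G * eX k 1 ^ s)) * E := by
        rw [eY_pow_mul_frob'_mul_eX_pow (mul_mem_Dr hG hK) s hzz, hKdef]; simp only [mul_assoc]
    _ = _ := by rw [← hEG, hE, mul_assoc, hE]

end

/-! ### The twisted Frobenius splitting and a tensor decomposition of `𝒜_{r+1}` -/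

section

variable {k : Type*} [Field k]

variable (k) in
theorem exists_diag : ∃ L : Hyper k →ₗ[k] (ℕ →₀ W k), ∀ m n (f : W k),
    L (mon m f n) = if m = n then Finsupp.single m f else 0 := by
  obtain ⟨L, hL⟩ := exists_linearMap (k := k) (V := ℕ →₀ W k)
    (fun m n => if m = n then Finsupp.lsingle m else 0)
  refine ⟨L, fun m n f => ?_⟩
  rw [hL]
  split_ifs <;> simp

variable (k) in
/-- The coefficient of `Y^(n) · X^(n)`, as an element of the torus part `W k`. -/
noncomputable def diagCoeff (n : ℕ) : Hyper k →ₗ[k] W k :=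
  Finsupp.lapply n ∘ₗ (exists_diag k).choose

theorem diagCoeff_mon (l m n : ℕ) (f : W k) :
    diagCoeff k l (mon m f n) = if m = l ∧ n = l then f else 0 := by
  rw [diagCoeff, LinearMap.comp_apply, (exists_diag k).choose_spec]
  by_cases h : m = n
  · subst h
    by_cases h' : m = l <;> simp [h']
  · have : ¬ (m = l ∧ n = l) := by omega
    simp [h, this]

theorem homog_zero_induction {motive : ∀ u : Hyper k, u ∈ homog k 0 → Prop}
    (zero : motive 0 (zero_mem _))
    (mon : ∀ m (f : W k), motive (mon m f m) (mon_mem_homog (sub_self _) f))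
    (add : ∀ u v hu hv, motive u hu → motive v hv → motive (u + v) (add_mem hu hv))
    (smul : ∀ (c : k) u hu, motive u hu → motive (c • u) (Submodule.smul_mem _ c hu))
    {u : Hyper k} (hu : u ∈ homog k 0) : motive u hu := by
  unfold homog at hu
  induction hu using Submodule.span_induction with
  | mem x hx =>
    obtain ⟨m, f, n, h, rfl⟩ := hx
    obtain rfl : n = m := by omega
    exact mon _ _
  | zero => exact zero
  | add u v hu hv h1 h2 => exact add u v hu hv h1 h2
  | smul c u hu h => exact smul c u hu h

theorem eq_zero_of_diagCoeff {u : Hyper k} (hu : u ∈ homog k 0)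
    (h : ∀ n, diagCoeff k n u = 0) : u = 0 := by
  have key : (Finsupp.lsum k fun n => monL n n) ((exists_diag k).choose u) = u := by
    clear h
    induction hu using homog_zero_induction with
    | zero => simp
    | mon m f =>
      rw [(exists_diag k).choose_spec, if_pos rfl, Finsupp.lsum_single, monL_apply]
    | add u v _ _ h1 h2 => rw [map_add, map_add]; rw [h1, h2]
    | smul c u _ h => rw [map_smul, map_smul, h]
  have h0 : (exists_diag k).choose u = 0 := Finsupp.ext fun n => h n
  rw [← key, h0, map_zero]

variable {p : ℕ} [Fact p.Prime] [CharP k p]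

theorem mon_mem_Dr {r m : ℕ} (hm : m < p ^ r) {f : W k} (hf : f ∈ perW p r) :
    mon m f m ∈ Dr k p r :=
  Submodule.subset_span ⟨m, f, hm, hf, rfl⟩

theorem frobS_mon_mul_mon (c : ℤ) (l : ℕ) {m : ℕ} (hm : m < p) (f : W k) {g : W k}
    (hg : g ∈ perW p 1) : frobS k p c (mon l f l) * mon m g m
      = mon (l * p + m) (shiftW (c - 2 * m) (floorW k p f) * g) (l * p + m) := by
  have hm1 : m < p ^ 1 := by simpa using hm
  have hc := commute_eX_of_mem_Dr (mon_mem_Dr hm1 hg) l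
  rw [frobS_mon]
  generalize hF : shiftW c (floorW k p f) = F
  have hF' : shiftW (c - 2 * m) (floorW k p f) = shiftW (-2 * m) F := by
    rw [← hF, shiftW_shiftW, neg_mul, neg_add_eq_sub]
  have e : mon (l * p) F (l * p) = eY k (l * p) * torus k F * eX k (l * p) := rfl
  rw [e, mul_assoc, hc.eq, hF']
  have e2 : mon m g m = eY k m * torus k g * eX k m := rfl
  have e3 : ∀ G : W k, mon (l * p + m) G (l * p + m)
      = eY k (l * p + m) * torus k G * eX k (l * p + m) := fun _ => rfl
  rw [e2, e3, eX_add_of_lt hm, eY_add_of_lt hm, map_mul, (commute_eX _ _).eq]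
  calc eY k (l * p) * torus k F * (eY k m * torus k g * eX k m * eX k (l * p))
      = eY k (l * p) * (torus k F * eY k m) * torus k g * eX k m * eX k (l * p) := by
        simp only [mul_assoc]
    _ = _ := by rw [torus_mul_eY]; simp only [mul_assoc]

/-- A residue class modulo `p ^ (r + 1)` is cut out by its residue modulo `p` and the residue modulo
`p ^ r` of the floor of the quotient by `p`. -/
theorem ind_succ (r : ℕ) (b c : ℤ) : ind k p (r + 1) b
    = ind k p 1 b * shiftW c (floorW k p (ind k p r ((b + c) / p))) := by
  have hp : (p : ℤ) ≠ 0 := by exact_mod_cast (Fact.out : p.Prime).ne_zero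
  apply Subtype.ext
  funext h
  rw [MulMemClass.coe_mul, Pi.mul_apply, shiftW_apply, floorW_apply, ind_apply, ind_apply,
    ind_apply, pow_one]
  by_cases hd : (p : ℤ) ∣ h - b
  · have hd' := hd
    obtain ⟨t, ht⟩ := hd
    have e1 : (h + c) / p - (b + c) / p = t := by
      have : h + c = b + c + p * t := by linarith
      rw [this, Int.add_mul_ediv_left _ _ hp]; ring
    have e2 : (p : ℤ) ^ (r + 1) ∣ h - b ↔ (p : ℤ) ^ r ∣ t := by
      rw [ht, pow_succ', mul_dvd_mul_iff_left hp]
    simp only [e1, e2, hd', if_true, one_mul]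
  · have : ¬ (p : ℤ) ^ (r + 1) ∣ h - b := fun h' => hd ((dvd_pow_self _ (by omega)).trans h')
    rw [if_neg hd, if_neg this, zero_mul]

/-- `𝒜_{r+1}` is spanned by the products of the elements of the twisted image of `𝒜_r` with those
of `𝒜_1`. -/
theorem mem_span_frobS_mul (c : ℤ) {r : ℕ} {u : Hyper k} (hu : u ∈ Dr k p (r + 1)) :
    u ∈ Submodule.span k {x | ∃ z ∈ Dr k p r, ∃ b ∈ Dr k p 1, x = frobS k p c z * b} := by
  have hp : 0 < p := (Fact.out : p.Prime).pos
  unfold Dr at hu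
  induction hu using Submodule.span_induction with
  | zero => exact zero_mem _
  | add u v _ _ h1 h2 => exact add_mem h1 h2
  | smul c u _ h => exact Submodule.smul_mem _ _ h
  | mem x hx =>
    obtain ⟨m, f, hm, hf, rfl⟩ := hx
    rw [eq_sum_ind hf, ← monL_apply, map_sum]
    refine Submodule.sum_mem _ fun b _ => ?_
    rw [map_smul, monL_apply]
    refine Submodule.smul_mem _ _ (Submodule.subset_span ?_)
    have hlt : m / p < p ^ r := by
      rw [Nat.div_lt_iff_lt_mul hp, ← pow_succ]; exact hm
    refine ⟨mon (m / p) (ind k p r (((b : ℤ) + (c - 2 * (m % p : ℕ))) / p)) (m / p),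
      mon_mem_Dr hlt (ind_mem_perW _ _), mon (m % p) (ind k p 1 b) (m % p),
      mon_mem_Dr (by simpa using Nat.mod_lt m hp) (ind_mem_perW _ _), ?_⟩
    rw [frobS_mon_mul_mon c _ (Nat.mod_lt m hp) _ (ind_mem_perW _ _),
      ind_succ r b (c - 2 * (m % p : ℕ)), mul_comm (ind k p 1 b), mul_comm (m / p) p,
      Nat.div_add_mod]

theorem diagCoeff_mem_perW {r : ℕ} {u : Hyper k} (hu : u ∈ Dr k p r) (n : ℕ) :
    diagCoeff k n u ∈ perW p r := by
  unfold Dr at hu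
  induction hu using Submodule.span_induction with
  | zero => rw [map_zero]; exact zero_mem _
  | add u v _ _ h1 h2 => rw [map_add]; exact add_mem h1 h2
  | smul c u _ h => rw [map_smul]; exact Subalgebra.smul_mem _ h _
  | mem x hx =>
    obtain ⟨m, f, hm, hf, rfl⟩ := hx
    rw [diagCoeff_mon]
    split_ifs
    · exact hf
    · exact zero_mem _

theorem diagCoeff_of_le {r : ℕ} {u : Hyper k} (hu : u ∈ Dr k p r) {n : ℕ} (hn : p ^ r ≤ n) :
    diagCoeff k n u = 0 := by
  unfold Dr at hu
  induction hu using Submodule.span_induction with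
  | zero => rw [map_zero]
  | add u v _ _ h1 h2 => rw [map_add, h1, h2, add_zero]
  | smul c u _ h => rw [map_smul, h, smul_zero]
  | mem x hx =>
    obtain ⟨m, f, hm, hf, rfl⟩ := hx
    rw [diagCoeff_mon, if_neg (by omega)]

/-- The coefficients of a product of an element in the twisted image of `Fr'` and an element of
`𝒜_1` are products of the coefficients of the factors, by division of the exponent by `p` with
remainder. -/
theorem diagCoeff_frobS_mul (c : ℤ) (l : ℕ) {m : ℕ} (hm : m < p) {z : Hyper k}
    (hz : z ∈ homog k 0) {u : Hyper k} (hu : u ∈ Dr k p 1) :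
    diagCoeff k (l * p + m) (frobS k p c z * u)
      = shiftW (c - 2 * m) (floorW k p (diagCoeff k l z)) * diagCoeff k m u := by
  have hp : 0 < p := (Fact.out : p.Prime).pos
  induction hz using homog_zero_induction with
  | zero => simp
  | add z z' _ _ h1 h2 => simp only [map_add, add_mul, h1, h2]
  | smul d z _ h => simp only [map_smul, smul_mul_assoc, h]
  | mon l' f =>
    unfold Dr at hu
    induction hu using Submodule.span_induction with
    | zero => simp
    | add u v _ _ h1 h2 => simp only [map_add, mul_add, h1, h2]
    | smul d u _ h => simp only [map_smul, mul_smul_comm, h]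
    | mem x hx =>
      obtain ⟨m', g, hm', hg, rfl⟩ := hx
      rw [pow_one] at hm'
      rw [frobS_mon_mul_mon c l' hm' f hg, diagCoeff_mon, diagCoeff_mon, diagCoeff_mon]
      have h1 : l' * p + m' = l * p + m ↔ l' = l ∧ m' = m := by
        constructor
        · intro h
          have e1 := congrArg (· / p) h
          have e2 := congrArg (· % p) h
          simp only [mul_comm _ p] at e1 e2
          rw [Nat.mul_add_div hp, Nat.mul_add_div hp, Nat.div_eq_of_lt hm,
            Nat.div_eq_of_lt hm'] at e1
          rw [Nat.mul_add_mod, Nat.mul_add_mod, Nat.mod_eq_of_lt hm, Nat.mod_eq_of_lt hm'] at e2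
          exact ⟨by omega, e2⟩
        · rintro ⟨rfl, rfl⟩; rfl
      simp only [and_self, h1]
      by_cases hl : l' = l
      · by_cases hmm : m' = m
        · simp [hl, hmm]
        · simp [hmm]
      · simp [hl]

/-- For nonzero coefficient functions `f` of `z` and `g` of `u`, with `g` of period `p`, there is an
integer `h` with a prescribed residue modulo `p` and a prescribed floor `⌊(h + c) / p⌋`, so that the
corresponding coefficient of the product does not vanish at `h`. -/
theorem frobS_mul_ne_zero (c : ℤ) {z u : Hyper k} (hz : z ∈ homog k 0) (hz0 : z ≠ 0)
    (hu : u ∈ Dr k p 1) (hu0 : u ≠ 0) : frobS k p c z * u ≠ 0 := by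
  intro h0
  have hp : (p : ℤ) ≠ 0 := by exact_mod_cast (Fact.out : p.Prime).ne_zero
  have ex : ∀ {v : Hyper k}, v ∈ homog k 0 → v ≠ 0 →
      ∃ n x, (diagCoeff k n v : ℤ → k) x ≠ 0 := by
    intro v hv hv0
    by_contra! hcon
    exact hv0 (eq_zero_of_diagCoeff hv fun n => Subtype.ext (funext fun x => hcon n x))
  obtain ⟨l, x, hx⟩ := ex hz hz0
  obtain ⟨m, y, hy⟩ := ex (Dr_le_homog _ hu) hu0
  have hm : m < p := by
    by_contra hm
    rw [diagCoeff_of_le hu (by simpa using hm)] at hy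
    exact hy rfl
  have e := diagCoeff_frobS_mul c l hm hz hu
  rw [h0, map_zero] at e
  have e2 := congrFun (congrArg Subtype.val e) (y + (x - (y + (c - 2 * m)) / p) * p)
  rw [MulMemClass.coe_mul, Pi.mul_apply, shiftW_apply, floorW_apply] at e2
  have e3 := perW_apply_add_mul (diagCoeff_mem_perW hu m) y (x - (y + (c - 2 * m)) / p)
  rw [pow_one] at e3
  have e4 : (y + (x - (y + (c - 2 * m)) / p) * p + (c - 2 * m)) / p = x := by
    have : y + (x - (y + (c - 2 * m)) / p) * p + (c - 2 * m)
        = (y + (c - 2 * m)) + (x - (y + (c - 2 * m)) / p) * p := by ring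
    rw [this, Int.add_mul_ediv_right _ _ hp]; ring
  rw [e3, e4] at e2
  exact mul_ne_zero hx hy e2.symm

end

/-! ### Gluing the elements for single pairs -/

section

variable (k : Type*) [Field k] (p : ℕ) [Fact p.Prime] [CharP k p]

/-- What has to be known about the two elements `B 0`, `B 1` attached to a single pair: `B 0` is an
idempotent of weight `a` modulo `p` which generates, under `𝒜_1`, the span of `B 0` and (if `nd`,
the nondegeneracy of the pair, holds) of the square-zero element `B 1`; and the map `frobS k p c` is
multiplicative after multiplication by `B 0`. -/
structure IsStep (a c : ℤ) (nd : Prop) (B : Fin 2 → Hyper k) : Prop where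
  mem : ∀ ε, B ε ∈ Dr k p 1
  idem : B 0 * B 0 = B 0
  zero_mul_one : B 0 * B 1 = B 1
  sq_zero : nd → B 1 * B 1 = 0
  zero_ne : B 0 ≠ 0
  one_ne : nd → B 1 ≠ 0
  mem_span : ∀ b ∈ Dr k p 1, b * B 0 ∈ Submodule.span k {x | ∃ ε, (ε = 0 ∨ nd) ∧ x = B ε}
  weight : B 0 * torus k (ind k p 1 a) = B 0
  frob : ∀ z ∈ homog k 0, ∀ z' ∈ homog k 0,
    frobS k p c z * frobS k p c z' * B 0 = frobS k p c (z * z') * B 0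

/-- What the elements `B ε` attached to an `r`-tuple of pairs satisfy, where `nd i` is the
nondegeneracy of the `i`-th pair: restricted to the `ε` that vanish at all `i` without `nd i`, they
multiply like square-free monomials in variables of square zero (with the idempotent `B 0` as the
unit), they are nonzero and span `𝒜_r B 0`; and `B 0` has weight `b` modulo `p ^ r`. -/
structure IsBlock (r : ℕ) (b : ℤ) (nd : Fin r → Prop) (B : (Fin r → Fin 2) → Hyper k) :
    Prop where
  mem : ∀ ε, B ε ∈ Dr k p r
  mul_of_disjoint : ∀ ε θ, (∀ i, ¬ nd i → ε i = 0) → (∀ i, ¬ nd i → θ i = 0) →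
    (∀ i, ε i = 0 ∨ θ i = 0) → B ε * B θ = B (ε ⊔ θ)
  mul_eq_zero : ∀ ε θ, (∀ i, ¬ nd i → ε i = 0) → (∀ i, ¬ nd i → θ i = 0) →
    ∀ i, ε i = 1 → θ i = 1 → B ε * B θ = 0
  ne_zero : ∀ ε, (∀ i, ¬ nd i → ε i = 0) → B ε ≠ 0
  mem_span : ∀ u ∈ Dr k p r,
    u * B 0 ∈ Submodule.span k {x | ∃ ε, (∀ i, ¬ nd i → ε i = 0) ∧ x = B ε}
  weight : B 0 * torus k (ind k p r b) = B 0

variable {k p}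

theorem IsStep.zero_mul {a c : ℤ} {nd : Prop} {B : Fin 2 → Hyper k} (h : IsStep k p a c nd B)
    (ε : Fin 2) : B 0 * B ε = B ε := by
  fin_cases ε
  · exact h.idem
  · exact h.zero_mul_one

theorem IsStep.frobS_mul_mul {a c : ℤ} {nd : Prop} {B : Fin 2 → Hyper k}
    (h : IsStep k p a c nd B) {z z' : Hyper k} (hz : z ∈ homog k 0) (hz' : z' ∈ homog k 0)
    {b : Hyper k} (hb : b ∈ homog k 0) (ε : Fin 2) :
    frobS k p c z * b * (frobS k p c z' * B ε) = frobS k p c (z * z') * (b * B ε) := by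
  have h0 : B 0 ∈ homog k 0 := Dr_le_homog _ (h.mem 0)
  have hF := frobS_mem_homog (p := p) c hz'
  calc frobS k p c z * b * (frobS k p c z' * B ε)
      = frobS k p c z * (b * frobS k p c z') * B ε := by simp only [mul_assoc]
    _ = frobS k p c z * frobS k p c z' * (b * (B 0 * B ε)) := by
        rw [mul_comm_of_mem_homog hb hF, h.zero_mul]; simp only [mul_assoc]
    _ = (frobS k p c z * frobS k p c z' * B 0) * (b * B ε) := by
        rw [← mul_assoc b, mul_comm_of_mem_homog hb h0]; simp only [mul_assoc]
    _ = frobS k p c (z * z') * (b * (B 0 * B ε)) := by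
        rw [h.frob z hz z' hz', ← mul_assoc b, mul_comm_of_mem_homog hb h0]
        simp only [mul_assoc]
    _ = _ := by rw [h.zero_mul]

theorem isBlock_zero (nd : Fin 0 → Prop) : IsBlock k p 0 0 nd (fun _ => 1) where
  mem _ := one_mem_Dr 0
  mul_of_disjoint _ _ _ _ _ := one_mul 1
  mul_eq_zero _ _ _ _ i := i.elim0
  ne_zero _ _ := by
    intro h
    have h1 : torus k 1 = 0 := by rw [map_one, h]
    have := diagCoeff_mon (k := k) 0 0 0 1
    have e : mon 0 (1 : W k) 0 = 1 := by simp [mon, eX_zero, eY_zero]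
    rw [e, h, map_zero, if_pos ⟨rfl, rfl⟩] at this
    exact one_ne_zero this.symm
  mem_span u hu := by
    unfold Dr at hu
    rw [mul_one]
    induction hu using Submodule.span_induction with
    | zero => exact zero_mem _
    | add u v _ _ h1 h2 => exact add_mem h1 h2
    | smul c u _ h => exact Submodule.smul_mem _ _ h
    | mem x hx =>
      obtain ⟨m, f, hm, hf, rfl⟩ := hx
      obtain rfl : m = 0 := by simpa using hm
      rw [eq_sum_ind hf]
      simp only [pow_zero, Finset.range_one, Finset.sum_singleton]
      rw [mon_smul]
      refine Submodule.smul_mem _ _ (Submodule.subset_span ⟨0, fun _ _ => rfl, ?_⟩)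
      have : ind k p 0 (0 : ℕ) = 1 := by
        apply Subtype.ext; funext h; rw [ind_apply]; simp
      rw [this]; simp [mon, eX_zero, eY_zero]
  weight := by
    have : ind k p 0 0 = 1 := by
      apply Subtype.ext; funext h; rw [ind_apply]; simp
    rw [this, map_one, mul_one]

/-- Adding one pair at the front of a tuple. The new weight is congruent to `a` modulo `p`, and its
translate by `c` has floor `b` on division by `p`. -/
theorem IsBlock.succ {r : ℕ} {a b c : ℤ} {nd : Fin (r + 1) → Prop} {B : Fin 2 → Hyper k}
    {B' : (Fin r → Fin 2) → Hyper k} (h : IsStep k p a c (nd 0) B)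
    (h' : IsBlock k p r b (fun i => nd i.succ) B') :
    IsBlock k p (r + 1) (a + p * (b - (a + c) / p)) nd
      (fun ε => frobS k p c (B' fun i => ε i.succ) * B (ε 0)) where
  mem ε := mul_mem_Dr (frobS_mem_Dr c (h'.mem _)) (by
    have := h.mem (ε 0)
    unfold Dr at this ⊢
    refine Submodule.span_mono ?_ this
    rintro x ⟨m, f, hm, hf, rfl⟩
    exact ⟨m, f, hm.trans_le (Nat.pow_le_pow_right (Fact.out : p.Prime).pos (by omega)),
      perW_mono (by omega) hf, rfl⟩)
  mul_of_disjoint ε θ hε hθ hd := by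
    rw [h.frobS_mul_mul (Dr_le_homog _ (h'.mem _)) (Dr_le_homog _ (h'.mem _))
      (Dr_le_homog _ (h.mem _)),
      h'.mul_of_disjoint _ _ (fun i => hε i.succ) (fun i => hθ i.succ) (fun i => hd i.succ)]
    congr 1
    rw [Pi.sup_apply]
    rcases hd 0 with h0 | h0
    · rw [h0, h.zero_mul, sup_eq_right.mpr (Fin.zero_le _)]
    · rw [h0, mul_comm_of_mem_homog (Dr_le_homog _ (h.mem _)) (Dr_le_homog _ (h.mem _)),
        h.zero_mul, sup_eq_left.mpr (Fin.zero_le _)]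
  mul_eq_zero ε θ hε hθ i hi hi' := by
    rw [h.frobS_mul_mul (Dr_le_homog _ (h'.mem _)) (Dr_le_homog _ (h'.mem _))
      (Dr_le_homog _ (h.mem _))]
    refine Fin.cases (fun hi hi' => ?_) (fun i hi hi' => ?_) i hi hi'
    · have hnd : nd 0 := by
        by_contra hnd
        have := hε 0 hnd
        omega
      rw [hi, hi', h.sq_zero hnd, mul_zero]
    · rw [h'.mul_eq_zero _ _ (fun i => hε i.succ) (fun i => hθ i.succ) i hi hi', map_zero,
        MulZeroClass.zero_mul]
  ne_zero ε hε := by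
    refine frobS_mul_ne_zero c (Dr_le_homog _ (h'.mem _)) (h'.ne_zero _ fun i => hε i.succ)
      (h.mem _) ?_
    by_cases h0 : nd 0
    · rcases Fin.exists_fin_two.mp ⟨ε 0, rfl⟩ with h1 | h1
      · rw [h1]; exact h.zero_ne
      · rw [h1]; exact h.one_ne h0
    · rw [hε 0 h0]; exact h.zero_ne
  mem_span u hu := by
    have hu' := mem_span_frobS_mul c hu
    clear hu
    induction hu' using Submodule.span_induction with
    | zero => rw [MulZeroClass.zero_mul]; exact zero_mem _
    | add u v _ _ h1 h2 => rw [add_mul]; exact add_mem h1 h2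
    | smul c u _ h => rw [smul_mul_assoc]; exact Submodule.smul_mem _ _ h
    | mem x hx =>
      obtain ⟨z, hz, d, hd, rfl⟩ := hx
      simp only [Pi.zero_apply]
      rw [h.frobS_mul_mul (Dr_le_homog _ hz) (Dr_le_homog _ (h'.mem _)) (Dr_le_homog _ hd)]
      have h1 := h'.mem_span z hz
      have h2 := h.mem_span d hd
      change z * B' (fun _ => 0) ∈ _ at h1
      generalize z * B' (fun _ => 0) = v at h1 ⊢
      generalize d * B 0 = v' at h2 ⊢
      induction h1 using Submodule.span_induction with
      | zero => rw [map_zero, MulZeroClass.zero_mul]; exact zero_mem _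
      | add u v _ _ h1 h2 => rw [map_add, add_mul]; exact add_mem h1 h2
      | smul c u _ h => rw [map_smul, smul_mul_assoc]; exact Submodule.smul_mem _ _ h
      | mem x hx =>
        obtain ⟨ε, hε, rfl⟩ := hx
        induction h2 using Submodule.span_induction with
        | zero => rw [mul_zero]; exact zero_mem _
        | add u v _ _ h1 h2 => rw [mul_add]; exact add_mem h1 h2
        | smul c u _ h => rw [mul_smul_comm]; exact Submodule.smul_mem _ _ h
        | mem x hx =>
          obtain ⟨δ, hδ, rfl⟩ := hx
          refine Submodule.subset_span ⟨Fin.cons δ ε, fun i => ?_, by simp⟩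
          refine Fin.cases (fun hi => ?_) (fun i hi => ?_) i
          · exact hδ.resolve_right hi
          · exact hε i hi
  weight := by
    have hp : (p : ℤ) ≠ 0 := by exact_mod_cast (Fact.out : p.Prime).ne_zero
    simp only [Pi.zero_apply]
    have e1 : (a + p * (b - (a + c) / p) + c) / p = b := by
      have : a + p * (b - (a + c) / p) + c = a + c + p * (b - (a + c) / p) := by ring
      rw [this, Int.add_mul_ediv_left _ _ hp]; ring
    have e2 : ind k p 1 (a + p * (b - (a + c) / p)) = ind k p 1 a := by
      apply Subtype.ext; funext h
      rw [ind_apply, ind_apply, pow_one]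
      have : h - (a + p * (b - (a + c) / p)) = h - a - p * (b - (a + c) / p) := by ring
      simp only [this, dvd_sub_left (dvd_mul_right (p : ℤ) _)]
    rw [ind_succ r _ c, e1, e2, map_mul, mul_assoc, ← mul_assoc (B 0), h.weight,
      mul_comm_of_mem_homog (Dr_le_homog _ (h.mem 0)) (torus_mem_homog _), ← mul_assoc,
      ← frobS_mul_torus]
    have := h'.weight
    change B' (fun _ => 0) * _ = B' (fun _ => 0) at this
    rw [this]

end

/-! ### Polynomials in `YX` on a weight space modulo `p` -/

section

variable (k : Type*) [Field k] (p : ℕ) [Fact p.Prime] [CharP k p] (a : ℕ)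

/-- The map `P ↦ P(μ_a Y X) μ_a` from polynomials to `𝒜_1 μ_a`. -/
noncomputable def evMu : k[X] →ₗ[k] Hyper k :=
  LinearMap.mulRight k (mu k p a) ∘ₗ (aeval (mu k p a * eY k 1 * eX k 1)).toLinearMap

/-- `φ_{a,m}` over the field `k`. -/
noncomputable def phiK (m : ℕ) : k[X] :=
  ∏ i ∈ Finset.range m, (X - C ((i : k) * (i + a + 1)))

/-- The polynomial corresponding to `X ^ m * Y ^ m`, as `φ_{a,m}` does to `Y ^ m * X ^ m`. -/
noncomputable def phiOp (m : ℕ) : k[X] :=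
  ∏ i ∈ Finset.range m, (X + C (((i : k) + 1) * (a - i)))

variable {k p}

theorem evMu_apply (P : k[X]) :
    evMu k p a P = aeval (mu k p a * eY k 1 * eX k 1) P * mu k p a := rfl

theorem map_phi (m : ℕ) : (phi p a m).map (ZMod.castHom (dvd_refl p) k) = phiK k a m := by
  rw [phi, phiK, Polynomial.map_prod]
  refine Finset.prod_congr rfl fun i _ => ?_
  simp

theorem phiK_dvd_of_le {m n : ℕ} (h : m ≤ n) : phiK k a m ∣ phiK k a n :=
  Finset.prod_dvd_prod_of_subset _ _ _ (Finset.range_mono h)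

theorem monic_phiK (m : ℕ) : (phiK k a m).Monic :=
  monic_prod_of_monic _ _ fun _ _ => monic_X_sub_C _

theorem natDegree_phiK (m : ℕ) : (phiK k a m).natDegree = m := by
  rw [phiK, natDegree_prod_of_monic _ _ fun _ _ => monic_X_sub_C _]
  simp only [natDegree_X_sub_C, Finset.sum_const, Finset.card_range, smul_eq_mul, mul_one]

theorem mu_eq : mu k p a = torus k (ind k p 1 a) := by
  rw [mu, ind, torus_binW, pow_one]

theorem mu_mem_Dr : mu k p a ∈ Dr k p 1 := by
  rw [mu_eq]; exact torus_mem_Dr (ind_mem_perW 1 a)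

theorem mu_mem_homog : mu k p a ∈ homog k 0 := Dr_le_homog 1 (mu_mem_Dr (p := p) a)

theorem ind_mul (N : ℕ) (b : ℤ) {f : W k} (hf : f ∈ perW p N) :
    ind k p N b * f = ((f : ℤ → k) b) • ind k p N b := by
  apply Subtype.ext; funext h
  change (ind k p N b : ℤ → k) h * (f : ℤ → k) h = (f : ℤ → k) b * (ind k p N b : ℤ → k) h
  rw [ind_apply]
  split_ifs with hd
  · rw [perW_apply_eq hf hd]; ring
  · ring

theorem mu_mul_mu : mu k p a * mu k p a = mu k p a := by
  rw [mu_eq, ← map_mul, ind_mul _ _ (ind_mem_perW _ _), ind_apply]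
  simp

theorem yx_mem_homog : eY k 1 * eX k 1 ∈ homog k 0 := by
  simpa using mul_mem_homog (eY_mem_homog (k := k) 1) (eX_mem_homog 1)

theorem commute_mu_yx : Commute (mu k p a) (eY k 1 * eX k 1) :=
  mul_comm_of_mem_homog (mu_mem_homog a) yx_mem_homog

theorem evMu_one : evMu k p a 1 = mu k p a := by rw [evMu_apply, map_one, one_mul]

theorem evMu_X : evMu k p a X = mu k p a * (eY k 1 * eX k 1) := by
  rw [evMu_apply, aeval_X, mul_assoc (mu k p a), mul_assoc, ← (commute_mu_yx a).eq, ← mul_assoc,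
    mu_mul_mu]

theorem evMu_C_mul (c : k) (P : k[X]) : evMu k p a (C c * P) = c • evMu k p a P := by
  rw [← smul_eq_C_mul, map_smul]

theorem commute_mu_aeval (P : k[X]) :
    Commute (mu k p a) (aeval (mu k p a * eY k 1 * eX k 1) P) := by
  have h : Commute (mu k p a) (mu k p a * eY k 1 * eX k 1) := by
    rw [mul_assoc]; exact (Commute.refl _).mul_right (commute_mu_yx a)
  induction P using Polynomial.induction_on' with
  | add P Q hP hQ => rw [map_add]; exact hP.add_right hQ
  | monomial n c =>
    rw [aeval_monomial]
    exact (Algebra.commute_algebraMap_right c _).mul_right (h.pow_right n)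

theorem evMu_mul (P Q : k[X]) : evMu k p a (P * Q) = evMu k p a P * evMu k p a Q := by
  rw [evMu_apply, evMu_apply, evMu_apply, map_mul, mul_assoc _ (mu k p a),
    ← mul_assoc (mu k p a), (commute_mu_aeval a Q).eq, mul_assoc _ (mu k p a), mu_mul_mu,
    mul_assoc]

theorem mu_mul_evMu (P : k[X]) : mu k p a * evMu k p a P = evMu k p a P := by
  rw [← evMu_one, ← evMu_mul, one_mul]

theorem evMu_mul_mu (P : k[X]) : evMu k p a P * mu k p a = evMu k p a P := by
  rw [← evMu_one, ← evMu_mul, mul_one]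

theorem mu_mul_h : mu k p a * torus k (binW k 0 1) = (a : k) • mu k p a := by
  rw [mu_eq, ← map_mul, ind_mul _ _ (binW_mem_perW 0 one_lt_p_pow_one), map_smul, binW_apply]
  simp

theorem mu_commute_h : Commute (mu k p a) (torus k (binW k 0 1)) :=
  mul_comm_of_mem_homog (mu_mem_homog a) (torus_mem_homog _)

/-- On `μ_a`, the polynomial `φ_{a,m}` in `YX` is `Y ^ m X ^ m`. -/
theorem evMu_phiK (m : ℕ) : evMu k p a (phiK k a m) = mu k p a * (eY k 1 ^ m * eX k 1 ^ m) := by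
  induction m with
  | zero => simp [phiK, evMu_one]
  | succ m ih =>
    rw [phiK, Finset.prod_range_succ, ← phiK, evMu_mul, ih, eY_pow_mul_eX_pow_succ, map_sub,
      evMu_X, ← mul_one (C _), evMu_C_mul, evMu_one]
    have h1 : Commute (mu k p a) (eY k 1 ^ m * eX k 1 ^ m) :=
      commute_eY_pow_mul_eX_pow (commute_mu_yx a) (mu_commute_h a) m
    have h2 : mu k p a * ((m : Hyper k) * (torus k (binW k 0 1) + m + 1))
        = ((m : k) * (m + a + 1)) • mu k p a := by
      rw [← mul_assoc, ← (Nat.cast_commute m (mu k p a)).eq, mul_assoc, mul_add, mul_add (mu k p a),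
        mu_mul_h, mul_one, ← (Nat.cast_commute m (mu k p a)).eq, mul_smul,
        ← nsmul_eq_mul, ← nsmul_eq_mul, ← Nat.cast_smul_eq_nsmul k, ← Nat.cast_smul_eq_nsmul k]
      congr 1
      module
    rw [h1.eq, mul_assoc, mul_sub (mu k p a), ← mul_assoc (mu k p a) (mu k p a), mu_mul_mu,
      mul_smul_comm, mu_mul_mu, ← h2, ← mul_sub, ← mul_assoc, ← h1.eq, mul_assoc]

/-- On `μ_a`, the polynomial `phiOp` in `YX` is `X ^ m Y ^ m`. -/
theorem evMu_phiOp (m : ℕ) : evMu k p a (phiOp k a m) = mu k p a * (eX k 1 ^ m * eY k 1 ^ m) := by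
  induction m with
  | zero => simp [phiOp, evMu_one]
  | succ m ih =>
    rw [phiOp, Finset.prod_range_succ, ← phiOp, evMu_mul, ih, eX_pow_mul_eY_pow_succ, map_add,
      evMu_X, ← mul_one (C _), evMu_C_mul, evMu_one]
    have h0 : eX k 1 ^ m * eY k 1 ^ m ∈ homog k 0 := by
      simpa using mul_mem_homog (eX_pow_mem_homog (k := k) m) (eY_pow_mem_homog m)
    have h1 : Commute (mu k p a) (eX k 1 ^ m * eY k 1 ^ m) :=
      mul_comm_of_mem_homog (mu_mem_homog a) h0
    have h2 : mu k p a * (((m : Hyper k) + 1) * (torus k (binW k 0 1) - m))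
        = (((m : k) + 1) * (a - m)) • mu k p a := by
      have e : ((m : Hyper k) + 1) = ((m + 1 : ℕ) : Hyper k) := by push_cast; rfl
      rw [e, ← mul_assoc, ← (Nat.cast_commute (m + 1) (mu k p a)).eq, mul_assoc, mul_sub,
        mu_mul_h, ← (Nat.cast_commute m (mu k p a)).eq, mul_smul,
        ← nsmul_eq_mul, ← nsmul_eq_mul, ← Nat.cast_smul_eq_nsmul k, ← Nat.cast_smul_eq_nsmul k]
      push_cast
      module
    rw [h1.eq, mul_assoc, mul_add (mu k p a), ← mul_assoc (mu k p a) (mu k p a), mu_mul_mu,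
      mul_smul_comm, mu_mul_mu, ← h2, ← mul_add, ← mul_assoc, ← h1.eq, mul_assoc]

theorem eX_one_pow_p : eX k 1 ^ p = 0 := by
  have : ((p.factorial : ℕ) : k) = 0 :=
    (CharP.cast_eq_zero_iff k p _).2 (Nat.dvd_factorial (Fact.out : p.Prime).pos le_rfl)
  rw [eX_one_pow, this, zero_smul]

theorem evMu_eq_zero_of_dvd {P : k[X]} (h : phiK k a p ∣ P) : evMu k p a P = 0 := by
  obtain ⟨Q, rfl⟩ := h
  rw [evMu_mul, evMu_phiK, eX_one_pow_p, mul_zero, mul_zero, zero_mul]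

theorem evMu_eq_of_dvd {P Q : k[X]} (h : phiK k a p ∣ P - Q) : evMu k p a P = evMu k p a Q := by
  rw [← sub_eq_zero, ← map_sub]; exact evMu_eq_zero_of_dvd a h

theorem eY_pow_mul_eX_pow_mem_Dr (m : ℕ) : eY k 1 ^ m * eX k 1 ^ m ∈ Dr k p 1 := by
  simpa using eY_pow_mul_mul_eX_pow_mem (one_mem_Dr (k := k) (p := p) 1) m

theorem linearIndependent_mu_mul :
    LinearIndependent k (fun m : Fin p => mu k p a * (eY k 1 ^ (m : ℕ) * eX k 1 ^ (m : ℕ))) := by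
  have key : ∀ m n : ℕ, diagCoeff k n (mu k p a * (eY k 1 ^ m * eX k 1 ^ m))
      = if m = n then ((m.factorial : k) * m.factorial) • shiftW (-2 * m) (ind k p 1 a) else 0 := by
    intro m n
    rw [eY_one_pow, eX_one_pow, smul_mul_smul_comm, mul_smul_comm, map_smul, mu_eq, ← mul_assoc,
      torus_mul_eY]
    have := diagCoeff_mon n m m (shiftW (-2 * m) (ind k p 1 a))
    rw [mon] at this
    rw [this]
    simp only [and_self, smul_ite, smul_zero]
  rw [Fintype.linearIndependent_iff]
  intro g hg i
  have h1 := congrArg (diagCoeff k i) hg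
  rw [map_sum, map_zero] at h1
  simp only [map_smul, key] at h1
  rw [Finset.sum_eq_single i (fun m _ hm => by
    rw [if_neg (fun h => hm (Fin.ext h)), smul_zero]) (by simp), if_pos rfl] at h1
  have h2 := congrFun (congrArg Subtype.val h1) (a + 2 * (i : ℕ))
  change g i * ((((i : ℕ).factorial : k) * (i : ℕ).factorial)
    * (shiftW (-2 * (i : ℕ)) (ind k p 1 a) : ℤ → k) (a + 2 * (i : ℕ))) = 0 at h2
  rw [shiftW_apply, ind_apply] at h2
  have h3 := factorial_ne_zero_of_lt (k := k) i.2
  have h4 : (p : ℤ) ^ 1 ∣ (a : ℤ) + 2 * (i : ℕ) + -2 * (i : ℕ) - a := by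
    ring_nf; exact dvd_zero _
  rw [if_pos h4] at h2
  simpa [h3] using h2

/-- Expansion of a polynomial in the `φ_{a,m}`, starting at an index for which `φ_{a,n}` divides
it. -/
theorem exists_phiK_expansion {n : ℕ} (N : ℕ) {P : k[X]} (hn : phiK k a n ∣ P)
    (hP : P.degree < N) : ∃ c : ℕ → k, (∀ m < n, c m = 0) ∧
      P = ∑ m ∈ Finset.range N, c m • phiK k a m := by
  induction N generalizing P with
  | zero =>
    refine ⟨0, by simp, ?_⟩
    have : P = 0 := by
      rw [← Polynomial.degree_eq_bot]
      by_contra h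
      rw [degree_eq_natDegree (by simpa using h)] at hP
      simp at hP
    simpa using this
  | succ N ih =>
    by_cases hnN : n ≤ N
    · have hd : (P - P.coeff N • phiK k a N).degree < N := by
        rw [degree_lt_iff_coeff_zero]
        intro m hm
        rw [coeff_sub, coeff_smul]
        rcases hm.eq_or_lt with rfl | hm
        · have : (phiK k a N).coeff N = 1 := by
            have := (monic_phiK (k := k) a N).coeff_natDegree
            rwa [natDegree_phiK] at this
          rw [this]; simp
        · have h1 : (phiK k a N).coeff m = 0 :=
            coeff_eq_zero_of_natDegree_lt (by rw [natDegree_phiK]; exact hm)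
          have h2 : P.coeff m = 0 :=
            coeff_eq_zero_of_degree_lt (hP.trans_le (by exact_mod_cast hm))
          rw [h1, h2]; simp
      obtain ⟨c, hc, he⟩ := ih (dvd_sub hn ((phiK_dvd_of_le a hnN).trans
        (Dvd.intro_left (C (P.coeff N)) (smul_eq_C_mul _).symm))) hd
      refine ⟨fun m => if m = N then P.coeff N else c m, fun m hm => ?_, ?_⟩
      · simp only
        rw [if_neg (by omega), hc m hm]
      · have h3 : ∑ m ∈ Finset.range N, (if m = N then P.coeff N else c m) • phiK k a m
            = ∑ m ∈ Finset.range N, c m • phiK k a m :=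
          Finset.sum_congr rfl fun m hm => by rw [if_neg (Finset.mem_range.1 hm).ne]
        rw [Finset.sum_range_succ, h3, ← he]
        simp
    · refine ⟨0, by simp, ?_⟩
      have : P = 0 := by
        by_contra h
        have h1 := Polynomial.degree_le_of_dvd hn h
        rw [degree_eq_natDegree (monic_phiK a n).ne_zero, natDegree_phiK] at h1
        have h2 := h1.trans_lt hP
        have h3 : n < N + 1 := by exact_mod_cast h2
        omega
      simpa using this

theorem evMu_mem_Dr (P : k[X]) : evMu k p a P ∈ Dr k p 1 := by
  have h1 : mu k p a * eY k 1 * eX k 1 ∈ Dr k p 1 := by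
    rw [mul_assoc]
    have := eY_pow_mul_eX_pow_mem_Dr (k := k) (p := p) 1
    rw [pow_one, pow_one] at this
    exact mul_mem_Dr (mu_mem_Dr a) this
  rw [evMu_apply]
  refine mul_mem_Dr ?_ (mu_mem_Dr a)
  rw [← mem_Ar_iff] at h1 ⊢
  exact (aeval_mem_adjoin_singleton k _ |> Algebra.adjoin_le (by simpa using h1) : _)

theorem evMu_ne_zero {P : k[X]} (hP : P.degree < p) (h0 : P ≠ 0) : evMu k p a P ≠ 0 := by
  intro h
  obtain ⟨c, -, he⟩ := exists_phiK_expansion (n := 0) a p (by simp [phiK]) hP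
  have h1 := he
  apply h0
  rw [h1, map_sum] at h
  simp only [map_smul, evMu_phiK] at h
  rw [Finset.sum_range] at h
  have := Fintype.linearIndependent_iff.1 (linearIndependent_mu_mul (k := k) (p := p) a)
    (fun i => c i) h
  rw [h1]
  refine Finset.sum_eq_zero fun m hm => ?_
  rw [this ⟨m, Finset.mem_range.1 hm⟩, zero_smul]

/-- `𝒜_1 μ_a` consists of polynomials in `YX`. -/
theorem exists_evMu_of_mem_Dr {b : Hyper k} (hb : b ∈ Dr k p 1) :
    ∃ Q, b * mu k p a = evMu k p a Q := by
  have h2 : b * mu k p a ∈ LinearMap.range (evMu k p a) := by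
    unfold Dr at hb
    induction hb using Submodule.span_induction with
    | zero => rw [zero_mul]; exact zero_mem _
    | add u v _ _ h1 h2 => rw [add_mul]; exact add_mem h1 h2
    | smul c u _ h => rw [smul_mul_assoc]; exact Submodule.smul_mem _ _ h
    | mem x hx =>
      obtain ⟨m, f, hm, hf, rfl⟩ := hx
      rw [pow_one] at hm
      have h3 := factorial_ne_zero_of_lt (k := k) hm
      have hf' := shiftW_mem_perW hf (2 * m)
      refine ⟨C ((shiftW (2 * m) f : ℤ → k) a * ((m.factorial : k)⁻¹ * (m.factorial : k)⁻¹))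
        * phiK k a m, ?_⟩
      rw [evMu_C_mul, evMu_phiK, mon_self, mul_comm_of_mem_homog (by
        simpa using mul_mem_homog (torus_mem_homog _) (by
          simpa using mul_mem_homog (eY_mem_homog (k := k) m) (eX_mem_homog m)))
        (mu_mem_homog a), mu_eq, ← mul_assoc _ (torus k _), ← map_mul (torus k), ind_mul _ _ hf',
        map_smul, eY_one_pow, eX_one_pow, smul_mul_smul_comm, mul_smul_comm, smul_smul,
        smul_mul_assoc]
      congr 1
      field_simp
  obtain ⟨Q, hQ⟩ := h2
  exact ⟨Q, hQ.symm⟩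

end

/-! ### From polynomials to the elements for a single pair -/

section

variable {k : Type*} [Field k] {p : ℕ} [Fact p.Prime] [CharP k p] {a : ℕ}

theorem eX_eq_smul_pow {m : ℕ} (hm : m < p) : eX k m = ((m.factorial : k)⁻¹) • eX k 1 ^ m := by
  rw [eX_one_pow, smul_smul, inv_mul_cancel₀ (factorial_ne_zero_of_lt hm), one_smul]

/-- Divisibility of a polynomial by `φ_{a,s}` allows its value to be written with a factor `Y ^ s`
on the left and `X ^ s` on the right. -/
theorem exists_evMu_eq_of_phiK_dvd {P : k[X]} (hP : P.degree < p) {s : ℕ}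
    (hs : phiK k a s ∣ P) : ∃ G ∈ Dr k p 1, evMu k p a P = eY k 1 ^ s * G * eX k 1 ^ s := by
  obtain ⟨c, hc, he⟩ := exists_phiK_expansion a p hs hP
  refine ⟨torus k (shiftW (-2 * s) (ind k p 1 a)) *
    ∑ m ∈ Finset.range p, c m • (eY k 1 ^ (m - s) * eX k 1 ^ (m - s)), ?_, ?_⟩
  · refine mul_mem_Dr (torus_mem_Dr (shiftW_mem_perW (ind_mem_perW 1 a) _)) ?_
    exact Submodule.sum_mem _ fun m _ => Submodule.smul_mem _ _ (eY_pow_mul_eX_pow_mem_Dr _)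
  · have h1 : eY k 1 ^ s * torus k (shiftW (-2 * s) (ind k p 1 a)) = mu k p a * eY k 1 ^ s := by
      rw [eY_one_pow, mu_eq, smul_mul_assoc, mul_smul_comm, torus_mul_eY]
    conv_lhs => rw [he]
    rw [map_sum, ← mul_assoc, h1, mul_assoc, mul_assoc, Finset.sum_mul, Finset.mul_sum,
      Finset.mul_sum]
    refine Finset.sum_congr rfl fun m _ => ?_
    rw [map_smul, evMu_phiK, smul_mul_assoc, mul_smul_comm, mul_smul_comm]
    by_cases hm : m < s
    · rw [hc m hm, zero_smul, zero_smul]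
    · obtain ⟨t, rfl⟩ := Nat.exists_eq_add_of_le (not_lt.1 hm)
      rw [Nat.add_sub_cancel_left, pow_add, add_comm s t, pow_add]
      simp only [mul_assoc]

theorem eX_pow_mul_evMu_eq_zero (ha : a < p) {P : k[X]} (hP : phiOp k a a ∣ P) :
    eX k 1 ^ (p - a) * evMu k p a P = 0 := by
  obtain ⟨Q, rfl⟩ := hP
  have h0 : eX k 1 ^ a * eY k 1 ^ a ∈ homog k 0 := by
    simpa using mul_mem_homog (eX_pow_mem_homog (k := k) a) (eY_pow_mem_homog a)
  rw [evMu_mul, evMu_phiOp, mul_comm_of_mem_homog (mu_mem_homog a) h0, ← mul_assoc, ← mul_assoc,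
    ← mul_assoc, ← pow_add, Nat.sub_add_cancel ha.le, eX_one_pow_p]
  simp only [zero_mul]

/-- The multiplicativity of the twisted Frobenius splitting on the idempotent given by `P`. If `s =
0`, the vector is the idempotent itself, of weight `a`, and `X ^ (p - a)` kills it. If `s > 0`, the
vector is `X ^ s` times the idempotent, whose weight `a + 2 s` is `0` or `1` modulo `p`. -/
theorem frobS_mul_evMu (ha : a < p) {s : ℕ} {P : k[X]} (hP : P.degree < p)
    (hidem : evMu k p a P * evMu k p a P = evMu k p a P)
    (hs : (s = 0 ∧ phiOp k a a ∣ P) ∨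
      (0 < s ∧ (a + 2 * s = p ∨ a + 2 * s = p + 1) ∧ phiK k a s ∣ P))
    {z z' : Hyper k} (hz : z ∈ homog k 0) (hz' : z' ∈ homog k 0) :
    frobS k p (2 * s) z * frobS k p (2 * s) z' * evMu k p a P
      = frobS k p (2 * s) (z * z') * evMu k p a P := by
  rcases hs with ⟨rfl, hs⟩ | ⟨hs0, hs, hd⟩
  · refine frobS_mul (G := evMu k p a P) (a := a) (evMu_mem_Dr a P) (by simp) hidem ?_ ?_ hz hz'
    · rw [pow_zero, one_mul, ← mu_eq, mu_mul_evMu]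
    · intro t h1 ht
      have e : p - t = (a - t) + (p - a) := by omega
      rw [eX_eq_smul_pow (show p - t < p by omega), e, pow_add, pow_zero, one_mul, smul_mul_assoc,
        mul_assoc, eX_pow_mul_evMu_eq_zero ha hs, mul_zero, smul_zero]
  · obtain ⟨G, hG, hE⟩ := exists_evMu_eq_of_phiK_dvd hP hd
    have hw : ∀ b : ℤ, (p : ℤ) ∣ (a + 2 * s : ℤ) - b →
        torus k (ind k p 1 b) * (eX k 1 ^ s * evMu k p a P) = eX k 1 ^ s * evMu k p a P := by
      intro b hb
      have e : shiftW (2 * s) (ind k p 1 b) = ind k p 1 a := by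
        apply Subtype.ext; funext h
        rw [shiftW_apply, ind_apply, ind_apply, pow_one]
        have e1 : h + 2 * s - b = (h - a) + ((a + 2 * s : ℤ) - b) := by ring
        simp only [e1, dvd_add_left hb]
      rw [eX_one_pow, smul_mul_assoc, mul_smul_comm, ← mul_assoc, torus_mul_eX, e, mul_assoc,
        ← mu_eq, mu_mul_evMu]
    rcases hs with hs | hs
    · refine frobS_mul (a := 0) hG hE hidem (hw _ ?_) (fun t h1 h2 => by omega) hz hz'
      rw [show ((a : ℤ) + 2 * s) = p by exact_mod_cast hs]; simp
    · refine frobS_mul (a := 1) hG hE hidem (hw _ ?_) (fun t h1 h2 => ?_) hz hz'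
      · rw [show ((a : ℤ) + 2 * s) = p + 1 by exact_mod_cast hs]; simp
      · have e : p - t + s = p + (s - 1) := by have := (Fact.out : p.Prime).pos; omega
        rw [eX_eq_smul_pow (show p - t < p by have := (Fact.out : p.Prime).pos; omega),
          smul_mul_assoc, ← mul_assoc, ← pow_add, e, pow_add, eX_one_pow_p]
        simp only [zero_mul, smul_zero]

/-- The properties required of a single pair, for elements given by polynomials `P 0` and `P 1` that
are, modulo `φ_{a,p}`, a primitive idempotent and a generator of the radical of the corresponding
local factor (of dimension two if `nd`, and one otherwise). -/
theorem isStep_evMu (ha : a < p) {s : ℕ} {nd : Prop} {P : Fin 2 → k[X]}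
    (hdeg : ∀ ε, (P ε).degree < p) (h0 : P 0 ≠ 0) (h1 : nd → P 1 ≠ 0)
    (hidem : phiK k a p ∣ P 0 * P 0 - P 0) (h01 : phiK k a p ∣ P 0 * P 1 - P 1)
    (hsq : nd → phiK k a p ∣ P 1 * P 1)
    (hspan : ∀ Q : k[X], ∃ α β : k, (¬ nd → β = 0) ∧
      phiK k a p ∣ Q * P 0 - (C α * P 0 + C β * P 1))
    (hs : (s = 0 ∧ phiOp k a a ∣ P 0) ∨
      (0 < s ∧ (a + 2 * s = p ∨ a + 2 * s = p + 1) ∧ phiK k a s ∣ P 0)) :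
    IsStep k p a (2 * s) nd (fun ε => evMu k p a (P ε)) where
  mem ε := evMu_mem_Dr a _
  idem := by rw [← evMu_mul]; exact evMu_eq_of_dvd a hidem
  zero_mul_one := by rw [← evMu_mul]; exact evMu_eq_of_dvd a h01
  sq_zero h := by rw [← evMu_mul]; exact evMu_eq_zero_of_dvd a (hsq h)
  zero_ne := evMu_ne_zero a (hdeg 0) h0
  one_ne h := evMu_ne_zero a (hdeg 1) (h1 h)
  mem_span b hb := by
    obtain ⟨Q, hQ⟩ := exists_evMu_of_mem_Dr a hb
    obtain ⟨α, β, hβ, hd⟩ := hspan Q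
    rw [← mu_mul_evMu, ← mul_assoc, hQ, ← evMu_mul, evMu_eq_of_dvd a hd, map_add, evMu_C_mul,
      evMu_C_mul]
    refine add_mem (Submodule.smul_mem _ _ (Submodule.subset_span ⟨0, Or.inl rfl, rfl⟩)) ?_
    by_cases h : nd
    · exact Submodule.smul_mem _ _ (Submodule.subset_span ⟨1, Or.inr h, rfl⟩)
    · rw [hβ h, zero_smul]; exact zero_mem _
  weight := by rw [← mu_eq, evMu_mul_mu]
  frob z hz z' hz' := frobS_mul_evMu ha (hdeg 0)
    (by rw [← evMu_mul]; exact evMu_eq_of_dvd a hidem) hs hz hz'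

/-- The case of a pair for which `φ_{a,p}` has a double root at `d` and `P 0`, `P 1` are, modulo
`φ_{a,p}`, the idempotent and the square-zero element of the corresponding local factor. -/
theorem isStep_of_double_root (ha : a < p) {s : ℕ} {nd : Prop} (hnd : nd) {P : Fin 2 → k[X]}
    {L U : k[X]} {d : k} (hP0 : P 0 = L * U) (hP1 : P 1 = L * (X - C d))
    (hφ : phiK k a p = L * (X - C d) ^ 2) (hU : U.natDegree ≤ 1)
    (hLU : (X - C d) ^ 2 ∣ L * U - 1)
    (hs : (s = 0 ∧ phiOp k a a ∣ P 0) ∨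
      (0 < s ∧ (a + 2 * s = p ∨ a + 2 * s = p + 1) ∧ phiK k a s ∣ P 0)) :
    (∀ ε, (P ε).degree < p) ∧ IsStep k p a (2 * s) nd (fun ε => evMu k p a (P ε)) := by
  have hL : L ≠ 0 := by
    rintro rfl
    rw [zero_mul] at hφ
    exact (monic_phiK (k := k) a p).ne_zero hφ
  have hX : (X - C d : k[X]) ≠ 0 := X_sub_C_ne_zero d
  have hdL : L.natDegree + 2 = p := by
    have := natDegree_phiK (k := k) a p
    rw [hφ, natDegree_mul hL (pow_ne_zero 2 hX), natDegree_pow, natDegree_X_sub_C] at this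
    exact this
  have hU0 : U ≠ 0 := by
    rintro rfl
    have h1 : (X - C d) ∣ (1 : k[X]) := by
      have := (dvd_pow_self (X - C d) two_ne_zero).trans hLU
      rwa [mul_zero, zero_sub, dvd_neg] at this
    exact not_isUnit_X_sub_C d (isUnit_of_dvd_one h1)
  have hdeg : ∀ ε, (P ε).degree < p := by
    intro ε
    refine degree_le_natDegree.trans_lt ?_
    have : (P ε).natDegree < p := by
      fin_cases ε
      · change (P 0).natDegree < p
        rw [hP0]
        exact natDegree_mul_le.trans_lt (by omega)
      · change (P 1).natDegree < p
        rw [hP1]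
        refine natDegree_mul_le.trans_lt ?_
        rw [natDegree_X_sub_C]; omega
    exact_mod_cast this
  obtain ⟨V, hV⟩ := hLU
  refine ⟨hdeg, isStep_evMu ha hdeg ?_ ?_ ?_ ?_ ?_ ?_ hs⟩
  · rw [hP0]; exact mul_ne_zero hL hU0
  · intro _; rw [hP1]; exact mul_ne_zero hL hX
  · rw [hP0, hφ]
    exact ⟨U * V, by linear_combination (L * U) * hV⟩
  · rw [hP0, hP1, hφ]
    exact ⟨(X - C d) * V, by linear_combination (L * (X - C d)) * hV⟩
  · intro _
    rw [hP1, hφ]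
    exact ⟨L, by ring⟩
  · intro Q
    obtain ⟨S, hS⟩ : (X - C d) ∣ Q - C (Q.eval d) := dvd_iff_isRoot.2 (by simp)
    obtain ⟨T, hT⟩ : (X - C d) ∣ S * U - C ((S * U).eval d) := dvd_iff_isRoot.2 (by simp)
    refine ⟨Q.eval d, (S * U).eval d, fun h => absurd hnd h, ?_⟩
    rw [hP0, hP1, hφ]
    exact ⟨T, by linear_combination (L * U) * hS + (L * (X - C d)) * hT⟩

/-- The case of a pair for which `φ_{a,p}` has a simple root at `d`. -/
theorem isStep_of_simple_root (ha : a < p) {s : ℕ} {nd : Prop} (hnd : ¬ nd) {P : Fin 2 → k[X]}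
    {L : k[X]} {d : k} (hP : ∀ ε, P ε = L) (hφ : phiK k a p = L * (X - C d))
    (hL1 : L.eval d = 1)
    (hs : (s = 0 ∧ phiOp k a a ∣ P 0) ∨
      (0 < s ∧ (a + 2 * s = p ∨ a + 2 * s = p + 1) ∧ phiK k a s ∣ P 0)) :
    (∀ ε, (P ε).degree < p) ∧ IsStep k p a (2 * s) nd (fun ε => evMu k p a (P ε)) := by
  have hL : L ≠ 0 := by
    rintro rfl
    simp at hL1
  have hX : (X - C d : k[X]) ≠ 0 := X_sub_C_ne_zero d
  have hdL : L.natDegree + 1 = p := by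
    have := natDegree_phiK (k := k) a p
    rw [hφ, natDegree_mul hL hX, natDegree_X_sub_C] at this
    exact this
  have hdeg : ∀ ε, (P ε).degree < p := by
    intro ε
    refine degree_le_natDegree.trans_lt ?_
    rw [hP ε]
    exact_mod_cast (show L.natDegree < p by omega)
  obtain ⟨V, hV⟩ : (X - C d) ∣ L - 1 := dvd_iff_isRoot.2 (by simp [hL1])
  refine ⟨hdeg, isStep_evMu ha hdeg ?_ (fun h => absurd h hnd) ?_ ?_ (fun h => absurd h hnd) ?_ hs⟩
  · rw [hP 0]; exact hL
  · rw [hP 0, hφ]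
    exact ⟨V, by linear_combination L * hV⟩
  · rw [hP 0, hP 1, hφ]
    exact ⟨V, by linear_combination L * hV⟩
  · intro Q
    obtain ⟨S, hS⟩ : (X - C d) ∣ Q - C (Q.eval d) := dvd_iff_isRoot.2 (by simp)
    refine ⟨Q.eval d, 0, fun _ => rfl, ?_⟩
    rw [hP 0, C_0, zero_mul, add_zero, hφ]
    exact ⟨S, by linear_combination L * hS⟩

/-- The map `Z^{(ε)}` is the twisted Frobenius splitting followed by multiplication by `B^{(ε)}(a,
j)`. -/
theorem Zmap_eq {ε : Fin 2} {j : ℚ} {s : ℕ} {P : k[X]} (hB : B1 k p ε a j = evMu k p a P)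
    (hdeg : P.degree < p) (hN : phiK k a (nIdx p ε a j) ∣ P)
    (hs : CondAC p a j → s = sIdx p a ∧ s ≤ nIdx p ε a j) (hs0 : ¬ CondAC p a j → s = 0)
    {z : Hyper k} (hz : z ∈ homog k 0) :
    Zmap k p ε a j z = frobS k p (2 * s) z * B1 k p ε a j := by
  unfold Zmap
  split_ifs with hc
  · obtain ⟨rfl, hsN⟩ := hs hc
    obtain ⟨c, hc0, he⟩ := exists_phiK_expansion a p hN hdeg
    set v : Fin p → Hyper k := fun m => mu k p a * (eY k 1 ^ (m : ℕ) * eX k 1 ^ (m : ℕ)) with hv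
    have hB' : B1 k p ε a j = Finsupp.linearCombination k v
        (Finsupp.equivFunOnFinite.symm fun m : Fin p => c m) := by
      rw [hB, he, map_sum, Finset.sum_range, Finsupp.linearCombination_apply,
        Finsupp.sum_fintype _ _ (by simp)]
      refine Finset.sum_congr rfl fun m _ => ?_
      rw [map_smul, evMu_phiK]; rfl
    have hcc : cCoef k p ε a j = Finsupp.equivFunOnFinite.symm fun m : Fin p => c m := by
      unfold cCoef
      rw [hB']
      have hinj : LinearMap.ker (Finsupp.linearCombination k v) = ⊥ :=
        LinearMap.ker_eq_bot.2 (linearIndependent_mu_mul (k := k) (p := p) a)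
      have := LinearMap.leftInverse_comp_of_inj hinj
      exact LinearMap.congr_fun this _
    have hterm : ∀ m : ℕ, sIdx p a ≤ m →
        eY k 1 ^ m * eX k 1 ^ (m - sIdx p a) * frob' k p z * eX k 1 ^ sIdx p a
          = frobS k p (2 * sIdx p a) z * (eY k 1 ^ m * eX k 1 ^ m) := by
      intro m hm
      obtain ⟨t, rfl⟩ := Nat.exists_eq_add_of_le hm
      have := eY_pow_mul_frob'_mul_eX_pow (eY_pow_mul_eX_pow_mem_Dr (k := k) (p := p) t)
        (sIdx p a) hz
      rw [Nat.add_sub_cancel_left, pow_add, pow_add, (Commute.pow_pow_self (eX k 1) _ _).eq]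
      simpa only [mul_assoc] using this
    rw [hcc, hB', Finsupp.linearCombination_apply, Finsupp.sum_fintype _ _ (by simp),
      Finset.mul_sum, Finset.mul_sum, Finset.sum_filter]
    refine Finset.sum_congr rfl fun m _ => ?_
    simp only [Finsupp.equivFunOnFinite_symm_apply_apply, hv]
    split_ifs with hm
    · rw [hterm m (hsN.trans hm), mul_smul_comm, mul_smul_comm, ← mul_assoc,
        mul_comm_of_mem_homog (mu_mem_homog a) (frobS_mem_homog _ hz), mul_assoc]
    · rw [hc0 m (by omega), zero_smul, mul_zero]
  · rw [hs0 hc, Nat.cast_zero, mul_zero, frobS_zero]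

end

/-! ### The polynomials attached to a pair, for odd `p` -/

section

variable (p : ℕ) [Fact p.Prime]

/-- The product of the `X - i²` over the residues `i ≠ ± J`. -/
noncomputable def psiRest (J : ZMod p) : (ZMod p)[X] :=
  ∏ i ∈ Finset.univ.filter (fun i : ZMod p => i ≠ J ∧ i ≠ -J), (X - C (i ^ 2))

variable {p}

theorem prod_X_sub_C_zmod : ∏ i : ZMod p, (X - C i) = (X ^ p - X : (ZMod p)[X]) := by
  have hp : 1 < p := (Fact.out : p.Prime).one_lt
  have hd := FiniteField.X_pow_card_sub_X_natDegree_eq (ZMod p) hp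
  have hr := FiniteField.roots_X_pow_card_sub_X (ZMod p)
  rw [ZMod.card] at hr
  have hm : (X ^ p - X : (ZMod p)[X]).Monic :=
    (monic_X_pow p).sub_of_left (by rw [degree_X, degree_X_pow]; exact_mod_cast hp)
  have := prod_multiset_X_sub_C_of_monic_of_roots_card_eq hm (by
    rw [hr, hd]; simp [ZMod.card])
  rw [hr] at this
  exact this

/-- Substitution of `x²` for `x` turns the left side into `∏ (x - i) (x + i) = (x ^ p - x)²`. -/
theorem prod_X_sub_C_sq {n : ℕ} (hn : p = 2 * n + 1) :
    ∏ i : ZMod p, (X - C (i ^ 2)) = (X * (X ^ n - 1) ^ 2 : (ZMod p)[X]) := by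
  apply Polynomial.expand_injective (R := ZMod p) (n := 2) (by norm_num)
  have h1 : ∏ i : ZMod p, (X + C i) = (X ^ p - X : (ZMod p)[X]) := by
    rw [← prod_X_sub_C_zmod, ← Equiv.prod_comp (Equiv.neg (ZMod p))]
    refine Finset.prod_congr rfl fun i _ => ?_
    rw [Equiv.neg_apply, C_neg, sub_eq_add_neg]
  rw [map_prod]
  have h2 : ∀ i : ZMod p, expand (ZMod p) 2 (X - C (i ^ 2)) = (X - C i) * (X + C i) := by
    intro i
    rw [map_sub, expand_X, expand_C, C_pow]; ring
  simp only [h2, Finset.prod_mul_distrib, h1, prod_X_sub_C_zmod]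
  simp only [map_mul, map_pow, map_sub, expand_X, map_one]
  have e : (X ^ p : (ZMod p)[X]) = X * (X ^ 2) ^ n := by rw [← pow_mul, ← pow_succ', ← hn]
  rw [e]; ring

theorem psiRest_zero_mul_X : psiRest p 0 * X = ∏ i : ZMod p, (X - C (i ^ 2)) := by
  rw [← Finset.prod_erase_mul _ _ (Finset.mem_univ (0 : ZMod p))]
  congr 1
  · refine Finset.prod_congr ?_ fun _ _ => rfl
    ext i; simp
  · simp

theorem psiRest_zero {n : ℕ} (hn : p = 2 * n + 1) : psiRest p 0 = (X ^ n - 1) ^ 2 := by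
  have h := psiRest_zero_mul_X (p := p)
  rw [prod_X_sub_C_sq hn, mul_comm] at h
  exact mul_left_cancel₀ X_ne_zero h

theorem two_ne_zero_zmod {n : ℕ} (hn : p = 2 * n + 1) : (2 : ZMod p) ≠ 0 := by
  have : ((2 : ℕ) : ZMod p) ≠ 0 := by
    rw [Ne, ZMod.natCast_eq_zero_iff]
    intro h
    have h1 := Nat.le_of_dvd two_pos h
    have h2 := (Fact.out : p.Prime).two_le
    omega
  exact_mod_cast this

theorem psiRest_mul_sq {n : ℕ} (hn : p = 2 * n + 1) {J : ZMod p} (hJ : J ≠ 0) :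
    psiRest p J * (X - C (J ^ 2)) ^ 2 = ∏ i : ZMod p, (X - C (i ^ 2)) := by
  have hJJ : J ≠ -J := by
    intro h
    have : 2 * J = 0 := by linear_combination h
    exact hJ ((mul_eq_zero.1 this).resolve_left (two_ne_zero_zmod hn))
  rw [← Finset.prod_erase_mul _ _ (Finset.mem_univ J),
    ← Finset.prod_erase_mul _ _ (Finset.mem_erase.2 ⟨hJJ.symm, Finset.mem_univ (-J)⟩), neg_sq,
    mul_assoc, ← sq]
  congr 1
  refine Finset.prod_congr ?_ fun _ _ => rfl
  ext i; simp [and_comm]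

theorem psiRest_eq_X_mul {J : ZMod p} (hJ : J ≠ 0) : psiRest p J
    = X * ∏ i ∈ Finset.univ.filter (fun i : ZMod p => i ≠ 0 ∧ i ≠ J ∧ i ≠ -J),
      (X - C (i ^ 2)) := by
  rw [psiRest, ← Finset.mul_prod_erase _ _ (a := (0 : ZMod p)) (by simp [hJ, hJ.symm])]
  congr 1
  · simp
  · refine Finset.prod_congr ?_ fun _ _ => rfl
    ext i; simp

theorem psiZero_eq {J : ZMod p} (hJ : J ≠ 0) :
    psiZero p J = psiRest p J * (2 * (X + C (J ^ 2))) := by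
  rw [psiZero, if_neg hJ, psiRest_eq_X_mul hJ]; ring

theorem psiZero_zero : psiZero p 0 = psiRest p 0 := by
  rw [psiZero, if_pos rfl, psiRest]
  refine Finset.prod_congr ?_ fun _ _ => rfl
  ext i; simp

theorem psiOne_eq {n : ℕ} (hn : p = 2 * n + 1) {J : ZMod p} (hJ : J ≠ 0) :
    psiOne p J = psiRest p J * (X - C (J ^ 2)) := by
  rw [psiOne, ← psiRest_mul_sq hn hJ, sq, ← mul_assoc, mul_comm,
    mul_divByMonic_cancel_left _ (monic_X_sub_C _)]

theorem psiOne_zero : psiOne p 0 = psiRest p 0 := by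
  have : (X - C ((0 : ZMod p) ^ 2)) = (X : (ZMod p)[X]) := by simp
  rw [psiOne, ← psiRest_zero_mul_X, this, mul_comm, mul_divByMonic_cancel_left _ monic_X]

/-- The factor `2 (X + J²)` in `psiZero` is the inverse of `psiRest` modulo `(X - J²)²`. -/
theorem sq_dvd_psiRest_mul_sub_one {n : ℕ} (hn : p = 2 * n + 1) {J : ZMod p} (hJ : J ≠ 0) :
    (X - C (J ^ 2)) ^ 2 ∣ psiRest p J * (2 * (X + C (J ^ 2))) - 1 := by
  have h2n : (2 * n : ZMod p) = -1 := by
    have : ((2 * n + 1 : ℕ) : ZMod p) = 0 := by rw [← hn]; exact CharP.cast_eq_zero _ _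
    push_cast at this
    linear_combination this
  have h2 := two_ne_zero_zmod hn
  have hc0 : J ^ 2 ≠ 0 := pow_ne_zero 2 hJ
  have hcn : (J ^ 2) ^ n = 1 := by
    rw [← pow_mul]
    have := ZMod.pow_card_sub_one_eq_one hJ
    rwa [show p - 1 = 2 * n by omega] at this
  generalize hc : J ^ 2 = c at *
  obtain ⟨S, hS⟩ : (X - C c) ∣ (X ^ n - 1 : (ZMod p)[X]) := dvd_iff_isRoot.2 (by simp [hcn])
  have hL : psiRest p J = X * S ^ 2 := by
    have h := psiRest_mul_sq hn hJ
    rw [prod_X_sub_C_sq hn, hS, hc] at h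
    refine mul_right_cancel₀ (pow_ne_zero 2 (X_sub_C_ne_zero c)) (h.trans ?_)
    ring
  -- differentiate `X ^ n - 1 = (X - c) S` to obtain the value and the derivative of `S` at `c`
  have hder : X * (S + (X - C c) * derivative S) = C (n : ZMod p) * ((X - C c) * S + 1) := by
    have h1 := congrArg derivative hS
    simp only [derivative_sub, derivative_X_pow, derivative_one, derivative_mul, derivative_X,
      derivative_C, sub_zero, one_mul] at h1
    rw [← h1, ← hS]
    rcases n with _ | m
    · simp
    · rw [Nat.add_sub_cancel]; ring
  have hS1 : c * S.eval c = n := by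
    have := congrArg (eval c) hder
    simpa using this
  have hS2 : 2 * c * (derivative S).eval c + S.eval c = n * S.eval c := by
    have := congrArg (eval c) (congrArg derivative hder)
    simp at this
    linear_combination this
  rw [hL]
  have hG0 : (X * S ^ 2 * (2 * (X + C c)) - 1).eval c = 0 := by
    simp
    linear_combination (4 * c * S.eval c + 4 * n) * hS1 + (2 * n - 1) * h2n
  obtain ⟨H, hH⟩ : (X - C c) ∣ X * S ^ 2 * (2 * (X + C c)) - 1 := dvd_iff_isRoot.2 hG0
  have hG1 : (derivative (X * S ^ 2 * (2 * (X + C c)) - 1)).eval c = 0 := by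
    have e : (derivative (X * S ^ 2 * (2 * (X + C c)) - 1)).eval c
        = c * S.eval c * (6 * S.eval c + 8 * c * (derivative S).eval c) := by
      simp [derivative_pow]
      ring
    rw [e]
    linear_combination (c * S.eval c) * (4 * hS2 + 2 * S.eval c * h2n)
  have hH0 : H.eval c = 0 := by
    rw [hH] at hG1
    simpa using hG1
  obtain ⟨K, hK⟩ : (X - C c) ∣ H := dvd_iff_isRoot.2 hH0
  exact ⟨K, by rw [hH, hK]; ring⟩

theorem prod_dvd_psiRest {J : ZMod p} {m : ℕ} {f : ℕ → ZMod p}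
    (hf : ∀ i < m, ∀ i' < m, f i = f i' → i = i') (hJ : ∀ i < m, f i ≠ J ∧ f i ≠ -J) :
    ∏ i ∈ Finset.range m, (X - C (f i ^ 2)) ∣ psiRest p J := by
  rw [← Finset.prod_image (g := f) (s := Finset.range m) (f := fun i => X - C (i ^ 2))
    (fun i hi i' hi' h => hf i (by simpa using hi) i' (by simpa using hi') h)]
  refine Finset.prod_dvd_prod_of_subset _ _ _ fun i hi => ?_
  obtain ⟨l, hl, rfl⟩ := Finset.mem_image.1 hi
  simpa using hJ l (Finset.mem_range.1 hl)

theorem natCast_inj_of_lt {i i' : ℕ} (hi : i < p) (hi' : i' < p)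
    (h : (i : ZMod p) = i') : i = i' := by
  rw [ZMod.natCast_eq_natCast_iff', Nat.mod_eq_of_lt hi, Nat.mod_eq_of_lt hi'] at h
  exact h

/-- The square of `(a + 1) / 2`, by which the variable is shifted. -/
noncomputable def halfSq (p : ℕ) [Fact p.Prime] (a : ℕ) : ZMod p := (((a : ZMod p) + 1) / 2) ^ 2

theorem phi_eq_comp {n : ℕ} (hn : p = 2 * n + 1) (a m : ℕ) : phi p a m
    = (∏ i ∈ Finset.range m, (X - C (((i : ZMod p) + ((a : ZMod p) + 1) / 2) ^ 2))).comp
      (X + C (halfSq p a)) := by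
  have h2 := two_ne_zero_zmod hn
  rw [phi, Polynomial.prod_comp]
  refine Finset.prod_congr rfl fun i _ => ?_
  rw [sub_comp, X_comp, C_comp, add_sub_assoc, ← C_sub, sub_eq_add_neg, ← C_neg, halfSq]
  congr 2
  field_simp
  ring

theorem prod_eq_comp {n : ℕ} (hn : p = 2 * n + 1) (a m : ℕ) :
    ∏ i ∈ Finset.range m, (X + C (((i : ZMod p) + 1) * (a - i)))
    = (∏ i ∈ Finset.range m, (X - C ((((a : ZMod p) + 1) / 2 - 1 - i) ^ 2))).comp
      (X + C (halfSq p a)) := by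
  have h2 := two_ne_zero_zmod hn
  rw [Polynomial.prod_comp]
  refine Finset.prod_congr rfl fun i _ => ?_
  rw [sub_comp, X_comp, C_comp, add_sub_assoc, ← C_sub, halfSq]
  congr 2
  field_simp
  ring

/-- For odd `p`, the polynomial `φ_{a,p}` is the shift of `∏ (x - i²)`, by completing the square in
`i (i + a + 1) = (i + (a + 1) / 2)² - ((a + 1) / 2)²`. -/
theorem phi_self_eq_comp {n : ℕ} (hn : p = 2 * n + 1) (a : ℕ) :
    phi p a p = (∏ i : ZMod p, (X - C (i ^ 2))).comp (X + C (halfSq p a)) := by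
  rw [phi_eq_comp hn]
  congr 1
  have hinj : Set.InjOn (fun i : ℕ => (i : ZMod p) + ((a : ZMod p) + 1) / 2)
      (Finset.range p : Set ℕ) := by
    intro i hi i' hi' h
    simp only [Finset.coe_range, Set.mem_Iio] at hi hi'
    exact natCast_inj_of_lt hi hi' (add_right_cancel h)
  have himg : (Finset.range p).image (fun i : ℕ => (i : ZMod p) + ((a : ZMod p) + 1) / 2)
      = Finset.univ := by
    rw [← Finset.card_eq_iff_eq_univ, Finset.card_image_of_injOn hinj, Finset.card_range,
      ZMod.card]
  rw [← himg, Finset.prod_image hinj]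

theorem eq_or_of_dvd {x : ℤ} (h : (p : ℤ) ∣ x) (h1 : -(2 * p) < x) (h2 : x < 2 * p) :
    x = 0 ∨ x = p ∨ x = -p := by
  obtain ⟨q, rfl⟩ := h
  have hp : (0 : ℤ) < p := by exact_mod_cast (Fact.out : p.Prime).pos
  have h3 : q < 2 := by nlinarith
  have h4 : -2 < q := by nlinarith
  obtain rfl | rfl | rfl : q = 0 ∨ q = 1 ∨ q = -1 := by omega
  · left; ring
  · right; left; ring
  · right; right; ring

/-- A criterion for a residue `u = x / 2` to differ from `± t`, by bounds on the integers `x ± 2 t`.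
-/
theorem ne_of_two_mul {n : ℕ} (hn : p = 2 * n + 1) {u : ZMod p} {x : ℤ} {t : ℕ}
    (hu : 2 * u = x) (h1 : -(2 * p) < x - 2 * t) (h2 : x + 2 * t < 2 * p)
    (h3 : ∀ y : ℤ, y = 0 ∨ y = p ∨ y = -p → x - 2 * t ≠ y ∧ x + 2 * t ≠ y) :
    u ≠ t ∧ u ≠ -t := by
  constructor
  · rintro rfl
    have : ((x - 2 * t : ℤ) : ZMod p) = 0 := by push_cast; rw [← hu]; ring
    rw [ZMod.intCast_zmod_eq_zero_iff_dvd] at this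
    exact (h3 _ (eq_or_of_dvd this h1 (by omega))).1 rfl
  · rintro rfl
    have : ((x + 2 * t : ℤ) : ZMod p) = 0 := by push_cast; rw [← hu]; ring
    rw [ZMod.intCast_zmod_eq_zero_iff_dvd] at this
    exact (h3 _ (eq_or_of_dvd this (by omega) h2)).2 rfl

theorem condAC_iff {n : ℕ} (hn : p = 2 * n + 1) {a t : ℕ} (ht : t ≤ n) :
    CondAC p a (t : ℚ) ↔ (Even a ∧ p + 1 ≤ a + 2 * t) ∨ (Odd a ∧ 2 * t + 1 ≤ a) := by
  unfold CondAC
  refine or_congr (and_congr_right fun _ => ?_) (and_congr_right fun _ => ?_)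
  · constructor
    · rintro ⟨h, -⟩
      have : ((p + 1 : ℕ) : ℚ) ≤ ((a + 2 * t : ℕ) : ℚ) := by push_cast; linarith
      exact_mod_cast this
    · intro h
      have h1 : ((p + 1 : ℕ) : ℚ) ≤ ((a + 2 * t : ℕ) : ℚ) := by exact_mod_cast h
      have h2 : ((2 * t + 1 : ℕ) : ℚ) ≤ (p : ℚ) := by exact_mod_cast (by omega)
      push_cast at h1 h2
      exact ⟨by linarith, by linarith⟩
  · constructor
    · rintro ⟨-, h⟩
      have : ((2 * t + 1 : ℕ) : ℚ) ≤ (a : ℚ) := by push_cast; linarith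
      exact_mod_cast this
    · intro h
      have h1 : ((2 * t + 1 : ℕ) : ℚ) ≤ (a : ℚ) := by exact_mod_cast h
      push_cast at h1
      exact ⟨by positivity, by linarith⟩

/-- Under (A) or (C), no `i + (a + 1) / 2` with `i < s(a, j)` is congruent to `± j`. -/
theorem phi_dvd_psiRest_comp {n : ℕ} (hn : p = 2 * n + 1) {a t : ℕ} (ha : a < p) (ht : t ≤ n)
    (h : CondAC p a (t : ℚ)) :
    phi p a (sIdx p a) ∣ (psiRest p (t : ZMod p)).comp (X + C (halfSq p a)) := by
  have h2 := two_ne_zero_zmod hn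
  rw [condAC_iff hn ht] at h
  have hp2 : p ≠ 2 := by omega
  have hs : sIdx p a ≤ p := by unfold sIdx; split_ifs <;> omega
  rw [phi_eq_comp hn, ← coe_compRingHom_apply, ← coe_compRingHom_apply]
  refine map_dvd (compRingHom _) (prod_dvd_psiRest
    (f := fun i : ℕ => (i : ZMod p) + ((a : ZMod p) + 1) / 2) (fun i hi i' hi' h => ?_)
    fun i hi => ?_)
  · exact natCast_inj_of_lt (hi.trans_le hs) (hi'.trans_le hs) (add_right_cancel h)
  · refine ne_of_two_mul hn (x := 2 * i + a + 1) ?_ ?_ ?_ ?_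
    · push_cast; field_simp; ring
    all_goals
      unfold sIdx at hi
      rw [if_neg hp2] at hi
      rcases h with ⟨he, h⟩ | ⟨ho, h⟩
    · rw [if_pos he] at hi; clear he; omega
    · clear hi ho; omega
    · rw [if_pos he] at hi; clear he; omega
    · rw [if_neg (Nat.not_even_iff_odd.2 ho)] at hi; clear ho; omega
    · rw [if_pos he] at hi
      obtain ⟨b, rfl⟩ := he
      have hi' : 2 * i + 2 * b + 1 ≤ p := by omega
      clear hi
      rintro y (rfl | rfl | rfl) <;> constructor <;> omega
    · rw [if_neg (Nat.not_even_iff_odd.2 ho)] at hi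
      obtain ⟨b, rfl⟩ := ho
      have hi' : 2 * i + 2 * b + 3 ≤ p := by omega
      clear hi
      rintro y (rfl | rfl | rfl) <;> constructor <;> omega

/-- If neither (A) nor (C) holds, no `(a + 1) / 2 - 1 - i` with `i < a` is congruent to `± j`. -/
theorem prod_dvd_psiRest_comp {n : ℕ} (hn : p = 2 * n + 1) {a t : ℕ} (ha : a < p) (ht : t ≤ n)
    (h : ¬ CondAC p a (t : ℚ)) :
    ∏ i ∈ Finset.range a, (X + C (((i : ZMod p) + 1) * (a - i)))
      ∣ (psiRest p (t : ZMod p)).comp (X + C (halfSq p a)) := by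
  have h2 := two_ne_zero_zmod hn
  rw [condAC_iff hn ht] at h
  suffices hd : ∏ i ∈ Finset.range a, (X - C ((((a : ZMod p) + 1) / 2 - 1 - i) ^ 2))
      ∣ psiRest p (t : ZMod p) by
    obtain ⟨K, hK⟩ := hd
    exact ⟨K.comp (X + C (halfSq p a)), by rw [prod_eq_comp hn, hK, mul_comp]⟩
  refine prod_dvd_psiRest (f := fun i : ℕ => ((a : ZMod p) + 1) / 2 - 1 - (i : ZMod p))
    (fun i hi i' hi' h => ?_) fun i hi => ?_
  · exact natCast_inj_of_lt (hi.trans ha) (hi'.trans ha) (by simpa using h)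
  · refine ne_of_two_mul hn (x := a - 1 - 2 * i) ?_ ?_ ?_ ?_
    · push_cast; field_simp; ring
    all_goals
      rcases Nat.even_or_odd a with he | ho
    · have h3 : a + 2 * t < p + 1 := by
        by_contra hc; exact h (Or.inl ⟨he, not_lt.1 hc⟩)
      clear h he; omega
    · clear h ho; omega
    · have h3 : a + 2 * t < p + 1 := by
        by_contra hc; exact h (Or.inl ⟨he, not_lt.1 hc⟩)
      clear h he; omega
    · clear h ho; omega
    · have h3 : a + 2 * t < p + 1 := by
        by_contra hc; exact h (Or.inl ⟨he, not_lt.1 hc⟩)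
      clear h
      obtain ⟨b, rfl⟩ := he
      rintro y (rfl | rfl | rfl) <;> constructor <;> omega
    · have h3 : a < 2 * t + 1 := by
        by_contra hc; exact h (Or.inr ⟨ho, not_lt.1 hc⟩)
      clear h
      obtain ⟨b, rfl⟩ := ho
      rintro y (rfl | rfl | rfl) <;> constructor <;> omega

end

/-! ### The elements `B^{(ε)}(a, j)` -/

/-- Nondegeneracy of a pair `(a, j)`. -/
def Nondeg (p a : ℕ) (j : ℚ) : Prop := if p = 2 then a ≠ 1 else j ≠ 0

section

variable {k : Type*} [Field k] {p : ℕ} [Fact p.Prime] [CharP k p]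

theorem psiRest_comp_dvd_psiShift {n : ℕ} (hn : p = 2 * n + 1) (ε : Fin 2) (a t : ℕ) :
    (psiRest p (t : ZMod p)).comp (X + C (halfSq p a)) ∣ psiShift p ε a (t : ℚ) := by
  have key : psiRest p (t : ZMod p) ∣
      (if ε = 0 then psiZero p ((t : ℚ) : ZMod p) else psiOne p ((t : ℚ) : ZMod p)) := by
    rw [Rat.cast_natCast]
    by_cases ht : (t : ZMod p) = 0
    · rw [ht, psiZero_zero, psiOne_zero, ite_self]
    · rw [psiZero_eq ht, psiOne_eq hn ht]
      split_ifs
      · exact dvd_mul_right _ _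
      · exact dvd_mul_right _ _
  obtain ⟨K, hK⟩ := key
  refine ⟨K.comp (X + C (halfSq p a)), ?_⟩
  rw [psiShift, hK, mul_comp]; rfl

theorem map_prod_eq_phiOp (a m : ℕ) :
    (∏ i ∈ Finset.range m, (X + C (((i : ZMod p) + 1) * ((a : ZMod p) - i)))).map
      (ZMod.castHom (dvd_refl p) k) = phiOp k a m := by
  rw [phiOp, Polynomial.map_prod]
  refine Finset.prod_congr rfl fun i _ => ?_
  simp

/-- The set in the definition of `nIdx` is nonempty and bounded, so that its supremum is a maximum.
-/
theorem nIdx_spec (hp : p ≠ 2) {ε : Fin 2} {a : ℕ} {j : ℚ} (h0 : psiShift p ε a j ≠ 0) :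
    phi p a (nIdx p ε a j) ∣ psiShift p ε a j ∧
      ∀ m, phi p a m ∣ psiShift p ε a j → m ≤ nIdx p ε a j := by
  have hdeg : ∀ m, (phi p a m).natDegree = m := by
    intro m
    rw [phi, natDegree_prod_of_monic _ _ fun _ _ => monic_X_sub_C _]
    simp only [natDegree_X_sub_C, Finset.sum_const, Finset.card_range, smul_eq_mul, mul_one]
  have hbdd : BddAbove {n : ℕ | phi p a n ∣ psiShift p ε a j} :=
    ⟨(psiShift p ε a j).natDegree, fun m hm => by
      have := natDegree_le_of_dvd hm h0
      rwa [hdeg] at this⟩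
  rw [nIdx, if_neg hp]
  exact ⟨Nat.sSup_mem ⟨0, by simp [phi]⟩ hbdd, fun m hm => le_csSup hbdd hm⟩

theorem exists_isStep_odd {n : ℕ} (hn : p = 2 * n + 1) {a t : ℕ} (ha : a < p) (ht : t ≤ n) :
    ∃ s : ℕ, IsStep k p a (2 * s) (Nondeg p a t) (fun ε => B1 k p ε a t) ∧
      ∀ ε z, z ∈ homog k 0 → Zmap k p ε a t z = frobS k p (2 * s) z * B1 k p ε a t := by
  classical
  have hp2 : p ≠ 2 := by omega
  set ι := ZMod.castHom (dvd_refl p) k with hι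
  set Φ : (ZMod p)[X] →+* k[X] := (mapRingHom ι).comp (compRingHom (X + C (halfSq p a))) with hΦ
  have hΦa : ∀ P, Φ P = (P.comp (X + C (halfSq p a))).map ι := fun P => rfl
  set s : ℕ := if CondAC p a (t : ℚ) then sIdx p a else 0 with hs
  set P : Fin 2 → k[X] := fun ε => (psiShift p ε a (t : ℚ)).map ι with hP
  have hP0 : P 0 = Φ (psiZero p (t : ZMod p)) := by
    rw [hΦa, hP]; simp only [psiShift, if_true, Rat.cast_natCast]; rfl
  have hP1 : P 1 = Φ (psiOne p (t : ZMod p)) := by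
    rw [hΦa, hP]; simp only [psiShift, Rat.cast_natCast]; rfl
  have hB : ∀ ε, B1 k p ε a t = evMu k p a (P ε) := by
    intro ε; rw [B1, if_neg hp2, evMu_apply]
  have hφ : phiK k a p = Φ (∏ i : ZMod p, (X - C (i ^ 2))) := by
    rw [← map_phi (p := p), phi_self_eq_comp hn, hΦa]
  have hX : ∀ c : ZMod p, Φ (X - C c) = X - C (ι (c - halfSq p a)) := by
    intro c
    have e : (X - C c).comp (X + C (halfSq p a)) = X - C (c - halfSq p a) := by
      rw [sub_comp, X_comp, C_comp, C_sub]; ring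
    rw [hΦa, e, Polynomial.map_sub, map_X, map_C]
  have hdR : ∀ ε, Φ (psiRest p (t : ZMod p)) ∣ P ε := fun ε =>
    Polynomial.map_dvd ι (psiRest_comp_dvd_psiShift hn ε a t)
  have hcases : (s = 0 ∧ phiOp k a a ∣ P 0) ∨
      (0 < s ∧ (a + 2 * s = p ∨ a + 2 * s = p + 1) ∧ phiK k a s ∣ P 0) := by
    by_cases hc : CondAC p a (t : ℚ)
    · right
      have hs' : s = sIdx p a := by rw [hs, if_pos hc]
      have hnum : 0 < sIdx p a ∧ (a + 2 * sIdx p a = p ∨ a + 2 * sIdx p a = p + 1) := by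
        rw [sIdx, if_neg hp2]
        split_ifs with he
        · obtain ⟨b, rfl⟩ := he
          clear * - ha hn
          omega
        · obtain ⟨b, rfl⟩ := Nat.not_even_iff_odd.1 he
          clear * - ha hn
          omega
      rw [hs']
      refine ⟨hnum.1, hnum.2, dvd_trans ?_ (hdR 0)⟩
      rw [← map_phi (p := p), hΦa]
      exact Polynomial.map_dvd ι (phi_dvd_psiRest_comp hn ha ht hc)
    · left
      refine ⟨by rw [hs, if_neg hc], dvd_trans ?_ (hdR 0)⟩
      rw [← map_prod_eq_phiOp (p := p), hΦa]
      exact Polynomial.map_dvd ι (prod_dvd_psiRest_comp hn ha ht hc)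
  have htt : (t : ZMod p) = 0 ↔ t = 0 := by
    rw [ZMod.natCast_eq_zero_iff]
    exact ⟨fun h => Nat.eq_zero_of_dvd_of_lt h (by omega), fun h => h ▸ dvd_zero _⟩
  have hnd : Nondeg p a t ↔ t ≠ 0 := by
    rw [Nondeg, if_neg hp2, Ne, Nat.cast_eq_zero]
  have hmain : ((∀ ε, (P ε).degree < p) ∧
      IsStep k p a (2 * s) (Nondeg p a t) (fun ε => evMu k p a (P ε))) ∧ ∀ ε, P ε ≠ 0 := by
    by_cases h0 : t = 0
    · have hz : (t : ZMod p) = 0 := htt.2 h0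
      have hPL : ∀ ε, P ε = Φ (psiRest p 0) := by
        intro ε
        fin_cases ε
        · exact hP0.trans (by rw [hz, psiZero_zero])
        · exact hP1.trans (by rw [hz, psiOne_zero])
      have hval : (Φ (psiRest p 0)).eval (ι (0 - halfSq p a)) = 1 := by
        have hn0 : n ≠ 0 := by
          rintro rfl
          exact (Fact.out : p.Prime).ne_one (by omega)
        rw [hΦa, psiRest_zero hn, eval_map, eval₂_hom]
        simp [hn0]
      have hφ' : phiK k a p = Φ (psiRest p 0) * (X - C (ι (0 - halfSq p a))) := by
        rw [hφ, ← psiRest_zero_mul_X, map_mul, ← hX, C_0, sub_zero]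
      have := isStep_of_simple_root ha (fun h => hnd.1 h h0) hPL hφ' hval hcases
      refine ⟨this, fun ε hε => ?_⟩
      rw [← hPL ε, hε] at hval
      simp at hval
    · have hz : (t : ZMod p) ≠ 0 := fun h => h0 (htt.1 h)
      have hφ' : phiK k a p = Φ (psiRest p (t : ZMod p))
          * (X - C (ι ((t : ZMod p) ^ 2 - halfSq p a))) ^ 2 := by
        rw [hφ, ← psiRest_mul_sq hn hz, map_mul, map_pow, hX]
      have hLU : (X - C (ι ((t : ZMod p) ^ 2 - halfSq p a))) ^ 2 ∣
          Φ (psiRest p (t : ZMod p)) * Φ (2 * (X + C ((t : ZMod p) ^ 2))) - 1 := by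
        rw [← hX, ← map_pow, ← map_mul, ← map_one Φ, ← map_sub]
        exact map_dvd Φ (sq_dvd_psiRest_mul_sub_one hn hz)
      have hU : (Φ (2 * (X + C ((t : ZMod p) ^ 2)))).natDegree ≤ 1 := by
        have e : (2 * (X + C ((t : ZMod p) ^ 2))).comp (X + C (halfSq p a))
            = C 2 * (X + C (halfSq p a + (t : ZMod p) ^ 2)) := by
          rw [mul_comp, add_comp, X_comp, C_comp, C_add, add_assoc]
          congr 1
          exact C_comp (R := ZMod p) (a := 2)
        rw [hΦa, e]
        refine natDegree_map_le.trans ((natDegree_C_mul_le _ _).trans ?_)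
        rw [natDegree_X_add_C]
      have := isStep_of_double_root ha (hnd.2 h0) (hP0.trans (by rw [psiZero_eq hz, map_mul]))
        (hP1.trans (by rw [psiOne_eq hn hz, map_mul, hX])) hφ' hU hLU hcases
      refine ⟨this, fun ε hε => ?_⟩
      fin_cases ε
      · exact this.2.zero_ne (by rw [show P 0 = 0 from hε, map_zero])
      · exact this.2.one_ne (hnd.2 h0)
          (by rw [show P 1 = 0 from hε, map_zero])
  obtain ⟨⟨hdeg, hstep⟩, hne⟩ := hmain
  refine ⟨s, ?_, fun ε z hz => ?_⟩
  · simpa only [hB] using hstep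
  · have hsh : psiShift p ε a (t : ℚ) ≠ 0 := by
      intro h
      apply hne ε
      rw [hP]; simp only [h, Polynomial.map_zero]
    obtain ⟨h1, h2⟩ := nIdx_spec hp2 hsh
    refine Zmap_eq (hB ε) (hdeg ε) ?_ (fun hc => ⟨by rw [hs, if_pos hc], ?_⟩)
      (fun hc => by rw [hs, if_neg hc]) hz
    · rw [← map_phi (p := p)]
      exact Polynomial.map_dvd ι h1
    · rw [hs, if_pos hc]
      exact h2 _ ((phi_dvd_psiRest_comp hn ha ht hc).trans (psiRest_comp_dvd_psiShift hn ε a t))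

section Two

variable [CharP k 2]

theorem C_two_eq_zero : (C 2 : k[X]) = 0 := by
  have : (2 : k) = 0 := by exact_mod_cast CharP.cast_eq_zero k 2
  rw [this, C_0]

theorem phiK_zero_two : phiK k 0 2 = X ^ 2 := by
  have h := C_two_eq_zero (k := k)
  simp only [phiK, Finset.prod_range_succ, Finset.prod_range_zero]
  have e : ((1 : ℕ) : k) * ((1 : ℕ) + (0 : ℕ) + 1) = 2 := by push_cast; ring
  rw [e, h]; simp [sq]

theorem phiK_one_two : phiK k 1 2 = X * (X - C 1) := by
  have h : (2 : k) = 0 := by exact_mod_cast CharP.cast_eq_zero k 2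
  simp only [phiK, Finset.prod_range_succ, Finset.prod_range_zero]
  have e : ((1 : ℕ) : k) * ((1 : ℕ) + (1 : ℕ) + 1) = 1 := by
    push_cast; linear_combination h
  rw [e]; simp

/-- The pair `(0, 1 / 2)` for `p = 2`, with `φ_{0,2} = x²`. -/
theorem isStep_zero_half :
    IsStep k 2 (0 : ℕ) (2 * (0 : ℕ)) (Nondeg 2 0 (1 / 2)) (fun ε => B1 k 2 ε 0 (1 / 2)) ∧
      ∀ ε z, z ∈ homog k 0 →
        Zmap k 2 ε 0 (1 / 2) z = frobS k 2 (2 * (0 : ℕ)) z * B1 k 2 ε 0 (1 / 2) := by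
  set P : Fin 2 → k[X] := fun ε => if ε = 0 then 1 else X with hP
  have hB : ∀ ε, B1 k 2 ε 0 (1 / 2) = evMu k 2 0 (P ε) := by
    intro ε
    fin_cases ε
    · simp [B1, hP, evMu_one]
    · simp [B1, hP, evMu_X, mul_assoc]
  have hC : ¬ CondAC 2 0 (1 / 2) := by
    unfold CondAC; norm_num
  have hs := isStep_of_double_root (k := k) (p := 2) (a := 0) (s := 0) (nd := Nondeg 2 0 (1 / 2))
    two_pos (by simp [Nondeg]) (P := P) (L := 1) (U := 1) (d := 0) (by simp [hP]) (by simp [hP])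
    (by rw [phiK_zero_two]; simp) (by simp) (by simp) (Or.inl ⟨rfl, by simp [phiOp]⟩)
  refine ⟨by simpa only [hB] using hs.2, fun ε z hz => ?_⟩
  refine Zmap_eq (hB ε) (hs.1 ε) ?_ (fun h => absurd h hC) (fun _ => rfl) hz
  fin_cases ε
  · simp [nIdx, phiK]
  · simp [nIdx, phiK, hP]

/-- The pair `(1, 0)` for `p = 2`, belonging to the root `1` of `φ_{1,2} = x (x - 1)`. Condition (C)
holds, and `s = 1`. -/
theorem isStep_one_zero :
    IsStep k 2 (1 : ℕ) (2 * (1 : ℕ)) (Nondeg 2 1 0) (fun ε => B1 k 2 ε 1 0) ∧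
      ∀ ε z, z ∈ homog k 0 → Zmap k 2 ε 1 0 z = frobS k 2 (2 * (1 : ℕ)) z * B1 k 2 ε 1 0 := by
  have hB : ∀ ε, B1 k 2 ε 1 0 = evMu k 2 1 X := by
    intro ε
    simp [B1, evMu_X, mul_assoc]
  have hs := isStep_of_simple_root (k := k) (p := 2) (a := 1) (s := 1) (nd := Nondeg 2 1 0)
    one_lt_two (by simp [Nondeg]) (P := fun _ => X) (L := X) (d := 1) (fun _ => rfl)
    phiK_one_two (by simp) (Or.inr ⟨one_pos, Or.inr rfl, by simp [phiK]⟩)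
  refine ⟨by simpa only [hB] using hs.2, fun ε z hz => ?_⟩
  refine Zmap_eq (hB ε) (hs.1 ε) ?_ (fun h => ?_) (fun h => absurd ?_ h) hz
  · simp [nIdx, phiK]
  · simp [sIdx, nIdx]
  · unfold CondAC; norm_num

/-- The pair `(1, 1)` for `p = 2`, belonging to the root `0` of `φ_{1,2} = x (x - 1)`. -/
theorem isStep_one_one :
    IsStep k 2 (1 : ℕ) (2 * (0 : ℕ)) (Nondeg 2 1 1) (fun ε => B1 k 2 ε 1 1) ∧
      ∀ ε z, z ∈ homog k 0 → Zmap k 2 ε 1 1 z = frobS k 2 (2 * (0 : ℕ)) z * B1 k 2 ε 1 1 := by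
  have hB : ∀ ε, B1 k 2 ε 1 1 = evMu k 2 1 (X + 1) := by
    intro ε
    simp [B1, evMu_X, evMu_one, mul_assoc]
  have hC : ¬ CondAC 2 1 1 := by
    unfold CondAC; norm_num
  have hX : (X + 1 : k[X]) = X - C 1 := by
    have h := C_two_eq_zero (k := k)
    have h2 : (2 : k[X]) = 0 := (map_ofNat C 2).symm.trans h
    rw [C_1]; linear_combination h2
  have hs := isStep_of_simple_root (k := k) (p := 2) (a := 1) (s := 0) (nd := Nondeg 2 1 1)
    one_lt_two (by simp [Nondeg]) (P := fun _ => X + 1) (L := X + 1) (d := 0) (fun _ => rfl)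
    (by rw [phiK_one_two, hX]; simp [mul_comm]) (by simp) (Or.inl ⟨rfl, by simp [phiOp]⟩)
  refine ⟨by simpa only [hB] using hs.2, fun ε z hz => ?_⟩
  refine Zmap_eq (hB ε) (hs.1 ε) ?_ (fun h => absurd h hC) (fun _ => rfl) hz
  simp [nIdx, phiK]

end Two

theorem exists_isStep {a : ℕ} {j : ℚ} (h : (a, j) ∈ pairs p) :
    ∃ s : ℕ, IsStep k p a (2 * s) (Nondeg p a j) (fun ε => B1 k p ε a j) ∧
      ∀ ε z, z ∈ homog k 0 → Zmap k p ε a j z = frobS k p (2 * s) z * B1 k p ε a j := by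
  unfold pairs at h
  split_ifs at h with hp
  · subst hp
    rcases h with h | h | h
    · obtain ⟨rfl, rfl⟩ := Prod.mk.inj h
      exact ⟨0, isStep_zero_half⟩
    · obtain ⟨rfl, rfl⟩ := Prod.mk.inj h
      exact ⟨1, isStep_one_zero⟩
    · obtain ⟨rfl, rfl⟩ := Prod.mk.inj h
      exact ⟨0, isStep_one_one⟩
  · obtain ⟨ha, t, ht, rfl⟩ := h
    obtain ⟨n, hn⟩ := (Fact.out : p.Prime).odd_of_ne_two hp
    exact exists_isStep_odd hn ha (by omega)

/-- The weight of the block is made up of the `a i` by recursion; only its existence matters. -/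
theorem exists_isBlock : ∀ (r : ℕ) (a : Fin r → ℕ) (j : Fin r → ℚ),
    (∀ i, (a i, j i) ∈ pairs p) →
    ∃ b, IsBlock k p r b (fun i => Nondeg p (a i) (j i)) (fun ε => Bvec k p r ε a j)
  | 0, _, _, _ => ⟨0, isBlock_zero _⟩
  | 1, a, j, h => by
    obtain ⟨s, hs, -⟩ := exists_isStep (k := k) (h 0)
    have := IsBlock.succ (nd := fun i => Nondeg p (a i) (j i)) hs (isBlock_zero _)
    refine ⟨a 0 + p * (0 - (a 0 + 2 * s) / p), ?_⟩
    simp only [frobS_one, one_mul] at this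
    exact this
  | r + 2, a, j, h => by
    obtain ⟨s, hs, hZ⟩ := exists_isStep (k := k) (h 0)
    obtain ⟨b, hb⟩ := exists_isBlock (r + 1) (fun i => a i.succ) (fun i => j i.succ)
      (fun i => h i.succ)
    have := IsBlock.succ (nd := fun i => Nondeg p (a i) (j i)) hs hb
    refine ⟨a 0 + p * (b - (a 0 + 2 * s) / p), ?_⟩
    convert this using 2 with ε
    exact hZ _ _ (Dr_le_homog _ (hb.mem _))

end

/-! ### Modules over commutative algebras with a cube-shaped basis -/

section Cube

variable {k H ι : Type*} [Field k] [Ring H] [Algebra k H] [DecidableEq ι]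

/-- A family `b` of elements of the commutative algebra `A`, indexed by the subsets `T` of the
finite set `S`, which multiplies like the square-free monomials in variables of square zero (up to
the fact that `b ∅` is only an idempotent), and whose span is the ideal generated by `b ∅`. -/
structure IsCube (A : Subalgebra k H) (S : Finset ι) (b : Finset ι → H) : Prop where
  comm : ∀ u ∈ A, ∀ v ∈ A, u * v = v * u
  mem : ∀ T ⊆ S, b T ∈ A
  mul_of_disjoint : ∀ T ⊆ S, ∀ T' ⊆ S, Disjoint T T' → b T * b T' = b (T ∪ T')
  mul_eq_zero : ∀ T ⊆ S, ∀ T' ⊆ S, ¬ Disjoint T T' → b T * b T' = 0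
  ne_zero : b S ≠ 0
  mem_span : ∀ u ∈ A, u * b ∅ ∈ Submodule.span k {x | ∃ T ⊆ S, x = b T}

variable (k) in
/-- The span of the `b T'` with `T ⊆ T' ⊆ S` and `T' \ T` of size at least `n`. -/
def cubeFilt (S : Finset ι) (b : Finset ι → H) (n : ℕ) (T : Finset ι) : Submodule k H :=
  Submodule.span k {x | ∃ T' ⊆ S, n ≤ (T' \ T).card ∧ T ⊆ T' ∧ x = b T'}

variable {A : Subalgebra k H} {S : Finset ι} {b : Finset ι → H}

theorem mem_cubeFilt {n : ℕ} {T T' : Finset ι} (h1 : T' ⊆ S) (h2 : n ≤ (T' \ T).card)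
    (h3 : T ⊆ T') : b T' ∈ cubeFilt k S b n T := Submodule.subset_span ⟨T', h1, h2, h3, rfl⟩

theorem cubeFilt_anti {m n : ℕ} (h : m ≤ n) (T : Finset ι) :
    cubeFilt k S b n T ≤ cubeFilt k S b m T :=
  Submodule.span_mono fun _ ⟨T', h1, h2, h3, h4⟩ => ⟨T', h1, h.trans h2, h3, h4⟩

theorem cubeFilt_eq_bot {n : ℕ} {T : Finset ι} (h : (S \ T).card < n) :
    cubeFilt k S b n T = ⊥ := by
  rw [cubeFilt, Submodule.span_eq_bot]
  rintro x ⟨T', h1, h2, -, -⟩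
  have := Finset.card_le_card (Finset.sdiff_subset_sdiff h1 (le_refl T))
  omega

namespace IsCube

variable (hb : IsCube A S b)
include hb

theorem empty_mul {T : Finset ι} (hT : T ⊆ S) : b ∅ * b T = b T := by
  rw [hb.mul_of_disjoint _ (Finset.empty_subset S) _ hT (Finset.disjoint_empty_left T),
    Finset.empty_union]

theorem ne_zero_of_subset {T : Finset ι} (hT : T ⊆ S) : b T ≠ 0 := by
  intro h
  have := hb.mul_of_disjoint T hT (S \ T) Finset.sdiff_subset Finset.disjoint_sdiff
  rw [h, zero_mul, Finset.union_sdiff_of_subset hT] at this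
  exact hb.ne_zero this.symm

/-- Every element of `A` acts on the `b T` by a scalar, up to terms deeper in the filtration. -/
theorem exists_residue {u : H} (hu : u ∈ A) :
    ∃ c : k, u * b ∅ - c • b ∅ ∈ cubeFilt k S b 1 ∅ := by
  have hu' := hb.mem_span u hu
  generalize u * b ∅ = w at hu' ⊢
  induction hu' using Submodule.span_induction with
  | mem x hx =>
    obtain ⟨T, hT, rfl⟩ := hx
    by_cases h : T = ∅
    · exact ⟨1, by rw [h, one_smul, sub_self]; exact zero_mem _⟩
    · refine ⟨0, ?_⟩
      rw [zero_smul, sub_zero]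
      refine mem_cubeFilt hT ?_ (Finset.empty_subset T)
      rw [Finset.sdiff_empty]
      exact Finset.card_pos.2 (Finset.nonempty_iff_ne_empty.2 h)
  | zero => exact ⟨0, by simp⟩
  | add x y _ _ h1 h2 =>
    obtain ⟨c, hc⟩ := h1
    obtain ⟨d, hd⟩ := h2
    refine ⟨c + d, ?_⟩
    rw [add_smul, add_sub_add_comm]
    exact add_mem hc hd
  | smul e x _ h =>
    obtain ⟨c, hc⟩ := h
    refine ⟨e * c, ?_⟩
    rw [mul_smul, ← smul_sub]
    exact Submodule.smul_mem _ _ hc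

/-- The filtrations are compatible with multiplication. -/
theorem mul_mem_cubeFilt {m n : ℕ} {T : Finset ι} {u v : H}
    (hu : u ∈ cubeFilt k S b m ∅) (hv : v ∈ cubeFilt k S b n T) :
    u * v ∈ cubeFilt k S b (m + n) T := by
  unfold cubeFilt at hu hv
  induction hu using Submodule.span_induction with
  | zero => rw [zero_mul]; exact zero_mem _
  | add x y _ _ h1 h2 => rw [add_mul]; exact add_mem h1 h2
  | smul c x _ h => rw [smul_mul_assoc]; exact Submodule.smul_mem _ _ h
  | mem x hx =>
    obtain ⟨U, hU, hm, -, rfl⟩ := hx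
    induction hv using Submodule.span_induction with
    | zero => rw [mul_zero]; exact zero_mem _
    | add x y _ _ h1 h2 => rw [mul_add]; exact add_mem h1 h2
    | smul c x _ h => rw [mul_smul_comm]; exact Submodule.smul_mem _ _ h
    | mem y hy =>
      obtain ⟨T', hT', hn, hTT', rfl⟩ := hy
      by_cases hd : Disjoint U T'
      · rw [hb.mul_of_disjoint U hU T' hT' hd]
        refine mem_cubeFilt (Finset.union_subset hU hT') ?_
          (hTT'.trans Finset.subset_union_right)
        have h1 : (U ∪ T') \ T = U ∪ (T' \ T) := by
          rw [Finset.union_sdiff_distrib, Finset.sdiff_eq_self_of_disjoint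
            (Finset.disjoint_of_subset_right hTT' hd)]
        rw [h1, Finset.card_union_of_disjoint
          (Finset.disjoint_of_subset_right Finset.sdiff_subset hd)]
        rw [Finset.sdiff_empty] at hm
        omega
      · rw [hb.mul_eq_zero U hU T' hT' hd]; exact zero_mem _

theorem empty_mul_of_mem {n : ℕ} {T : Finset ι} {v : H} (hv : v ∈ cubeFilt k S b n T) :
    b ∅ * v = v := by
  unfold cubeFilt at hv
  induction hv using Submodule.span_induction with
  | zero => rw [mul_zero]
  | add x y _ _ h1 h2 => rw [mul_add, h1, h2]
  | smul c x _ h => rw [mul_smul_comm, h]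
  | mem y hy =>
    obtain ⟨T', hT', -, -, rfl⟩ := hy
    exact hb.empty_mul hT'

theorem mem_of_mem_cubeFilt {n : ℕ} {T : Finset ι} {v : H} (hv : v ∈ cubeFilt k S b n T) :
    v ∈ A := by
  have : cubeFilt k S b n T ≤ Subalgebra.toSubmodule A := by
    refine Submodule.span_le.2 ?_
    rintro x ⟨T', hT', -, -, rfl⟩
    exact hb.mem T' hT'
  exact this hv

theorem exists_residue_mul {u : H} (hu : u ∈ A) : ∃ c : k, ∀ (n : ℕ) (T : Finset ι) (v : H),
    v ∈ cubeFilt k S b n T → u * v - c • v ∈ cubeFilt k S b (n + 1) T := by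
  obtain ⟨c, hc⟩ := hb.exists_residue hu
  refine ⟨c, fun n T v hv => ?_⟩
  have := hb.mul_mem_cubeFilt hc hv
  rwa [sub_mul, smul_mul_assoc, mul_assoc, hb.empty_mul_of_mem hv, add_comm 1 n] at this

theorem mul_mem_of_mem {u : H} (hu : u ∈ A) {n : ℕ} {T : Finset ι} {v : H}
    (hv : v ∈ cubeFilt k S b n T) : u * v ∈ cubeFilt k S b n T := by
  obtain ⟨c, hc⟩ := hb.exists_residue_mul hu
  have h1 := cubeFilt_anti (Nat.le_succ n) T (hc n T v hv)
  have h2 := add_mem h1 (Submodule.smul_mem _ c hv)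
  rwa [sub_add_cancel] at h2

omit hb in
theorem mem_cubeFilt_top {v : H} : v ∈ cubeFilt k S b 0 S ↔ ∃ c : k, v = c • b S := by
  have : cubeFilt k S b 0 S = Submodule.span k {b S} := by
    unfold cubeFilt
    congr 1
    ext x
    constructor
    · rintro ⟨T', h1, -, h2, rfl⟩
      rw [h1.antisymm h2]; rfl
    · rintro rfl
      exact ⟨S, subset_rfl, Nat.zero_le _, subset_rfl, rfl⟩
  rw [this, Submodule.mem_span_singleton]
  exact ⟨fun ⟨c, hc⟩ => ⟨c, hc.symm⟩, fun ⟨c, hc⟩ => ⟨c, hc.symm⟩⟩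

theorem mem_span_iff {T : Finset ι} (hT : T ⊆ S) {v : H} :
    v ∈ Submodule.span A {b T} ↔ v ∈ cubeFilt k S b 0 T := by
  constructor
  · intro hv
    obtain ⟨u, rfl⟩ := Submodule.mem_span_singleton.1 hv
    exact hb.mul_mem_of_mem u.2 (mem_cubeFilt hT (Nat.zero_le _) subset_rfl)
  · intro hv
    unfold cubeFilt at hv
    induction hv using Submodule.span_induction with
    | zero => exact zero_mem _
    | add x y _ _ h1 h2 => exact add_mem h1 h2
    | smul c x _ h =>
      have := Submodule.smul_mem _ (algebraMap k A c) h
      rwa [algebraMap_smul] at this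
    | mem y hy =>
      obtain ⟨T', hT', -, h, rfl⟩ := hy
      rw [← Finset.sdiff_union_of_subset h, ← hb.mul_of_disjoint _
        (Finset.sdiff_subset.trans hT') _ hT Finset.sdiff_disjoint]
      exact Submodule.smul_mem _ (⟨b (T' \ T), hb.mem _ (Finset.sdiff_subset.trans hT')⟩ : A)
        (Submodule.mem_span_singleton_self _)

/-! #### The radical filtration -/

/-- `A` acts on `b S` by scalars, and a nonzero scalar would contradict the invertibility of `1 - y
x` for all `y`. -/
theorem mul_eq_zero_of_mem_jacobson {x : A} (hx : x ∈ Ring.jacobson A) : (x : H) * b S = 0 := by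
  rw [← Ideal.jacobson_bot, Ideal.mem_jacobson_iff] at hx
  obtain ⟨c, hc⟩ := hb.exists_residue_mul x.2
  have h1 := hc 0 S (b S) (mem_cubeFilt subset_rfl (Nat.zero_le _) subset_rfl)
  rw [cubeFilt_eq_bot (by simp), Submodule.mem_bot, sub_eq_zero] at h1
  by_cases hc0 : c = 0
  · rw [h1, hc0, zero_smul]
  · exfalso
    obtain ⟨z, hz⟩ := hx (algebraMap k A (-c⁻¹))
    rw [Ideal.mem_bot] at hz
    have h2 := congrArg (fun w : A => (w : H) * b S) hz
    simp only [AddSubgroupClass.coe_sub, Subalgebra.coe_add, Subalgebra.coe_mul,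
      Subalgebra.coe_algebraMap, OneMemClass.coe_one, ZeroMemClass.coe_zero, sub_mul, add_mul,
      mul_assoc, h1, one_mul, zero_mul] at h2
    rw [← Algebra.smul_def, smul_smul, neg_mul, inv_mul_cancel₀ hc0, neg_smul, one_smul, mul_neg,
      neg_add_cancel, zero_sub, neg_eq_zero] at h2
    exact hb.ne_zero h2

/-- The `b T` with `T` nonempty have square zero in a commutative algebra. -/
theorem mem_jacobson {T : Finset ι} (hT : T ⊆ S) (h0 : T.Nonempty) :
    (⟨b T, hb.mem T hT⟩ : A) ∈ Ring.jacobson A := by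
  rw [← Ideal.jacobson_bot, Ideal.mem_jacobson_iff]
  intro y
  refine ⟨1 - y * ⟨b T, hb.mem T hT⟩, ?_⟩
  rw [Ideal.mem_bot]
  apply Subtype.ext
  have h1 : b T * b T = 0 := hb.mul_eq_zero T hT T hT (by
    rw [disjoint_self]; exact h0.ne_empty)
  have h2 := hb.comm _ (hb.mem T hT) _ y.2
  have h3 : (y : H) * b T * ((y : H) * b T) = 0 := by
    rw [mul_assoc, ← mul_assoc (b T), h2, mul_assoc, h1, mul_zero, mul_zero]
  simp only [AddSubgroupClass.coe_sub, Subalgebra.coe_add, Subalgebra.coe_mul,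
    OneMemClass.coe_one, ZeroMemClass.coe_zero, sub_mul, one_mul]
  rw [mul_assoc _ (y : H), h3]
  abel

theorem mul_mem_of_mem_jacobson {x : A} (hx : x ∈ Ring.jacobson A) {n : ℕ} {T : Finset ι} {v : H}
    (hv : v ∈ cubeFilt k S b n T) : (x : H) * v ∈ cubeFilt k S b (n + 1) T := by
  obtain ⟨c, hc⟩ := hb.exists_residue_mul x.2
  have h1 := hc 0 S (b S) (mem_cubeFilt subset_rfl (Nat.zero_le _) subset_rfl)
  rw [cubeFilt_eq_bot (by simp), Submodule.mem_bot, hb.mul_eq_zero_of_mem_jacobson hx,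
    zero_sub, neg_eq_zero, smul_eq_zero, or_iff_left hb.ne_zero] at h1
  have h2 := hc n T v hv
  rwa [h1, zero_smul, sub_zero] at h2

/-- The radical filtration of the module generated by `b T` is the filtration by size. -/
theorem mem_radPow_iff {T : Finset ι} (hT : T ⊆ S) (n : ℕ) {v : H} :
    v ∈ radPow n (Submodule.span A {b T}) ↔ v ∈ cubeFilt k S b n T := by
  induction n generalizing v with
  | zero =>
    rw [radPow, Submodule.pow_zero, Ideal.one_eq_top, Submodule.top_smul]
    exact hb.mem_span_iff hT
  | succ n ih =>
    have e : radPow (n + 1) (Submodule.span A {b T})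
        = Ring.jacobson A • radPow n (Submodule.span A {b T}) := by
      rcases eq_or_ne n 0 with rfl | hn
      · rw [radPow, radPow, Submodule.pow_zero, zero_add, Submodule.pow_one, Ideal.one_eq_top,
          Submodule.top_smul]
      · rw [radPow, radPow, ← Submodule.smul_assoc, smul_eq_mul, Submodule.pow_succ' _ hn]
    rw [e]
    constructor
    · intro hv
      refine Submodule.smul_induction_on hv (fun x hx y hy => ?_) fun x y hx hy => add_mem hx hy
      exact hb.mul_mem_of_mem_jacobson hx (ih.1 hy)
    · intro hv
      unfold cubeFilt at hv
      induction hv using Submodule.span_induction with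
      | zero => exact zero_mem _
      | add x y _ _ h1 h2 => exact add_mem h1 h2
      | smul c x _ h =>
        have := Submodule.smul_mem _ (algebraMap k A c) h
        rwa [algebraMap_smul] at this
      | mem y hy =>
        obtain ⟨T', hT', hn, h, rfl⟩ := hy
        obtain ⟨i, hi⟩ := Finset.card_pos.1 (show 0 < (T' \ T).card by omega)
        obtain ⟨hi1, hi2⟩ := Finset.mem_sdiff.1 hi
        have hsub : {i} ⊆ S := Finset.singleton_subset_iff.2 (hT' hi1)
        have hE : T'.erase i ⊆ S := (Finset.erase_subset i T').trans hT'
        have e1 : b T' = b {i} * b (T'.erase i) := by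
          rw [hb.mul_of_disjoint _ hsub _ hE (Finset.disjoint_singleton_left.2
            (Finset.notMem_erase i T')), ← Finset.insert_eq, Finset.insert_erase hi1]
        rw [e1]
        refine Submodule.smul_mem_smul (hb.mem_jacobson hsub (Finset.singleton_nonempty i))
          (ih.2 (mem_cubeFilt hE ?_ (Finset.subset_erase.2 ⟨h, hi2⟩)))
        rw [Finset.erase_sdiff_comm, Finset.card_erase_of_mem hi]
        omega

theorem radPow_eq_iSup {T : Finset ι} (hT : T ⊆ S) (n : ℕ) :
    radPow n (Submodule.span A {b T})
      = ⨆ T' ∈ {T' | T' ⊆ S ∧ (T' \ T).card = n ∧ T ⊆ T'}, Submodule.span A {b T'} := by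
  apply le_antisymm
  · intro v hv
    rw [hb.mem_radPow_iff hT] at hv
    unfold cubeFilt at hv
    induction hv using Submodule.span_induction with
    | zero => exact zero_mem _
    | add x y _ _ h1 h2 => exact add_mem h1 h2
    | smul c x _ h =>
      have := Submodule.smul_mem _ (algebraMap k A c) h
      rwa [algebraMap_smul] at this
    | mem y hy =>
      obtain ⟨T', hT', hn, h, rfl⟩ := hy
      obtain ⟨U, hU, hUn⟩ := Finset.exists_subset_card_eq hn
      have hUS : U ⊆ S := hU.trans (Finset.sdiff_subset.trans hT')
      have hdis : Disjoint U T := Finset.disjoint_of_subset_left hU Finset.sdiff_disjoint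
      have h1 : T ∪ U ⊆ T' := Finset.union_subset h (hU.trans Finset.sdiff_subset)
      refine Submodule.mem_iSup_of_mem (T ∪ U) (Submodule.mem_iSup_of_mem
        ⟨Finset.union_subset hT hUS, ?_, Finset.subset_union_left⟩ ?_)
      · rw [Finset.union_sdiff_cancel_left hdis.symm, hUn]
      · exact (hb.mem_span_iff (Finset.union_subset hT hUS)).2
          (mem_cubeFilt hT' (Nat.zero_le _) h1)
  · refine iSup₂_le fun T' hT' => ?_
    obtain ⟨h1, h2, h3⟩ := hT'
    rw [Submodule.span_singleton_le_iff_mem, hb.mem_radPow_iff hT]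
    exact mem_cubeFilt h1 h2.ge h3

theorem radPow_eq_bot_iff {T : Finset ι} (hT : T ⊆ S) (n : ℕ) :
    radPow n (Submodule.span A {b T}) = ⊥ ↔ (S \ T).card < n := by
  constructor
  · intro h
    by_contra hn
    have h1 : b S ∈ radPow n (Submodule.span A {b T}) :=
      (hb.mem_radPow_iff hT n).2 (mem_cubeFilt subset_rfl (not_lt.1 hn) hT)
    rw [h, Submodule.mem_bot] at h1
    exact hb.ne_zero h1
  · intro h
    rw [eq_bot_iff]
    intro v hv
    rw [hb.mem_radPow_iff hT, cubeFilt_eq_bot h] at hv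
    exact hv

theorem loewyLength_eq {T : Finset ι} (hT : T ⊆ S) :
    loewyLength (Submodule.span A {b T}) = (S \ T).card + 1 := by
  rw [loewyLength]
  have : {n : ℕ | radPow n (Submodule.span A {b T}) = ⊥} = Set.Ici ((S \ T).card + 1) := by
    ext n
    exact (hb.radPow_eq_bot_iff hT n).trans Nat.lt_iff_add_one_le
  rw [this, csInf_Ici]

/-! #### The layers -/

theorem mul_compl {n : ℕ} {T U T' : Finset ι} (hU : U ∈ (S \ T).powersetCard n)
    (hT' : T' ⊆ S) (hT : T ⊆ T') (hn : n ≤ (T' \ T).card) :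
    b T' * b (S \ (T ∪ U)) = if T' \ T = U then b S else 0 := by
  obtain ⟨hU1, hU2⟩ := Finset.mem_powersetCard.1 hU
  split_ifs with h
  · have : T' = T ∪ U := by rw [← h, Finset.union_sdiff_of_subset hT]
    rw [← this, hb.mul_of_disjoint _ hT' _ Finset.sdiff_subset Finset.disjoint_sdiff,
      Finset.union_sdiff_of_subset hT']
  · refine hb.mul_eq_zero _ hT' _ Finset.sdiff_subset fun hd => h ?_
    refine Finset.eq_of_subset_of_card_le (fun x hx => ?_) (by omega)
    obtain ⟨hx1, hx2⟩ := Finset.mem_sdiff.1 hx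
    by_contra hxU
    refine Finset.disjoint_left.1 hd hx1 (Finset.mem_sdiff.2 ⟨hT' hx1, ?_⟩)
    simp [hx2, hxU]

/-- Multiplication by the `b (S \ (T ∪ U))` reads off the coefficients in the `n`-th layer. -/
theorem exists_coeff {n : ℕ} {T : Finset ι} {v : H} (hv : v ∈ cubeFilt k S b n T) :
    ∃ c : Finset ι → k, (∀ U ∈ (S \ T).powersetCard n, v * b (S \ (T ∪ U)) = c U • b S) ∧
      v - ∑ U ∈ (S \ T).powersetCard n, c U • b (T ∪ U) ∈ cubeFilt k S b (n + 1) T := by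
  unfold cubeFilt at hv
  induction hv using Submodule.span_induction with
  | zero => exact ⟨0, fun U _ => by simp, by simp⟩
  | add x y _ _ h1 h2 =>
    obtain ⟨c, hc, hc'⟩ := h1
    obtain ⟨d, hd, hd'⟩ := h2
    refine ⟨c + d, fun U hU => ?_, ?_⟩
    · rw [add_mul, hc U hU, hd U hU, Pi.add_apply, add_smul]
    · simp only [Pi.add_apply, add_smul, Finset.sum_add_distrib]
      rw [add_sub_add_comm]
      exact add_mem hc' hd'
  | smul e x _ h =>
    obtain ⟨c, hc, hc'⟩ := h
    refine ⟨fun U => e * c U, fun U hU => ?_, ?_⟩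
    · rw [smul_mul_assoc, hc U hU, mul_smul]
    · simp only [mul_smul, ← Finset.smul_sum, ← smul_sub]
      exact Submodule.smul_mem _ _ hc'
  | mem x hx =>
    obtain ⟨T', hT', hn, h, rfl⟩ := hx
    refine ⟨fun U => if T' \ T = U then 1 else 0, fun U hU => ?_, ?_⟩
    · rw [hb.mul_compl hU hT' h hn, ite_smul, one_smul, zero_smul]
    · simp only [ite_smul, one_smul, zero_smul, Finset.sum_ite_eq]
      split_ifs with hU
      · rw [Finset.union_sdiff_of_subset h, sub_self]; exact zero_mem _
      · rw [sub_zero]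
        refine mem_cubeFilt hT' (Nat.lt_of_le_of_ne hn fun hne => hU ?_) h
        exact Finset.mem_powersetCard.2 ⟨Finset.sdiff_subset_sdiff hT' le_rfl, hne.symm⟩

/-- The layers of the filtration are detected by multiplication by the `b (S \ (T ∪ U))`. -/
theorem mem_succ_iff {n : ℕ} {T : Finset ι} {v : H} (hv : v ∈ cubeFilt k S b n T) :
    v ∈ cubeFilt k S b (n + 1) T ↔
      ∀ U ∈ (S \ T).powersetCard n, v * b (S \ (T ∪ U)) = 0 := by
  constructor
  · intro hv' U hU
    unfold cubeFilt at hv'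
    induction hv' using Submodule.span_induction with
    | zero => rw [zero_mul]
    | add x y hx hy h1 h2 =>
      have anti := cubeFilt_anti (k := k) (S := S) (b := b) (Nat.le_succ n) T
      rw [add_mul, h1 (anti hx), h2 (anti hy), add_zero]
    | smul e x hx h =>
      have anti := cubeFilt_anti (k := k) (S := S) (b := b) (Nat.le_succ n) T
      rw [smul_mul_assoc, h (anti hx), smul_zero]
    | mem x hx =>
      obtain ⟨T', hT', hn, h, rfl⟩ := hx
      rw [hb.mul_compl hU hT' h (by omega), if_neg]
      rintro rfl
      have := (Finset.mem_powersetCard.1 hU).2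
      omega
  · intro h
    obtain ⟨c, hc, hc'⟩ := hb.exists_coeff hv
    have : ∑ U ∈ (S \ T).powersetCard n, c U • b (T ∪ U) = 0 := by
      refine Finset.sum_eq_zero fun U hU => ?_
      have h1 := hc U hU
      rw [h U hU, eq_comm, smul_eq_zero, or_iff_left hb.ne_zero] at h1
      rw [h1, zero_smul]
    rwa [this, sub_zero] at hc'

theorem mul_compl_mem {n : ℕ} {T U : Finset ι} (hU : U ∈ (S \ T).powersetCard n)
    {v : H} (hv : v ∈ cubeFilt k S b n T) :
    v * b (S \ (T ∪ U)) ∈ Submodule.span A {b S} := by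
  obtain ⟨c, hc, -⟩ := hb.exists_coeff hv
  rw [hb.mem_span_iff subset_rfl, mem_cubeFilt_top]
  exact ⟨c U, hc U hU⟩

theorem exists_layerMap {T : Finset ι} (hT : T ⊆ S) (n : ℕ) :
    ∃ f : radPow n (Submodule.span A {b T}) →ₗ[A]
        ({U // U ∈ (S \ T).powersetCard n} → Submodule.span A {b S}),
      ∀ v U, (f v U : H) = v * b (S \ (T ∪ U)) :=
  ⟨{ toFun := fun v U => ⟨v * b (S \ (T ∪ U)),
        hb.mul_compl_mem U.2 ((hb.mem_radPow_iff hT n).1 v.2)⟩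
     map_add' := fun v w => by
       funext U; exact Subtype.ext (add_mul (v : H) w _)
     map_smul' := fun c v => by
       funext U; exact Subtype.ext (mul_assoc (c : H) v _) }, fun _ _ => rfl⟩

/-- The multiplications by the `b (S \ (T ∪ U))`, for the subsets `U` of `S \ T` of size `n`,
identify the layer with a sum of copies of the module generated by `b S`. -/
theorem nonempty_radLayer_equiv {T : Finset ι} (hT : T ⊆ S) (n : ℕ) :
    Nonempty (RadLayer n (Submodule.span A {b T}) ≃ₗ[A]
      (Fin ((S \ T).card.choose n) → Submodule.span A {b S})) := by
  obtain ⟨f, hf⟩ := hb.exists_layerMap hT n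
  have hker : (radPow (n + 1) (Submodule.span A {b T})).submoduleOf
      (radPow n (Submodule.span A {b T})) = LinearMap.ker f := by
    ext v
    rw [Submodule.submoduleOf, Submodule.mem_comap, Submodule.subtype_apply,
      hb.mem_radPow_iff hT, hb.mem_succ_iff ((hb.mem_radPow_iff hT n).1 v.2),
      LinearMap.mem_ker]
    constructor
    · intro h
      funext U
      exact Subtype.ext ((hf v U).trans (h U U.2))
    · intro h U hU
      rw [← hf v ⟨U, hU⟩, h]; rfl
  have hsurj : Function.Surjective f := by
    intro g
    have hg : ∀ U, ∃ c : k, (g U : H) = c • b S := fun U =>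
      mem_cubeFilt_top.1 ((hb.mem_span_iff subset_rfl).1 (g U).2)
    choose c hc using hg
    have hmem : ∀ U : {U // U ∈ (S \ T).powersetCard n},
        b (T ∪ U) ∈ cubeFilt k S b n T := by
      intro U
      obtain ⟨h1, h2⟩ := Finset.mem_powersetCard.1 U.2
      refine mem_cubeFilt (Finset.union_subset hT (h1.trans Finset.sdiff_subset)) ?_
        Finset.subset_union_left
      rw [Finset.union_sdiff_cancel_left
        (Finset.disjoint_of_subset_right h1 Finset.disjoint_sdiff), h2]
    refine ⟨⟨∑ U, c U • b (T ∪ U), (hb.mem_radPow_iff hT n).2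
      (Submodule.sum_mem _ fun U _ => Submodule.smul_mem _ _ (hmem U))⟩, ?_⟩
    funext U
    apply Subtype.ext
    rw [hf, hc, Finset.sum_mul, Finset.sum_eq_single U]
    · rw [smul_mul_assoc]
      obtain ⟨h1, h2⟩ := Finset.mem_powersetCard.1 U.2
      have hd : (T ∪ (U : Finset ι)) \ T = U := Finset.union_sdiff_cancel_left
        (Finset.disjoint_of_subset_right h1 Finset.disjoint_sdiff)
      rw [hb.mul_compl U.2 (Finset.union_subset hT (h1.trans Finset.sdiff_subset))
        Finset.subset_union_left (by rw [hd, h2]), if_pos hd]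
    · intro U' _ hne
      obtain ⟨h1, h2⟩ := Finset.mem_powersetCard.1 U'.2
      have hd : (T ∪ (U' : Finset ι)) \ T = U' := Finset.union_sdiff_cancel_left
        (Finset.disjoint_of_subset_right h1 Finset.disjoint_sdiff)
      rw [smul_mul_assoc, hb.mul_compl U.2
        (Finset.union_subset hT (h1.trans Finset.sdiff_subset))
        Finset.subset_union_left (by rw [hd, h2]), if_neg, smul_zero]
      rw [hd]
      exact fun h => hne (Subtype.ext h)
    · simp
  have e1 := (Submodule.quotEquivOfEq _ _ hker).trans (f.quotKerEquivOfSurjective hsurj)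
  have hcard : Fintype.card {U // U ∈ (S \ T).powersetCard n} = (S \ T).card.choose n := by
    rw [Fintype.card_coe, Finset.card_powersetCard]
  exact ⟨e1.trans (LinearEquiv.funCongrLeft A _ (Fintype.equivFinOfCardEq hcard).symm)⟩

theorem nonempty_head_equiv {T : Finset ι} (hT : T ⊆ S) :
    Nonempty (Head (Submodule.span A {b T}) ≃ₗ[A] Submodule.span A {b S}) := by
  let f : Submodule.span A {b T} →ₗ[A] Submodule.span A {b S} :=
    { toFun := fun v => ⟨v * b (S \ (T ∪ ∅)), hb.mul_compl_mem (n := 0) (by simp)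
        ((hb.mem_span_iff hT).1 v.2)⟩
      map_add' := fun v w => Subtype.ext (add_mul (v : H) w _)
      map_smul' := fun c v => Subtype.ext (mul_assoc (c : H) v _) }
  have hker : (radPow 1 (Submodule.span A {b T})).submoduleOf (Submodule.span A {b T})
      = LinearMap.ker f := by
    ext v
    rw [Submodule.submoduleOf, Submodule.mem_comap, Submodule.subtype_apply,
      hb.mem_radPow_iff hT, hb.mem_succ_iff ((hb.mem_span_iff hT).1 v.2), LinearMap.mem_ker]
    simp only [Finset.powersetCard_zero, Finset.mem_singleton, forall_eq]
    exact (Subtype.ext_iff (a1 := f v) (a2 := 0)).symm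
  have hsurj : Function.Surjective f := by
    rintro ⟨w, hw⟩
    obtain ⟨c, rfl⟩ := mem_cubeFilt_top.1 ((hb.mem_span_iff subset_rfl).1 hw)
    refine ⟨⟨c • b T, (hb.mem_span_iff hT).2 (Submodule.smul_mem _ _
      (mem_cubeFilt hT (Nat.zero_le _) subset_rfl))⟩, Subtype.ext ?_⟩
    change c • b T * b (S \ (T ∪ ∅)) = c • b S
    rw [smul_mul_assoc, hb.mul_compl (n := 0) (by simp) hT subset_rfl (Nat.zero_le _),
      if_pos (Finset.sdiff_self T)]
  exact ⟨(Submodule.quotEquivOfEq _ _ hker).trans (f.quotKerEquivOfSurjective hsurj)⟩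

/-! #### The socle, indecomposability and primitivity -/

/-- A nonzero element has a multiple that is equal to `b S`. -/
theorem exists_mul_eq {T : Finset ι} {v : H} (hv : v ∈ cubeFilt k S b 0 T)
    (h0 : v ≠ 0) : ∃ u ∈ A, u * v = b S := by
  by_contra hcon
  have key : ∀ n, v ∈ cubeFilt k S b n T := by
    intro n
    induction n with
    | zero => exact hv
    | succ n ih =>
      refine (hb.mem_succ_iff ih).2 fun U hU => ?_
      by_contra hne
      obtain ⟨c, hc, -⟩ := hb.exists_coeff ih
      have hc0 : c U ≠ 0 := fun h => hne (by rw [hc U hU, h, zero_smul])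
      refine hcon ⟨(c U)⁻¹ • b (S \ (T ∪ U)), Subalgebra.smul_mem _
        (hb.mem _ Finset.sdiff_subset) _, ?_⟩
      rw [smul_mul_assoc, hb.comm _ (hb.mem _ Finset.sdiff_subset) _ (hb.mem_of_mem_cubeFilt hv),
        hc U hU, smul_smul, inv_mul_cancel₀ hc0, one_smul]
  have := key ((S \ T).card + 1)
  rw [cubeFilt_eq_bot (Nat.lt_succ_self _)] at this
  exact h0 this

theorem isSimpleModule : IsSimpleModule A (Submodule.span A {b S}) := by
  have hmem : b S ∈ Submodule.span A {b S} := Submodule.mem_span_singleton_self _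
  have : Nontrivial (Submodule A (Submodule.span A {b S})) :=
    (Submodule.nontrivial_iff A).2 ⟨⟨⟨b S, hmem⟩, 0, fun h => hb.ne_zero (congrArg Subtype.val h)⟩⟩
  rw [isSimpleModule_iff]
  refine ⟨fun N => or_iff_not_imp_left.2 fun hN => ?_⟩
  obtain ⟨⟨v, hv⟩, hvN, hv0⟩ := Submodule.exists_mem_ne_zero_of_ne_bot hN
  obtain ⟨u, hu, huv⟩ := hb.exists_mul_eq ((hb.mem_span_iff subset_rfl).1 hv)
    (fun h => hv0 (Subtype.ext h))
  rw [eq_top_iff]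
  rintro ⟨w, hw⟩ -
  obtain ⟨d, rfl⟩ := Submodule.mem_span_singleton.1 hw
  have h1 := N.smul_mem d (N.smul_mem (⟨u, hu⟩ : A) hvN)
  convert h1 using 1
  exact Subtype.ext (congrArg (fun x => (d : H) * x) huv.symm)

/-- Every nonzero submodule contains `b S`. -/
theorem isIndecomposable {T : Finset ι} (hT : T ⊆ S) :
    IsIndecomposable A (Submodule.span A {b T}) := by
  refine ⟨⟨⟨⟨b T, Submodule.mem_span_singleton_self _⟩, 0, fun h =>
    hb.ne_zero_of_subset hT (congrArg Subtype.val h)⟩⟩, fun N₁ N₂ hN => ?_⟩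
  have hS : b S ∈ Submodule.span A {b T} :=
    (hb.mem_span_iff hT).2 (mem_cubeFilt subset_rfl (Nat.zero_le _) hT)
  have key : ∀ N : Submodule A (Submodule.span A {b T}), N ≠ ⊥ → ⟨b S, hS⟩ ∈ N := by
    intro N hN
    obtain ⟨⟨v, hv⟩, hvN, hv0⟩ := Submodule.exists_mem_ne_zero_of_ne_bot hN
    obtain ⟨u, hu, huv⟩ := hb.exists_mul_eq ((hb.mem_span_iff hT).1 hv)
      (fun h => hv0 (Subtype.ext h))
    have h1 := N.smul_mem (⟨u, hu⟩ : A) hvN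
    convert h1 using 1
    exact Subtype.ext huv.symm
  by_contra! h
  have h3 := (Submodule.disjoint_def.1 hN.disjoint) _ (key N₁ h.1) (key N₂ h.2)
  exact hb.ne_zero (congrArg Subtype.val h3)

theorem restrictScalars_eq : (Submodule.span A {b S}).restrictScalars k
    = Submodule.span k {b S} := by
  ext v
  rw [Submodule.restrictScalars_mem, hb.mem_span_iff subset_rfl, mem_cubeFilt_top,
    Submodule.mem_span_singleton]
  exact ⟨fun ⟨c, hc⟩ => ⟨c, hc.symm⟩, fun ⟨c, hc⟩ => ⟨c, hc.symm⟩⟩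

theorem finrank_eq_one : Module.finrank k (Submodule.span A {b S}) = 1 := by
  have h1 : Module.finrank k ((Submodule.span A {b S}).restrictScalars k) = 1 := by
    rw [hb.restrictScalars_eq]; exact finrank_span_singleton hb.ne_zero
  exact h1

theorem pow_mem_cubeFilt {u : H} (hu : u ∈ cubeFilt k S b 1 ∅) (n : ℕ) :
    u ^ (n + 1) ∈ cubeFilt k S b (n + 1) ∅ := by
  induction n with
  | zero => simpa using hu
  | succ n ih => rw [pow_succ', add_comm (n + 1) 1]; exact hb.mul_mem_cubeFilt hu ih

theorem isNilpotent {u : H} (hu : u ∈ cubeFilt k S b 1 ∅) : u ^ (S.card + 1) = 0 := by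
  have := hb.pow_mem_cubeFilt hu S.card
  rwa [cubeFilt_eq_bot (by simp)] at this

theorem eq_zero_of_idempotent {u : H} (hu : u ∈ cubeFilt k S b 1 ∅) (h : u * u = u) : u = 0 := by
  have h1 : u ^ (S.card + 1) = u := IsIdempotentElem.pow_succ_eq S.card h
  rw [← h1, hb.isNilpotent hu]

theorem empty_notMem : b ∅ ∉ cubeFilt k S b 1 ∅ := fun h =>
  hb.ne_zero_of_subset (Finset.empty_subset S)
    (hb.eq_zero_of_idempotent h (hb.empty_mul (Finset.empty_subset S)))

theorem mem_of_mul_empty {u : H} (hu : u ∈ A) (h : u * b ∅ = u) : u ∈ cubeFilt k S b 0 ∅ := by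
  rw [← h]
  exact hb.mul_mem_of_mem hu (mem_cubeFilt (Finset.empty_subset S) (Nat.zero_le _) subset_rfl)

/-- A product `x * y` in `A` with `x` of square zero is not invertible in the local ring of `b ∅`.
-/
theorem mul_mem_of_sq_eq_zero {x y : H} (hxy : x * y ∈ A) (hx : x * b ∅ = x) (hy : y * b ∅ = y)
    (h2 : x * x = 0) : x * y ∈ cubeFilt k S b 1 ∅ := by
  obtain ⟨c, hc⟩ := hb.exists_residue hxy
  rw [mul_assoc, hy] at hc
  by_cases hc0 : c = 0
  · rwa [hc0, zero_smul, sub_zero] at hc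
  · exfalso
    -- `x * y` is invertible in the local ring of `b ∅`, while `x * (x * y) = 0`
    set m := (-c⁻¹) • (x * y - c • b ∅) with hm
    have hmem : m ∈ cubeFilt k S b 1 ∅ := Submodule.smul_mem _ _ hc
    have hxm : x * m = x := by
      rw [hm, mul_smul_comm, mul_sub, ← mul_assoc, h2, zero_mul, zero_sub, mul_smul_comm, hx,
        smul_neg, smul_smul, neg_mul, inv_mul_cancel₀ hc0, neg_smul, one_smul, neg_neg]
    have hpow : ∀ n : ℕ, x * m ^ n = x := by
      intro n
      induction n with
      | zero => rw [pow_zero, mul_one]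
      | succ n ih => rw [pow_succ', ← mul_assoc, hxm, ih]
    have hx0 : x = 0 := by rw [← hpow (S.card + 1), hb.isNilpotent hmem, mul_zero]
    rw [hx0, zero_mul, zero_sub] at hc
    have h3 := Submodule.smul_mem _ (-c⁻¹) hc
    rw [smul_neg, smul_smul, neg_mul, inv_mul_cancel₀ hc0, neg_smul, one_smul, neg_neg] at h3
    exact hb.empty_notMem h3

/-- Iterating `x = f₀ * x + x * f₀` puts `x` in the span of the `f₀ ^ m * x * f₀ ^ n` with `m + n`
large, which vanish since `f₀` is nilpotent. -/
theorem eq_zero_of_parts {f₀ f₁ f₂ : H} (h0 : f₀ ∈ cubeFilt k S b 1 ∅)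
    (hidem : (f₀ + f₁ + f₂) * (f₀ + f₁ + f₂) = f₀ + f₁ + f₂)
    (e1 : f₁ = f₀ * f₁ + f₁ * f₀) (e2 : f₂ = f₀ * f₂ + f₂ * f₀) : f₀ + f₁ + f₂ = 0 := by
  have hnil := hb.isNilpotent h0
  have key : ∀ x : H, x = f₀ * x + x * f₀ → x = 0 := by
    intro x hx
    have h : ∀ l m n : ℕ, 2 * (S.card + 1) ≤ l + m + n → f₀ ^ m * x * f₀ ^ n = 0 := by
      intro l
      induction l with
      | zero =>
        intro m n hmn
        rcases le_or_gt (S.card + 1) m with hm | hm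
        · rw [pow_eq_zero_of_le hm hnil, zero_mul, zero_mul]
        · rw [pow_eq_zero_of_le (show S.card + 1 ≤ n by omega) hnil, mul_zero]
      | succ l ih =>
        intro m n hmn
        have h1 := ih (m + 1) n (by omega)
        have h2 := ih m (n + 1) (by omega)
        rw [hx, mul_add, add_mul, ← mul_assoc, ← pow_succ, h1, zero_add, ← mul_assoc,
          mul_assoc _ f₀, ← pow_succ', h2]
    simpa using h (2 * (S.card + 1)) 0 0 (by omega)
  rw [key f₁ e1, key f₂ e2, add_zero, add_zero] at hidem ⊢
  exact hb.eq_zero_of_idempotent h0 hidem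

/-- An idempotent below `b ∅` in an algebra containing `A`, with one part in `A` and two parts of
square zero (as given by a grading) is trivial. -/
theorem eq_zero_or_eq {f₀ f₁ f₂ : H}
    (hidem : (f₀ + f₁ + f₂) * (f₀ + f₁ + f₂) = f₀ + f₁ + f₂)
    (h0 : f₀ ∈ A) (h12 : f₁ * f₂ ∈ A) (h21 : f₂ * f₁ ∈ A)
    (r0 : f₀ * b ∅ = f₀) (r1 : f₁ * b ∅ = f₁) (r2 : f₂ * b ∅ = f₂)
    (l1 : b ∅ * f₁ = f₁) (l2 : b ∅ * f₂ = f₂) (s1 : f₁ * f₁ = 0) (s2 : f₂ * f₂ = 0)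
    (e0 : f₀ = f₀ * f₀ + f₁ * f₂ + f₂ * f₁)
    (e1 : f₁ = f₀ * f₁ + f₁ * f₀) (e2 : f₂ = f₀ * f₂ + f₂ * f₀) :
    f₀ + f₁ + f₂ = 0 ∨ f₀ + f₁ + f₂ = b ∅ := by
  have he := hb.empty_mul (Finset.empty_subset S)
  have l0 : b ∅ * f₀ = f₀ := by
    rw [hb.comm _ (hb.mem _ (Finset.empty_subset S)) _ h0, r0]
  obtain ⟨c, hc⟩ := hb.exists_residue_mul h0
  have hc0 := hc 0 ∅ (b ∅) (mem_cubeFilt (Finset.empty_subset S) (Nat.zero_le _) subset_rfl)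
  rw [r0, zero_add] at hc0
  have hcc : (c - c * c) • b ∅ ∈ cubeFilt k S b 1 ∅ := by
    have h1 := hc 0 ∅ f₀ (hb.mem_of_mul_empty h0 r0)
    rw [zero_add] at h1
    have h2 := add_mem (hb.mul_mem_of_sq_eq_zero h12 r1 r2 s1)
      (hb.mul_mem_of_sq_eq_zero h21 r2 r1 s2)
    -- modulo the filtration, `f₀ = c • b ∅` and `f₀ = f₀ * f₀`
    have h3 := add_mem (add_mem h1 h2) (Submodule.smul_mem _ (c - 1) hc0)
    have h4 : f₀ * f₀ - c • f₀ + (f₁ * f₂ + f₂ * f₁) + (c - 1) • (f₀ - c • b ∅)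
        = (c - c * c) • b ∅ := by
      have h5 : f₀ * f₀ + (f₁ * f₂ + f₂ * f₁) = f₀ := by rw [← add_assoc, ← e0]
      have h6 : f₀ * f₀ - c • f₀ + (f₁ * f₂ + f₂ * f₁)
          = (f₀ * f₀ + (f₁ * f₂ + f₂ * f₁)) - c • f₀ := by abel
      rw [h6, h5]
      module
    rwa [h4] at h3
  have hc1 : c - c * c = 0 := by
    by_contra h
    have h1 := Submodule.smul_mem _ (c - c * c)⁻¹ hcc
    rw [smul_smul, inv_mul_cancel₀ h, one_smul] at h1
    exact hb.empty_notMem h1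
  rcases _root_.mul_eq_zero.1 (show c * (1 - c) = 0 by linear_combination hc1) with h | h
  · left
    rw [h, zero_smul, sub_zero] at hc0
    exact hb.eq_zero_of_parts hc0 hidem e1 e2
  · right
    obtain rfl : c = 1 := by linear_combination -h
    have h1 : b ∅ - f₀ ∈ cubeFilt k S b 1 ∅ := by
      have := neg_mem hc0
      rwa [one_smul, neg_sub] at this
    have h2 : b ∅ - f₀ + -f₁ + -f₂ = b ∅ - (f₀ + f₁ + f₂) := by abel
    have hneg : ∀ x, b ∅ * x = x → x * b ∅ = x → x = f₀ * x + x * f₀ →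
        -x = (b ∅ - f₀) * -x + -x * (b ∅ - f₀) := by
      intro x hl hr hx
      have h4 : (b ∅ - f₀) * -x + -x * (b ∅ - f₀) = (f₀ * x + x * f₀) - x - x := by
        rw [sub_mul, mul_sub, mul_neg, neg_mul, mul_neg, neg_mul, hl, hr]
        abel
      rw [h4, ← hx]
      abel
    have h3 := hb.eq_zero_of_parts (f₁ := -f₁) (f₂ := -f₂) h1 (by
      rw [h2, sub_mul, mul_sub, mul_sub, he, hidem, mul_add, mul_add, l0, l1, l2, add_mul, add_mul,
        r0, r1, r2]
      abel) (hneg f₁ l1 r1 e1) (hneg f₂ l2 r2 e2)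
    rw [h2, sub_eq_zero] at h3
    exact h3.symm

end IsCube

end Cube

/-! ### Idempotents of `U_r` of a given weight -/

section

variable {k : Type*} [Field k]

theorem proj_mem_homog (d : ℤ) (u : Hyper k) : proj k d u ∈ homog k d := by
  induction u using hyper_induction with
  | zero => rw [map_zero]; exact zero_mem _
  | add u v hu hv => rw [map_add]; exact add_mem hu hv
  | mon m f n =>
    rw [proj_mon]
    split_ifs with h
    · exact mon_mem_homog h f
    · exact zero_mem _

theorem proj_torus_mul (d : ℤ) (g : W k) (u : Hyper k) :
    proj k d (torus k g * u) = torus k g * proj k d u := by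
  induction u using hyper_induction with
  | zero => simp
  | add u v hu hv => rw [mul_add, map_add, map_add, hu, hv, mul_add]
  | mon m f n =>
    rw [torus_mul_mon, proj_mon, proj_mon]
    split_ifs
    · rw [torus_mul_mon]
    · rw [mul_zero]

theorem proj_mul_torus (d : ℤ) (g : W k) (u : Hyper k) :
    proj k d (u * torus k g) = proj k d u * torus k g := by
  induction u using hyper_induction with
  | zero => simp
  | add u v hu hv => rw [add_mul, map_add, map_add, hu, hv, add_mul]
  | mon m f n =>
    rw [mon_mul_torus, proj_mon, proj_mon]
    split_ifs
    · rw [mon_mul_torus]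
    · rw [zero_mul]

variable {p : ℕ} [Fact p.Prime] [CharP k p]

theorem sum_proj {r : ℕ} {u : Hyper k} (hu : u ∈ Vr k p r) :
    ∑ d ∈ Finset.Ioo (-(p ^ r : ℤ)) (p ^ r), proj k d u = u := by
  unfold Vr at hu
  induction hu using Submodule.span_induction with
  | zero => simp
  | add u v _ _ h1 h2 => simp only [map_add, Finset.sum_add_distrib, h1, h2]
  | smul c u _ h => simp only [map_smul, ← Finset.smul_sum, h]
  | mem x hx =>
    obtain ⟨m, f, n, hm, hn, hf, rfl⟩ := hx
    simp only [proj_mon]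
    rw [Finset.sum_ite_eq, if_pos]
    have hm' : (m : ℤ) < (p : ℤ) ^ r := by exact_mod_cast hm
    have hn' : (n : ℤ) < (p : ℤ) ^ r := by exact_mod_cast hn
    rw [Finset.mem_Ioo]
    constructor <;> linarith

theorem eq_zero_of_mem_Vr_of_mem_homog {r : ℕ} {u : Hyper k} (hu : u ∈ Vr k p r) {d : ℤ}
    (hd : u ∈ homog k d) (h : (p : ℤ) ^ r ≤ |d|) : u = 0 := by
  rw [← sum_proj hu]
  refine Finset.sum_eq_zero fun e he => proj_of_mem_ne hd ?_
  rintro rfl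
  rw [Finset.mem_Ioo, ← abs_lt] at he
  omega

/-- An element of degree `d` shifts weights by `2 d`. -/
theorem proj_eq_zero_of_weight {r : ℕ} {b : ℤ} {u : Hyper k}
    (h1 : u * torus k (ind k p r b) = u) (h2 : torus k (ind k p r b) * u = u) {d : ℤ}
    (hd : ¬ (p : ℤ) ^ r ∣ 2 * d) : proj k d u = 0 := by
  have e1 : proj k d u * torus k (ind k p r b) = proj k d u := by rw [← proj_mul_torus, h1]
  have e2 : torus k (ind k p r b) * proj k d u = proj k d u := by rw [← proj_torus_mul, h2]
  have e3 : shiftW (2 * d) (ind k p r b) * ind k p r b = 0 := by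
    apply Subtype.ext; funext h
    change (shiftW (2 * d) (ind k p r b) : ℤ → k) h * (ind k p r b : ℤ → k) h = 0
    rw [shiftW_apply, ind_apply, ind_apply]
    split_ifs with h3 h4
    · exact absurd (by have := dvd_sub h3 h4; ring_nf at this ⊢; exact this) hd
    all_goals simp
  rw [← e1, ← e2, torus_mul_of_mem_homog (proj_mem_homog d u), mul_assoc, ← map_mul, e3, map_zero,
    mul_zero]

/-- An element of `U_r` which is fixed by a weight idempotent on both sides has components of degree
`0` and `± q` only, where `2 q = p ^ r` (so that `q` occurs for `p = 2` only). -/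
theorem exists_parts {r : ℕ} (hr : 0 < r) {b : ℤ} {u : Hyper k} (hu : u ∈ Vr k p r)
    (h1 : u * torus k (ind k p r b) = u) (h2 : torus k (ind k p r b) * u = u) :
    ∃ q : ℤ, 0 < q ∧ u = proj k 0 u + proj k q u + proj k (-q) u ∧
      ((proj k q u = 0 ∧ proj k (-q) u = 0) ∨ 2 * q = (p : ℤ) ^ r) := by
  by_cases hp : p = 2
  · subst hp
    obtain ⟨r, rfl⟩ := Nat.exists_eq_succ_of_ne_zero hr.ne'
    have hq : (0 : ℤ) < 2 ^ r := by positivity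
    refine ⟨2 ^ r, hq, ?_, Or.inr ?_⟩
    · have hsub : ({0, 2 ^ r, -2 ^ r} : Finset ℤ)
          ⊆ Finset.Ioo (-((2 : ℕ) ^ (r + 1) : ℤ)) ((2 : ℕ) ^ (r + 1)) := by
        intro d hd
        simp only [Finset.mem_insert, Finset.mem_singleton] at hd
        rw [Finset.mem_Ioo, Nat.cast_ofNat, pow_succ]
        rcases hd with rfl | rfl | rfl <;> constructor <;> linarith
      have := Finset.sum_subset hsub (f := fun d => proj k d u) fun d hd hd' => by
        refine proj_eq_zero_of_weight (p := 2) h1 h2 fun hdv => hd' ?_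
        rw [Finset.mem_Ioo, Nat.cast_ofNat, pow_succ'] at hd
        rw [Nat.cast_ofNat, pow_succ', mul_dvd_mul_iff_left two_ne_zero] at hdv
        obtain ⟨c, rfl⟩ := hdv
        have h3 : c < 2 := by nlinarith
        have h4 : -2 < c := by nlinarith
        obtain rfl | rfl | rfl : c = 0 ∨ c = 1 ∨ c = -1 := by omega
        all_goals simp
      rw [sum_proj hu] at this
      conv_lhs => rw [← this]
      rw [Finset.sum_insert, Finset.sum_pair, ← add_assoc]
      · intro h; linarith
      · simp only [Finset.mem_insert, Finset.mem_singleton]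
        rintro (h | h) <;> linarith
    · rw [Nat.cast_ofNat, pow_succ']
  · have hodd : IsCoprime ((p : ℤ) ^ r) 2 := by
      refine IsCoprime.pow_left ?_
      rw [← Nat.cast_ofNat (R := ℤ), Nat.isCoprime_iff_coprime]
      exact (Nat.coprime_primes Fact.out Nat.prime_two).2 hp
    have hz : ∀ d ∈ Finset.Ioo (-(p ^ r : ℤ)) (p ^ r), d ≠ 0 → proj k d u = 0 := by
      intro d hd hd0
      refine proj_eq_zero_of_weight h1 h2 fun hdv => hd0 ?_
      rw [Finset.mem_Ioo, ← abs_lt] at hd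
      exact Int.eq_zero_of_abs_lt_dvd (hodd.dvd_of_dvd_mul_left hdv) hd
    have hpr : (1 : ℤ) < (p : ℤ) ^ r :=
      one_lt_pow₀ (by exact_mod_cast (Fact.out : p.Prime).one_lt) hr.ne'
    have hq1 : proj k 1 u = 0 := hz 1 (by rw [Finset.mem_Ioo]; constructor <;> linarith) one_ne_zero
    have hq2 : proj k (-1) u = 0 :=
      hz (-1) (by rw [Finset.mem_Ioo]; constructor <;> linarith) (by norm_num)
    refine ⟨1, one_pos, ?_, Or.inl ⟨hq1, hq2⟩⟩
    rw [hq1, hq2, add_zero, add_zero]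
    conv_lhs => rw [← sum_proj hu]
    refine Finset.sum_eq_single 0 hz fun h => absurd ?_ h
    rw [Finset.mem_Ioo]; constructor <;> linarith

/-- Comparison of homogeneous components. -/
theorem eq_of_homog_add {q : ℤ} (hq : 0 < q) {x₀ x₁ x₂ y₀ y₁ y₂ : Hyper k}
    (hx0 : x₀ ∈ homog k 0) (hx1 : x₁ ∈ homog k q) (hx2 : x₂ ∈ homog k (-q))
    (hy0 : y₀ ∈ homog k 0) (hy1 : y₁ ∈ homog k q) (hy2 : y₂ ∈ homog k (-q))
    (h : x₀ + x₁ + x₂ = y₀ + y₁ + y₂) : x₀ = y₀ ∧ x₁ = y₁ ∧ x₂ = y₂ := by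
  refine ⟨?_, ?_, ?_⟩
  · have := congrArg (proj k 0) h
    simpa only [map_add, proj_of_mem hx0, proj_of_mem hy0, proj_of_mem_ne hx1 hq.ne',
      proj_of_mem_ne hy1 hq.ne', proj_of_mem_ne hx2 (neg_lt_zero.2 hq).ne,
      proj_of_mem_ne hy2 (neg_lt_zero.2 hq).ne, add_zero] using this
  · have := congrArg (proj k q) h
    have hne : -q ≠ q := by omega
    simpa only [map_add, proj_of_mem hx1, proj_of_mem hy1, proj_of_mem_ne hx0 hq.ne,
      proj_of_mem_ne hy0 hq.ne, proj_of_mem_ne hx2 hne,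
      proj_of_mem_ne hy2 hne, add_zero, zero_add] using this
  · have := congrArg (proj k (-q)) h
    have hne : q ≠ -q := by omega
    have hne' : 0 ≠ -q := by omega
    simpa only [map_add, proj_of_mem hx2, proj_of_mem hy2, proj_of_mem_ne hx0 hne',
      proj_of_mem_ne hy0 hne', proj_of_mem_ne hx1 hne,
      proj_of_mem_ne hy1 hne, add_zero, zero_add] using this

theorem mul_mem_Vr {r : ℕ} {u v : Hyper k} (hu : u ∈ Vr k p r) (hv : v ∈ Vr k p r) :
    u * v ∈ Vr k p r := by
  rw [← mem_Ur_iff] at hu hv ⊢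
  exact mul_mem hu hv

theorem Vr_inf_homog_le {r : ℕ} {u : Hyper k} (hu : u ∈ Vr k p r) (h : u ∈ homog k 0) :
    u ∈ Ar k p r := by
  rw [mem_Ar_iff, ← proj_of_mem h]
  exact proj_zero_mem_Dr hu

theorem IsCube.eq_zero_or_eq_of_mem_Ur {ι : Type*} [DecidableEq ι] {r : ℕ} (hr : 0 < r) {c : ℤ}
    {S : Finset ι} {b : Finset ι → Hyper k} (hb : IsCube (Ar k p r) S b)
    (hw : b ∅ * torus k (ind k p r c) = b ∅) {f : Hyper k} (hf : f ∈ Ur k p r)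
    (hidem : f * f = f) (hl : b ∅ * f = f) (hright : f * b ∅ = f) : f = 0 ∨ f = b ∅ := by
  rw [mem_Ur_iff] at hf
  have hbD : b ∅ ∈ Dr k p r := mem_Ar_iff.1 (hb.mem _ (Finset.empty_subset S))
  have hb0 : b ∅ ∈ homog k 0 := Dr_le_homog _ hbD
  have hw' : torus k (ind k p r c) * b ∅ = b ∅ := by
    rw [mul_comm_of_mem_homog (torus_mem_homog _) hb0, hw]
  obtain ⟨q, hq, hsum, hcase⟩ := exists_parts hr hf (b := c)
    (by rw [← hright, mul_assoc, hw]) (by rw [← hl, ← mul_assoc, hw'])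
  have m0 := proj_mem_homog 0 f
  have m1 := proj_mem_homog q f
  have m2 := proj_mem_homog (-q) f
  have v0 := proj_mem_Vr hf 0
  have v1 := proj_mem_Vr hf q
  have v2 := proj_mem_Vr hf (-q)
  generalize proj k 0 f = f₀ at *
  generalize proj k q f = f₁ at *
  generalize proj k (-q) f = f₂ at *
  have s1 : f₁ * f₁ = 0 := by
    rcases hcase with ⟨h, -⟩ | h
    · rw [h, zero_mul]
    · refine eq_zero_of_mem_Vr_of_mem_homog (mul_mem_Vr v1 v1) (mul_mem_homog m1 m1) ?_
      rw [← two_mul, h]; exact le_abs_self _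
  have s2 : f₂ * f₂ = 0 := by
    rcases hcase with ⟨-, h⟩ | h
    · rw [h, zero_mul]
    · refine eq_zero_of_mem_Vr_of_mem_homog (mul_mem_Vr v2 v2) (mul_mem_homog m2 m2) ?_
      rw [← two_mul, mul_neg, h, abs_neg]; exact le_abs_self _
  have hr' : f₀ * b ∅ = f₀ ∧ f₁ * b ∅ = f₁ ∧ f₂ * b ∅ = f₂ := by
    refine eq_of_homog_add hq ?_ ?_ ?_ m0 m1 m2 ?_
    · simpa using mul_mem_homog m0 hb0
    · simpa using mul_mem_homog m1 hb0
    · simpa using mul_mem_homog m2 hb0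
    · rw [← add_mul, ← add_mul, ← hsum, hright]
  have hl' : b ∅ * f₀ = f₀ ∧ b ∅ * f₁ = f₁ ∧ b ∅ * f₂ = f₂ := by
    refine eq_of_homog_add hq ?_ ?_ ?_ m0 m1 m2 ?_
    · simpa using mul_mem_homog hb0 m0
    · simpa using mul_mem_homog hb0 m1
    · simpa using mul_mem_homog hb0 m2
    · rw [← mul_add, ← mul_add, ← hsum, hl]
  have m12 : f₁ * f₂ ∈ homog k 0 := by simpa using mul_mem_homog m1 m2
  have m21 : f₂ * f₁ ∈ homog k 0 := by simpa using mul_mem_homog m2 m1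
  have m00 : f₀ * f₀ ∈ homog k 0 := by simpa using mul_mem_homog m0 m0
  have he : f₀ = f₀ * f₀ + f₁ * f₂ + f₂ * f₁ ∧ f₁ = f₀ * f₁ + f₁ * f₀ ∧
      f₂ = f₀ * f₂ + f₂ * f₀ := by
    refine eq_of_homog_add hq m0 m1 m2 (add_mem (add_mem m00 m12) m21) (add_mem ?_ ?_)
      (add_mem ?_ ?_) ?_
    · simpa using mul_mem_homog m0 m1
    · simpa using mul_mem_homog m1 m0
    · simpa using mul_mem_homog m0 m2
    · simpa using mul_mem_homog m2 m0
    · rw [← hsum]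
      conv_lhs => rw [← hidem, hsum]
      simp only [add_mul, mul_add, s1, s2]
      abel
  rw [hsum] at hidem ⊢
  exact hb.eq_zero_or_eq hidem (Vr_inf_homog_le v0 m0) (Vr_inf_homog_le (mul_mem_Vr v1 v2) m12)
    (Vr_inf_homog_le (mul_mem_Vr v2 v1) m21) hr'.1 hr'.2.1 hr'.2.2 hl'.2.1 hl'.2.2 s1 s2
    he.1 he.2.1 he.2.2

/-- Primitivity, in every subalgebra of `U_r` containing the idempotent. -/
theorem IsCube.isPrimitiveIdempotent {ι : Type*} [DecidableEq ι] {r : ℕ} (hr : 0 < r) {c : ℤ}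
    {S : Finset ι} {b : Finset ι → Hyper k} (hb : IsCube (Ar k p r) S b)
    (hw : b ∅ * torus k (ind k p r c) = b ∅) {R : Subalgebra k (Hyper k)} (hR : R ≤ Ur k p r)
    (he : b ∅ ∈ R) : IsPrimitiveIdempotent (⟨b ∅, he⟩ : R) := by
  refine ⟨fun h => hb.ne_zero_of_subset (Finset.empty_subset S) (congrArg Subtype.val h),
    Subtype.ext (hb.empty_mul (Finset.empty_subset S)), fun f g hf _ hfg hgf hsum => ?_⟩
  have e : (f : Hyper k) + g = b ∅ := congrArg Subtype.val hsum
  have e1 : (f : Hyper k) * f = f := congrArg Subtype.val hf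
  have e2 : (f : Hyper k) * g = 0 := congrArg Subtype.val hfg
  have e3 : (g : Hyper k) * f = 0 := congrArg Subtype.val hgf
  rcases hb.eq_zero_or_eq_of_mem_Ur hr hw (hR f.2) e1 (by rw [← e, add_mul, e1, e3, add_zero])
    (by rw [← e, mul_add, e1, e2, add_zero]) with h | h
  · exact Or.inl (Subtype.ext h)
  · right
    apply Subtype.ext
    rw [h] at e
    exact (add_eq_left.1 e)

end

/-! ### Transfer from `0`-`1`-vectors to subsets -/

section Transfer

variable {r : ℕ}

/-- The indicator vector of a set of indices. -/
def indFn (T : Finset (Fin r)) : Fin r → Fin 2 := fun i => if i ∈ T then 1 else 0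

/-- The support of a `0`-`1`-vector. -/
def supp (ε : Fin r → Fin 2) : Finset (Fin r) := Finset.univ.filter fun i => ε i = 1

theorem mem_supp {ε : Fin r → Fin 2} {i : Fin r} : i ∈ supp ε ↔ ε i = 1 := by simp [supp]

theorem indFn_apply_eq_one {T : Finset (Fin r)} {i : Fin r} : indFn T i = 1 ↔ i ∈ T := by
  simp [indFn]

theorem indFn_apply_eq_zero {T : Finset (Fin r)} {i : Fin r} : indFn T i = 0 ↔ i ∉ T := by
  simp [indFn]

theorem indFn_supp (ε : Fin r → Fin 2) : indFn (supp ε) = ε := by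
  funext i
  have : ∀ x : Fin 2, (if x = 1 then (1 : Fin 2) else 0) = x := by decide
  simpa [indFn, mem_supp] using this (ε i)

theorem supp_indFn (T : Finset (Fin r)) : supp (indFn T) = T := by
  ext i
  rw [mem_supp, indFn_apply_eq_one]

theorem indFn_empty : indFn (∅ : Finset (Fin r)) = 0 := by
  funext i
  simp [indFn]

theorem indFn_sup (T T' : Finset (Fin r)) : indFn T ⊔ indFn T' = indFn (T ∪ T') := by
  funext i
  simp only [Pi.sup_apply, indFn, Finset.mem_union]
  by_cases h : i ∈ T <;> by_cases h' : i ∈ T' <;> simp [h, h']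

theorem supp_subset_supp {ε θ : Fin r → Fin 2} : supp ε ⊆ supp θ ↔ ε ≤ θ := by
  have key : ∀ x y : Fin 2, (x = 1 → y = 1) ↔ x ≤ y := by decide
  simp only [Finset.subset_iff, mem_supp, Pi.le_def, key]

theorem hammingNorm_eq_card (ε : Fin r → Fin 2) : hammingNorm ε = (supp ε).card := by
  have key : ∀ x : Fin 2, x ≠ 0 ↔ x = 1 := by decide
  simp only [hammingNorm, supp, key]

theorem hammingDist_eq_card {ε θ : Fin r → Fin 2} (h : ε ≤ θ) :
    hammingDist θ ε = (supp θ \ supp ε).card := by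
  have key : ∀ x y : Fin 2, x ≤ y → (y ≠ x ↔ y = 1 ∧ ¬ x = 1) := by decide
  unfold hammingDist
  congr 1
  ext i
  simp [mem_supp, key _ _ (h i)]

open Classical in
/-- The set of non-degenerate indices. -/
noncomputable def ndSet (p : ℕ) (a : Fin r → ℕ) (j : Fin r → ℚ) : Finset (Fin r) :=
  Finset.univ.filter fun i => Nondeg p (a i) (j i)

theorem mem_ndSet {p : ℕ} {a : Fin r → ℕ} {j : Fin r → ℚ} {i : Fin r} :
    i ∈ ndSet p a j ↔ Nondeg p (a i) (j i) := by simp [ndSet]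

theorem supp_subset_ndSet {p : ℕ} {a : Fin r → ℕ} {j : Fin r → ℚ} {ε : Fin r → Fin 2} :
    supp ε ⊆ ndSet p a j ↔ ε ∈ Xset p r a j := by
  have key : ∀ x : Fin 2, x = 0 ↔ ¬ x = 1 := by decide
  simp only [Finset.subset_iff, mem_supp, mem_ndSet, Nondeg, Xset]
  split_ifs <;> simp only [Set.mem_ofPred_eq, key, ne_eq, imp_not_comm]

theorem tau_eq (p : ℕ) (a : Fin r → ℕ) (j : Fin r → ℚ) : tau p r a j = indFn (ndSet p a j) := by
  classical
  funext i
  simp only [tau, indFn, mem_ndSet, Nondeg]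
  split_ifs <;> simp_all

theorem wt_eq {p : ℕ} {a : Fin r → ℕ} {j : Fin r → ℚ} (h : ∀ i, (a i, j i) ∈ pairs p) :
    wt p r a j = (ndSet p a j).card := by
  classical
  unfold wt
  by_cases hp : p = 2
  · rw [if_pos hp]
    have e : ndSet p a j = Finset.univ.filter fun i => ¬ a i ≠ 0 := by
      ext i
      have hi := h i
      simp only [pairs, if_pos hp, Set.mem_insert_iff, Set.mem_singleton_iff, Prod.mk.injEq] at hi
      simp only [mem_ndSet, Nondeg, if_pos hp, Finset.mem_filter, Finset.mem_univ, true_and]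
      omega
    have h1 := Finset.card_filter_add_card_filter_not (s := Finset.univ) (fun i => a i ≠ 0)
    rw [Finset.card_univ, Fintype.card_fin, ← e] at h1
    have h2 : hammingNorm a = (Finset.univ.filter fun i => a i ≠ 0).card := rfl
    omega
  · rw [if_neg hp]
    unfold hammingNorm
    congr 1
    ext i
    simp [mem_ndSet, Nondeg, hp]

end Transfer

section

variable {k : Type*} [Field k] {p : ℕ} [Fact p.Prime] [CharP k p]

/-- The elements `B^{(ε)}`, indexed by the supports of the `ε`, form a cube-shaped basis. -/
theorem IsBlock.isCube {r : ℕ} {b : ℤ} {a : Fin r → ℕ} {j : Fin r → ℚ}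
    (h : IsBlock k p r b (fun i => Nondeg p (a i) (j i)) (fun ε => Bvec k p r ε a j)) :
    IsCube (Ar k p r) (ndSet p a j) (fun T => Bvec k p r (indFn T) a j) := by
  have hnd : ∀ T ⊆ ndSet p a j, ∀ i, ¬ Nondeg p (a i) (j i) → indFn T i = 0 := fun T hT i hi =>
    indFn_apply_eq_zero.2 fun hiT => hi (mem_ndSet.1 (hT hiT))
  refine ⟨fun u hu v hv => mul_comm_of_mem_homog (Dr_le_homog _ (mem_Ar_iff.1 hu))
    (Dr_le_homog _ (mem_Ar_iff.1 hv)), fun T _ => mem_Ar_iff.2 (h.mem _), fun T hT T' hT' hd => ?_,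
    fun T hT T' hT' hd => ?_, h.ne_zero _ (hnd _ subset_rfl), fun u hu => ?_⟩
  · have := h.mul_of_disjoint _ _ (hnd T hT) (hnd T' hT') fun i => by
      simp only [indFn_apply_eq_zero]
      by_contra! hi
      exact Finset.disjoint_left.1 hd hi.1 hi.2
    rwa [indFn_sup] at this
  · obtain ⟨i, hi, hi'⟩ := Finset.not_disjoint_iff.1 hd
    exact h.mul_eq_zero _ _ (hnd T hT) (hnd T' hT') i (indFn_apply_eq_one.2 hi)
      (indFn_apply_eq_one.2 hi')
  · have := h.mem_span u (mem_Ar_iff.1 hu)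
    simp only [indFn_empty]
    refine Submodule.span_mono ?_ this
    rintro x ⟨ε, hε, rfl⟩
    refine ⟨supp ε, fun i hi => mem_ndSet.2 ?_, by rw [indFn_supp]⟩
    by_contra hn
    rw [mem_supp, hε i hn] at hi
    exact zero_ne_one hi

end

end SL2Hyper

theorem theorem3p11 (k : Type*) [Field k] [IsAlgClosed k] (p : ℕ) [Fact p.Prime] [CharP k p]
    (r : ℕ) (hr : 0 < r) (a : Fin r → ℕ) (j : Fin r → ℚ) (haj : ∀ i, (a i, j i) ∈ pairs p) :
    -- the module `S_{(a,j)}` is simple and one-dimensional, spanned by `B^{(τ)}(a,j)`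
    (IsSimpleModule (Ar k p r) (Smod k p r a j) ∧
      Module.finrank k (Smod k p r a j) = 1 ∧
      (Smod k p r a j).restrictScalars k
        = Submodule.span k {Bvec k p r (tau p r a j) a j}) ∧
    (∀ ε ∈ Xset p r a j,
      -- the radicals
      (∀ n : ℕ,
        radPow n (ABmod k p r ε a j)
            = ⨆ θ ∈ {θ ∈ Xset p r a j | hammingDist θ ε = n ∧ ε ≤ θ}, ABmod k p r θ a j ∧
        (radPow n (ABmod k p r ε a j)).restrictScalars k
            = Submodule.span k {b | ∃ θ ∈ Xset p r a j,
                n ≤ hammingDist θ ε ∧ ε ≤ θ ∧ b = Bvec k p r θ a j}) ∧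
      -- the Loewy length
      loewyLength (ABmod k p r ε a j) = wt p r a j + 1 - hammingNorm ε ∧
      -- the radical layers
      (∀ i ≤ wt p r a j - hammingNorm ε,
        Nonempty (RadLayer i (ABmod k p r ε a j) ≃ₗ[Ar k p r]
          (Fin ((wt p r a j - hammingNorm ε).choose i) → Smod k p r a j))) ∧
      -- indecomposability and the head
      IsIndecomposable (Ar k p r) (ABmod k p r ε a j) ∧
      Nonempty (Head (ABmod k p r ε a j) ≃ₗ[Ar k p r] Smod k p r a j)) ∧
    -- primitivity of the idempotent `E(a,j) = B^{(0,…,0)}(a,j)`, in `𝒜_r` and in `U_r`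
    (∃ e : Ar k p r, (e : Hyper k) = Bvec k p r 0 a j ∧ IsPrimitiveIdempotent e) ∧
    (∃ e : Ur k p r, (e : Hyper k) = Bvec k p r 0 a j ∧ IsPrimitiveIdempotent e) := by
  obtain ⟨c, hc⟩ := exists_isBlock (k := k) r a j haj
  have hb := hc.isCube
  have hw := hc.weight
  have hS : Smod k p r a j
      = Submodule.span (Ar k p r) {Bvec k p r (indFn (ndSet p a j)) a j} := by
    rw [Smod, ABmod, tau_eq]
  have hwt := wt_eq haj
  refine ⟨?_, fun ε hε => ?_, ?_⟩
  · rw [hS, tau_eq]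
    exact ⟨hb.isSimpleModule, hb.finrank_eq_one, hb.restrictScalars_eq⟩
  · have hT := supp_subset_ndSet.2 hε
    have hM : ABmod k p r ε a j
        = Submodule.span (Ar k p r) {Bvec k p r (indFn (supp ε)) a j} := by
      rw [ABmod, indFn_supp]
    have hcard : (ndSet p a j \ supp ε).card = wt p r a j - hammingNorm ε := by
      rw [Finset.card_sdiff_of_subset hT, hwt, hammingNorm_eq_card]
    have hle : hammingNorm ε ≤ wt p r a j := by
      rw [hwt, hammingNorm_eq_card]
      exact Finset.card_le_card hT
    refine ⟨fun n => ⟨?_, ?_⟩, ?_, fun n _ => ?_, ?_, ?_⟩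
    · rw [hM, hb.radPow_eq_iSup hT n]
      refine le_antisymm (iSup₂_le fun T' hT' => ?_) (iSup₂_le fun θ hθ => ?_)
      · obtain ⟨h1, h2, h3⟩ := hT'
        rw [← supp_indFn T'] at h1 h2 h3
        have h4 := supp_subset_supp.1 h3
        exact le_iSup₂_of_le (indFn T') ⟨supp_subset_ndSet.1 h1,
          by rw [hammingDist_eq_card h4, h2], h4⟩ le_rfl
      · obtain ⟨h1, h2, h3⟩ := hθ
        refine le_iSup₂_of_le (supp θ) ⟨supp_subset_ndSet.2 h1,
          by rw [← hammingDist_eq_card h3, h2], supp_subset_supp.2 h3⟩ ?_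
        rw [indFn_supp, ABmod]
    · ext v
      rw [Submodule.restrictScalars_mem, hM, hb.mem_radPow_iff hT n, cubeFilt]
      suffices h : {x | ∃ T' ⊆ ndSet p a j, n ≤ (T' \ supp ε).card ∧ supp ε ⊆ T' ∧
          x = Bvec k p r (indFn T') a j} = {b | ∃ θ ∈ Xset p r a j,
          n ≤ hammingDist θ ε ∧ ε ≤ θ ∧ b = Bvec k p r θ a j} by rw [h]
      ext x
      constructor
      · rintro ⟨T', h1, h2, h3, h4⟩
        rw [← supp_indFn T'] at h1 h2 h3
        have h5 := supp_subset_supp.1 h3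
        exact ⟨indFn T', supp_subset_ndSet.1 h1, by rwa [hammingDist_eq_card h5], h5, h4⟩
      · rintro ⟨θ, h1, h2, h3, h4⟩
        exact ⟨supp θ, supp_subset_ndSet.2 h1, by rwa [← hammingDist_eq_card h3],
          supp_subset_supp.2 h3, by rwa [indFn_supp]⟩
    · rw [hM, hb.loewyLength_eq hT, hcard]
      omega
    · rw [hM, hS, ← hcard]
      exact hb.nonempty_radLayer_equiv hT n
    · rw [hM]
      exact hb.isIndecomposable hT
    · rw [hM, hS]
      exact hb.nonempty_head_equiv hT
  · have hmem := hb.mem ∅ (Finset.empty_subset _)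
    have hw' : Bvec k p r (indFn ∅) a j * torus k (ind k p r c) = Bvec k p r (indFn ∅) a j := by
      rw [indFn_empty]
      exact hw
    have e0 : Bvec k p r (indFn ∅) a j = Bvec k p r 0 a j := by rw [indFn_empty]
    exact ⟨⟨⟨_, hmem⟩, e0, hb.isPrimitiveIdempotent hr hw' inf_le_right hmem⟩,
      ⟨⟨_, hmem.2⟩, e0, hb.isPrimitiveIdempotent hr hw' le_rfl hmem.2⟩⟩
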